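/- **Oblivious state preparation implies blind classical delegation.** *Conventions.* Parties are (non-uniform) families of circuits of polynomial size. A classical client runs a randomised Boolean circuit and a quantum server runs a quantum circuit over the gates $H$, $P=\mathrm{diag}(1,i)$, $T^\dagger=\mathrm{diag}(1,e^{-i\pi/4})$, $\mathsf{CNOT}$, and resetting a qubit to $|0\rangle$; they exchange classical bits in a fixed, input-independent schedule. A function $f$ is negligible if for each $c$ we have $f(\lambda)<\lambda^{-c}$ for all large $\lambda$. *Oblivious state preparation (OSP).* A polynomial-size protocol $(s,\psi)\leftarrow\langle S(1^\lambda,b),R(1^\lambda)\rangle$ between a classical sender with input $b\in\{0,1\}$ and output $s\in\{0,1\}$ and a quantum receiver with a one-qubit output $\psi$ such that (correctness) for each $b$ the output $(s,\psi)$ passes the projective measurement onto $\sum_s|s\rangle\langle s|\otimes H^b|s\rangle\langle s|H^b$ with probability $1-\mathrm{negl}(\lambda)$, and (security) for every polynomial-size quantum adversary in the role of the receiver, the probabilities that it outputs $0$ for $b=0$ and for $b=1$ differ by at most $\mathrm{negl}(\lambda)$. *Blind classical delegation.* A protocol $(\mathcal W,(r,s))\leftarrow\langle S(1^\lambda,Q,\mathcal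 V),C(1^\lambda,Q,x)\rangle$ for every security parameter $\lambda$ and every public quantum circuit $Q$ over the gates above, where $Q$ takes a classical string $x\in\{0,1\}^n$, an input register $\mathcal V$ and ancillas $|0\rangle$, and outputs a register $\mathcal W$ formed by some of its wires, the others being discarded. The size of both parties is bounded by a polynomial in $\lambda+|Q|$, and for every family $(Q_\lambda)$ of circuits of polynomial size: * Correctness: for every family of inputs $x_\lambda$, the diamond distance between the map $\mathcal V\to\mathcal W$ obtained by running the protocol honestly on $(Q_\lambda,x_\lambda)$ and then applying $X^rZ^s$ to $\mathcal W$, where $(r,s)$ are the client's outputs, and the map $Q_\lambda(x_\lambda,\cdot)$ is negligible in $\lambda$. * Security: for all families of inputs $x_{0,\lambda},x_{1,\lambda}$ of the input length of $Q_\lambda$ and every polynomial-size quantum adversary in the role of the server, the probabilities that it outputs $0$ when interacting with $C(1^\lambda,Q_\lambda,x_{0,\lambda})$ and with $C(1^\lambda,Q_\lambda,x_{1,\lambda})$ differ by at most $\mathrm{negl}(\lambda)$. **Theorem.** OSP implies blind classical delegation of quantum computation. More precisely, for every such circuit $Q$ there is a delegation protocol $\mathcal T(Q)$, depending only on $Q$,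 that uses OSP as a black-box subroutine (with the client as sender and the server as receiver) and executes it exactly once per $T^\dagger$ gate of $Q$, such that for every OSP $\Pi=(\Pi_\lambda)_\lambda$ the protocols obtained by running $\mathcal T(Q)$ with $\Pi_\lambda$ as the subroutine form a protocol for blind classical delegation of quantum computation. -/

import Mathlib

open scoped ENNReal ComplexOrder

noncomputable section

namespace OSP

/-! ### Asymptotics -/

/-- `f` is negligible: eventually smaller than every inverse power. -/
def Negligible (f : ℕ → ℝ) : Prop :=
  ∀ c : ℕ, ∃ N : ℕ, ∀ n : ℕ, N < n → f n < ((n : ℝ) ^ c)⁻¹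

/-- `f` is polynomially bounded: eventually smaller than some power. -/
def PolyBounded (f : ℕ → ℕ) : Prop :=
  ∃ c N : ℕ, ∀ n : ℕ, N < n → f n < n ^ c

/-! ### Linear algebra on qubit registers

A register with wires `W` has computational basis `W → Bool`; its (unnormalised, mixed) states are
matrices indexed by this basis. -/

/-- Operators on the register with wire set `W`. -/
abbrev Op (W : Type) := Matrix (W → Bool) (W → Bool) ℂ

/-- The Hadamard gate. -/
def hMat : Matrix Bool Bool ℂ :=
  Matrix.of fun a b => (if a && b then -1 else 1) / (Real.sqrt 2 : ℂ)

/-- The phase gate `P = diag(1, i)`. -/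
def pMat : Matrix Bool Bool ℂ :=
  Matrix.diagonal fun b => if b then Complex.I else 1

/-- The gate `T† = diag(1, exp(-iπ/4))`. -/
def tdgMat : Matrix Bool Bool ℂ :=
  Matrix.diagonal fun b => if b then Complex.exp (-(Real.pi / 4 : ℝ) * Complex.I) else 1

section
variable {W : Type} [Fintype W] [DecidableEq W]

/-- The one-qubit operator `u` on wire `q`, tensored with the identity on all other wires. -/
def onWire (q : W) (u : Matrix Bool Bool ℂ) : Op W :=
  Matrix.of fun w w' => if ∀ j, j ≠ q → w j = w' j then u (w q) (w' q) else 0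

/-- CNOT with control `c` and target `t` (used for `c ≠ t` only). -/
def cnotMat (c t : W) : Op W :=
  Matrix.of fun w w' => if w = Function.update w' t (xor (w' t) (w' c)) then 1 else 0

/-- Discard the content of wire `q` and prepare it afresh in the state `|b⟩`. -/
def setWire (q : W) (b : Bool) (ρ : Op W) : Op W :=
  Matrix.of fun w w' =>
    if w q = b ∧ w' q = b then
      ∑ d : Bool, ρ (Function.update w q d) (Function.update w' q d)
    else 0

/-- Project wire `q` onto `|b⟩` (the unnormalised state after the measurement outcome `b`). -/
def projWire (q : W) (b : Bool) (ρ : Op W) : Op W :=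
  Matrix.of fun w w' => if w q = b ∧ w' q = b then ρ w w' else 0

/-- The register `W` with the state `ρ` on the wires in the image of `f` and the other wires in the
computational basis state `d`. -/
def load {A : Type} [Fintype A] [DecidableEq A] (f : A ↪ W) (d : W → Bool) (ρ : Op A) : Op W :=
  Matrix.of fun w w' =>
    if ∀ i, (∀ j, f j ≠ i) → w i = d i ∧ w' i = d i then ρ (w ∘ f) (w' ∘ f) else 0

/-- Partial trace over all wires outside the image of `f`. -/
def extract {A : Type} [Fintype A] [DecidableEq A] (f : A ↪ W) (ρ : Op W) : Op A :=
  Matrix.of fun u u' => ∑ w : W → Bool, ∑ w' : W → Bool,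
    if w ∘ f = u ∧ w' ∘ f = u' ∧ ∀ i, (∀ j, f j ≠ i) → w i = w' i then ρ w w' else 0

/-- The Pauli operator `X^r Z^s`, i.e. `|y⟩ ↦ (-1)^{s·y} |y ⊕ r⟩`. -/
def pauli (r s : W → Bool) : Op W :=
  Matrix.of fun u y =>
    if u = (fun i => xor (y i) (r i)) then ∏ i, (if s i && y i then (-1 : ℂ) else 1) else 0

end

/-- The trace norm `‖A‖₁ = Tr √(A† A)`. -/
def traceNorm {I : Type} [Fintype I] [DecidableEq I] (A : Matrix I I ℂ) : ℝ :=
  ∑ i, Real.sqrt ((Matrix.isHermitian_conjTranspose_mul_self A).eigenvalues i)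

/-- Density matrices. -/
def IsDensity {I : Type} [Fintype I] (ρ : Matrix I I ℂ) : Prop :=
  ρ.PosSemidef ∧ ρ.trace = 1

/-- `Φ ⊗ id` for a linear map `Φ` on matrices: `Φ` is applied to every block of `ρ`. -/
def ampl {I J B : Type} (Φ : Matrix I I ℂ → Matrix J J ℂ) (ρ : Matrix (I × B) (I × B) ℂ) :
    Matrix (J × B) (J × B) ℂ :=
  Matrix.of fun p p' => Φ (Matrix.of fun a a' => ρ (a, p.2) (a', p'.2)) p.1 p'.1

/-- The diamond distance: the supremum of `‖(Φ ⊗ id) ρ - (Ψ ⊗ id) ρ‖₁` over all states `ρ` of the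
input together with an auxiliary system of any finite dimension `m`. -/
def diamondDist {I J : Type} [Fintype I] [Fintype J] [DecidableEq J]
    (Φ Ψ : Matrix I I ℂ → Matrix J J ℂ) : ℝ≥0∞ :=
  ⨆ (m : ℕ) (ρ : Matrix (I × Fin m) (I × Fin m) ℂ) (_ : IsDensity ρ),
    ENNReal.ofReal (traceNorm (ampl Φ ρ - ampl Ψ ρ))

/-! ### Quantum circuits -/

/-- Elementary operations of a quantum circuit: the Clifford+`T†` gates and the replacement of a
wire by a fresh `|0⟩`. (A computational basis measurement is a CNOT onto a fresh wire that
is reset or discarded afterwards.) -/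
inductive Gate (W : Type) where
  | h (q : W)
  | p (q : W)
  | tdg (q : W)
  | cnot (c t : W) (ne : c ≠ t)
  | reset (q : W)

/-- Relabelling of wires. -/
def Gate.map {W W' : Type} (f : W ↪ W') : Gate W → Gate W'
  | .h q => .h (f q)
  | .p q => .p (f q)
  | .tdg q => .tdg (f q)
  | .cnot c t ne => .cnot (f c) (f t) (fun e => ne (f.injective e))
  | .reset q => .reset (f q)

/-- Is this a `T†` gate? -/
def Gate.isTdg {W : Type} : Gate W → Bool
  | .tdg _ => true
  | _ => false

/-- Conjugation `ρ ↦ U ρ U†`. -/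
def conj {I : Type} [Fintype I] (U ρ : Matrix I I ℂ) : Matrix I I ℂ :=
  U * ρ * U.conjTranspose

/-- The quantum operation implemented by a gate. -/
def Gate.apply {W : Type} [Fintype W] [DecidableEq W] : Gate W → Op W → Op W
  | .h q, ρ => conj (onWire q hMat) ρ
  | .p q, ρ => conj (onWire q pMat) ρ
  | .tdg q, ρ => conj (onWire q tdgMat) ρ
  | .cnot c t _, ρ => conj (cnotMat c t) ρ
  | .reset q, ρ => setWire q false ρ

/-- A (general, not necessarily unitary) quantum circuit `Q` with `n` classical input bits, `v` input
qubits (the register `V`), `a` ancilla qubits in state `|0⟩`, and `w` output qubits (the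
register `W`); the wires that are not output wires are discarded. -/
structure QCircuit where
  n : ℕ
  v : ℕ
  a : ℕ
  w : ℕ
  gates : List (Gate (Fin n ⊕ (Fin v ⊕ Fin a)))
  out : Fin w ↪ (Fin n ⊕ (Fin v ⊕ Fin a))

namespace QCircuit

/-- Number of wires plus number of gates. -/
def size (Q : QCircuit) : ℕ := Q.n + Q.v + Q.a + Q.gates.length

/-- Number of `T†` gates. -/
def tCount (Q : QCircuit) : ℕ := Q.gates.countP Gate.isTdg

/-- The wires of the register `V`. -/
def vWires (Q : QCircuit) : Fin Q.v ↪ (Fin Q.n ⊕ (Fin Q.v ⊕ Fin Q.a)) :=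
  ⟨fun j => Sum.inr (Sum.inl j), fun _ _ e => Sum.inl.inj (Sum.inr.inj e)⟩

/-- The quantum operation `Q(x, ·)` from `V` to `W`. -/
def ideal (Q : QCircuit) (x : Fin Q.n → Bool) (ρ : Op (Fin Q.v)) : Op (Fin Q.w) :=
  extract Q.out
    (Q.gates.foldl (fun σ g => g.apply σ)
      (load Q.vWires (Sum.elim x (fun _ => false)) ρ))

end QCircuit

/-! ### Interaction of a classical randomised party with a quantum party

The classical party (client) has a memory of bits `K` and runs a randomised Boolean straight-line program.
The quantum party (server) has qubits `W` and runs a quantum circuit. They exchange classical bits, one at a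
time. -/

/-- Local steps of the client: write a constant, a NAND, or a uniformly random bit to memory cell
`t`. -/
inductive CLocal (K : Type) where
  | const (t : K) (b : Bool)
  | nand (i j t : K)
  | coin (t : K)

/-- Steps of the client: a local step, sending the bit in cell `i`, or receiving a bit into cell `i`. -/
inductive CInstr (K : Type) where
  | loc (c : CLocal K)
  | send (i : K)
  | recv (i : K)

/-- Steps of the server: a gate, or taking part in the next transmission of a bit with wire `q`. The
direction of that transmission is the one of the client's next message: if the client sends, `q` is
overwritten by the bit; if the client receives, `q` is measured in the computational basis and the outcome is
sent. -/
inductive SInstr (W : Type) where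
  | gate (g : Gate W)
  | comm (q : W)

def CLocal.map {K K' : Type} (f : K → K') : CLocal K → CLocal K'
  | .const t b => .const (f t) b
  | .nand i j t => .nand (f i) (f j) (f t)
  | .coin t => .coin (f t)

def CInstr.map {K K' : Type} (f : K → K') : CInstr K → CInstr K'
  | .loc c => .loc (c.map f)
  | .send i => .send (f i)
  | .recv i => .recv (f i)

def SInstr.map {W W' : Type} (f : W ↪ W') : SInstr W → SInstr W'
  | .gate g => .gate (g.map f)
  | .comm q => .comm (f q)

def CInstr.isComm {K : Type} : CInstr K → Bool
  | .loc _ => false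
  | _ => true

def SInstr.isComm {W : Type} : SInstr W → Bool
  | .gate _ => false
  | .comm _ => true

/-- Joint states: for every content of the client's memory, the unnormalised state of the server
(its trace is the probability of this content). -/
abbrev JState (K W : Type) := (K → Bool) → Op W

section
variable {K W : Type} [Fintype K] [DecidableEq K] [Fintype W] [DecidableEq W]

/-- A deterministic update `f` of the client's memory. -/
def pushMem (f : (K → Bool) → (K → Bool)) (σ : JState K W) : JState K W :=
  fun m => ∑ m' : K → Bool, if f m' = m then σ m' else 0

def CLocal.apply : CLocal K → JState K W → JState K W
  | .const t b, σ => pushMem (fun m => Function.update m t b) σ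
  | .nand i j t, σ => pushMem (fun m => Function.update m t (!(m i && m j))) σ
  | .coin t, σ => fun m => (1 / 2 : ℂ) • ∑ b : Bool, σ (Function.update m t b)

/-- The client sends the bit in cell `i`; it arrives in wire `q`. -/
def toServer (i : K) (q : W) (σ : JState K W) : JState K W :=
  fun m => setWire q (m i) (σ m)

/-- The server measures wire `q` and sends the outcome; it arrives in cell `i`. -/
def toClient (q : W) (i : K) (σ : JState K W) : JState K W :=
  fun m => ∑ d : Bool, projWire q (m i) (σ (Function.update m i d))

/-- The interaction of a client program with a server program. If the server stops taking part
although the client is not done, the client's messages are lost and it receives the bit `0`; once the client is done,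
the remaining gates of the server are applied. -/
def interact : List (CInstr K) → List (SInstr W) → JState K W → JState K W
  | [], [], σ => σ
  | [], .gate g :: ss, σ => interact [] ss (fun m => g.apply (σ m))
  | [], .comm _ :: ss, σ => interact [] ss σ
  | .loc c :: cs, ss, σ => interact cs ss (c.apply σ)
  | .send i :: cs, .gate g :: ss, σ => interact (.send i :: cs) ss (fun m => g.apply (σ m))
  | .recv i :: cs, .gate g :: ss, σ => interact (.recv i :: cs) ss (fun m => g.apply (σ m))
  | .send i :: cs, .comm q :: ss, σ => interact cs ss (toServer i q σ)
  | .recv i :: cs, .comm q :: ss, σ => interact cs ss (toClient q i σ)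
  | .send _ :: cs, [], σ => interact cs [] σ
  | .recv i :: cs, [], σ => interact cs [] ((CLocal.const i false).apply σ)
termination_by cs ss _ => cs.length + ss.length

/-- The joint state with client memory `m₀` and server state `ρ`. -/
def initState (m₀ : K → Bool) (ρ : Op W) : JState K W :=
  fun m => if m = m₀ then ρ else 0

/-- The server state `|0…0⟩⟨0…0|`. -/
def zeroState : Op W := Matrix.single (fun _ => false) (fun _ => false) 1

/-- The probability that measuring wire `q` of the server gives `0`. -/
def probZero (q : W) (σ : JState K W) : ℝ :=
  ∑ m : K → Bool, (projWire q false (σ m)).trace.re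

end

/-- A protocol between a classical client and a quantum server, with `k` bits of client memory, `N`
server qubits, and the same number of transmissions in both programs. -/
structure Protocol where
  k : ℕ
  N : ℕ
  client : List (CInstr (Fin k))
  server : List (SInstr (Fin N))
  sync : client.countP CInstr.isComm = server.countP SInstr.isComm

/-- Number of bits, qubits and steps. -/
def Protocol.size (P : Protocol) : ℕ := P.k + P.N + P.client.length + P.server.length

/-- A quantum adversary: a server of its own with initial state `|0…0⟩`, whose one-bit output is the
measurement outcome of wire `out` after the interaction. -/
structure Adversary where
  N : ℕ
  prog : List (SInstr (Fin N))
  out : Fin N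

def Adversary.size (A : Adversary) : ℕ := A.N + A.prog.length

/-- The probability that the adversary outputs `0` after interacting with the client program `client`
started with memory `m₀`. -/
def Adversary.prob (A : Adversary) {k : ℕ} (client : List (CInstr (Fin k))) (m₀ : Fin k → Bool) : ℝ :=
  probZero A.out (interact client A.prog (initState m₀ zeroState))

/-! ### Oblivious state preparation -/

/-- The syntax of an OSP protocol: the sender is the classical client, with input bit in cell `bIn` and
output bit in cell `sOut`; the receiver is the quantum server, with output qubit `qOut`. -/
structure OSPProtocol extends Protocol where
  bIn : Fin k
  sOut : Fin k
  qOut : Fin N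

namespace OSPProtocol

/-- The initial memory of the sender with input `b`. -/
def initMem (P : OSPProtocol) (b : Bool) : Fin P.k → Bool :=
  Function.update (fun _ => false) P.bIn b

/-- The one-qubit projector `H^b |s⟩⟨s| H^b`. -/
def proj (b s : Bool) : Matrix Bool Bool ℂ :=
  if b then hMat * Matrix.single s s 1 * hMat else Matrix.single s s 1

/-- The probability that the outputs `(s, ψ)` of an honest execution on input `b` pass the projection
onto `∑ₛ |s⟩⟨s| ⊗ H^b |s⟩⟨s| H^b`. -/
def correctProb (P : OSPProtocol) (b : Bool) : ℝ :=
  ∑ m : Fin P.k → Bool,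
    (onWire P.qOut (proj b (m P.sOut)) *
      interact P.client P.server (initState (P.initMem b) zeroState) m).trace.re

end OSPProtocol

/-- The family `P` (indexed by the security parameter) is an oblivious state preparation protocol:
polynomial-size parties, correctness, and security against every polynomial-size quantum adversary. -/
structure IsOSP (P : ℕ → OSPProtocol) : Prop where
  poly : PolyBounded fun l => (P l).toProtocol.size
  correct : ∀ b : Bool, Negligible fun l => 1 - (P l).correctProb b
  secure : ∀ A : ℕ → Adversary, PolyBounded (fun l => (A l).size) →
    Negligible fun l =>
      |(A l).prob (P l).client ((P l).initMem false) - (A l).prob (P l).client ((P l).initMem true)|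

/-! ### Blind classical delegation of quantum computation -/

/-- The syntax of a protocol for delegating a circuit `Q`: the client has the input `x` in the cells `xIn` and
the output strings `(r, s)` in the cells `rOut`, `sOut`; the server has the input register `V` in the wires
`vIn` and the output register `W` in the wires `wOut`. -/
structure Delegation (Q : QCircuit) extends Protocol where
  xIn : Fin Q.n ↪ Fin k
  rOut : Fin Q.w → Fin k
  sOut : Fin Q.w → Fin k
  vIn : Fin Q.v ↪ Fin N
  wOut : Fin Q.w ↪ Fin N

namespace Delegation

variable {Q : QCircuit}

/-- The initial memory of the client with input `x`. -/
def initMem (D : Delegation Q) (x : Fin Q.n → Bool) : Fin D.k → Bool :=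
  fun i => decide (∃ j, D.xIn j = i ∧ x j = true)

/-- The map from `V` to `W` induced by an honest execution on `x` followed by `X^r Z^s` on `W`. -/
def real (D : Delegation Q) (x : Fin Q.n → Bool) (ρ : Op (Fin Q.v)) : Op (Fin Q.w) :=
  ∑ m : Fin D.k → Bool,
    conj (pauli (m ∘ D.rOut) (m ∘ D.sOut))
      (extract D.wOut
        (interact D.client D.server
          (initState (D.initMem x) (load D.vIn (fun _ => false) ρ)) m))

end Delegation

/-- The family `D` (indexed by the security parameter and the public circuit) is a protocol for blind classical
delegation of quantum computation: parties of size polynomial in the security parameter and the size of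
the circuit, and, for all polynomial-size families of circuits, correctness up to a quantum one-time pad known to
the client, and hiding of the client's input. -/
structure IsBlindDelegation (D : ℕ → (Q : QCircuit) → Delegation Q) : Prop where
  poly : ∃ c : ℕ, ∀ (l : ℕ) (Q : QCircuit), (D l Q).toProtocol.size ≤ c * (l + Q.size + 1) ^ c
  correct : ∀ Q : ℕ → QCircuit, PolyBounded (fun l => (Q l).size) →
    ∀ x : (l : ℕ) → Fin (Q l).n → Bool,
      ∃ ν : ℕ → ℝ, Negligible ν ∧
        ∀ l, diamondDist ((D l (Q l)).real (x l)) ((Q l).ideal (x l)) ≤ ENNReal.ofReal (ν l)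
  secure : ∀ Q : ℕ → QCircuit, PolyBounded (fun l => (Q l).size) →
    ∀ A : ℕ → Adversary, PolyBounded (fun l => (A l).size) →
    ∀ x₀ x₁ : (l : ℕ) → Fin (Q l).n → Bool,
      Negligible fun l =>
        |(A l).prob (D l (Q l)).client ((D l (Q l)).initMem (x₀ l)) -
          (A l).prob (D l (Q l)).client ((D l (Q l)).initMem (x₁ l))|

/-! ### Protocols that execute an OSP protocol as a subroutine -/

/-- Steps of a protocol with OSP calls. `osp b s q` is an execution of an OSP protocol in which the
client is the sender, with input bit in cell `b` and output bit to be stored in cell `s`, and the server is the receiver,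
with output qubit to be stored in wire `q`. -/
inductive HInstr (k N : ℕ) where
  | client (c : CLocal (Fin k))
  | server (g : Gate (Fin N))
  | toServer (i : Fin k) (q : Fin N)
  | toClient (q : Fin N) (i : Fin k)
  | osp (b s : Fin k) (q : Fin N)

def HInstr.isOSP {k N : ℕ} : HInstr k N → Bool
  | .osp _ _ _ => true
  | _ => false

/-- Copy the bit in cell `i` to cell `t`. -/
def copyBit {K : Type} (i t : K) : List (CInstr K) :=
  [.loc (.nand i i t), .loc (.nand t t t)]

/-- The client's steps, with `P` run on `P.k` additional memory cells. -/
def HInstr.toC {k N : ℕ} (P : OSPProtocol) : HInstr k N → List (CInstr (Fin (k + P.k)))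
  | .client c => [.loc (c.map (Fin.castAdd P.k))]
  | .server _ => []
  | .toServer i _ => [.send (Fin.castAdd P.k i)]
  | .toClient _ i => [.recv (Fin.castAdd P.k i)]
  | .osp b s _ =>
      (List.finRange P.k).map (fun j => .loc (.const (Fin.natAdd k j) false)) ++
      copyBit (Fin.castAdd P.k b) (Fin.natAdd k P.bIn) ++
      P.client.map (CInstr.map (Fin.natAdd k)) ++
      copyBit (Fin.natAdd k P.sOut) (Fin.castAdd P.k s)

theorem castAdd_ne_natAdd {N M : ℕ} (i : Fin N) (j : Fin M) : Fin.castAdd M i ≠ Fin.natAdd N j := by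
  intro e
  have h := congrArg Fin.val e
  simp at h
  omega

/-- The server's steps, with `P` run on `P.N` additional qubits; at the end of a call the output
qubit is swapped into its destination. -/
def HInstr.toS {k N : ℕ} (P : OSPProtocol) : HInstr k N → List (SInstr (Fin (N + P.N)))
  | .client _ => []
  | .server g => [.gate (g.map (Fin.castAddEmb P.N))]
  | .toServer _ q => [.comm (Fin.castAdd P.N q)]
  | .toClient q _ => [.comm (Fin.castAdd P.N q)]
  | .osp _ _ q =>
      (List.finRange P.N).map (fun j => .gate (.reset (Fin.natAdd N j))) ++
      P.server.map (SInstr.map (Fin.natAddEmb N)) ++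
      [.gate (.cnot (Fin.castAdd P.N q) (Fin.natAdd N P.qOut) (castAdd_ne_natAdd _ _)),
       .gate (.cnot (Fin.natAdd N P.qOut) (Fin.castAdd P.N q) (castAdd_ne_natAdd _ _).symm),
       .gate (.cnot (Fin.castAdd P.N q) (Fin.natAdd N P.qOut) (castAdd_ne_natAdd _ _))]

/-- A protocol with OSP calls for delegating the circuit `Q`. -/
structure Template (Q : QCircuit) where
  k : ℕ
  N : ℕ
  prog : List (HInstr k N)
  xIn : Fin Q.n ↪ Fin k
  rOut : Fin Q.w → Fin k
  sOut : Fin Q.w → Fin k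
  vIn : Fin Q.v ↪ Fin N
  wOut : Fin Q.w ↪ Fin N

namespace Template

variable {Q : QCircuit}

/-- The number of executions of the OSP protocol. -/
def ospCalls (T : Template Q) : ℕ := T.prog.countP HInstr.isOSP

theorem sync_aux {k N : ℕ} (P : OSPProtocol) (p : List (HInstr k N)) :
    (p.flatMap (HInstr.toC P)).countP CInstr.isComm =
      (p.flatMap (HInstr.toS P)).countP SInstr.isComm := by
  induction p with
  | nil => rfl
  | cons a p ih =>
    rw [List.flatMap_cons, List.flatMap_cons, List.countP_append, List.countP_append, ih]
    congr 1
    cases a with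
    | client c => rfl
    | server g => rfl
    | toServer i q => rfl
    | toClient q i => rfl
    | osp b s q =>
      have hc : (P.client.map (CInstr.map (Fin.natAdd k))).countP CInstr.isComm =
          P.client.countP CInstr.isComm := by
        rw [List.countP_map]; congr 1; funext c; cases c <;> rfl
      have hs : (P.server.map (SInstr.map (Fin.natAddEmb N))).countP SInstr.isComm =
          P.server.countP SInstr.isComm := by
        rw [List.countP_map]; congr 1; funext c; cases c <;> rfl
      have h1 : ((List.finRange P.k).map (fun j => CInstr.loc (.const (Fin.natAdd k j) false))).countP
          CInstr.isComm = 0 := by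
        rw [List.countP_map, List.countP_eq_zero]; intro a _; simp [CInstr.isComm]
      have h2 : ((List.finRange P.N).map (fun j => SInstr.gate (.reset (Fin.natAdd N j)))).countP
          SInstr.isComm = 0 := by
        rw [List.countP_map, List.countP_eq_zero]; intro a _; simp [SInstr.isComm]
      simp only [HInstr.toC, copyBit, HInstr.toS, List.countP_append, hc, hs, h1, h2, P.sync]
      simp [CInstr.isComm, SInstr.isComm]

/-- The protocol obtained by executing `P` for every OSP call. -/
def expand (T : Template Q) (P : OSPProtocol) : Delegation Q where
  k := T.k + P.k
  N := T.N + P.N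
  client := T.prog.flatMap (HInstr.toC P)
  server := T.prog.flatMap (HInstr.toS P)
  sync := sync_aux P T.prog
  xIn := T.xIn.trans (Fin.castAddEmb P.k)
  rOut := fun i => Fin.castAdd P.k (T.rOut i)
  sOut := fun i => Fin.castAdd P.k (T.sOut i)
  vIn := T.vIn.trans (Fin.castAddEmb P.N)
  wOut := T.wOut.trans (Fin.castAddEmb P.N)

end Template

end OSP

end

set_option linter.unusedSectionVars false
set_option linter.unusedVariables false

noncomputable section

namespace OSP

open Function (update extend)

/-! ### Entrywise description of the elementary operations -/

section
variable {W : Type} [Fintype W] [DecidableEq W]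

/-! The server computes on data hidden by a quantum one-time pad `X^r Z^s` whose keys stay with the
client. Paulis pass through Clifford gates at the price of a classical key update (`pad_h`, `pad_p`,
`pad_cnot`), an overwritten wire may be given any new key (`pad_setWire`), and the keys of discarded
wires are irrelevant (`pad_extract`). Only `T†` is different: up to a phase `T† X = X P T†`, so a
wire with X-key `r` acquires an unwanted `P^r`, which has to be removed without revealing `r`. An
OSP call on input `r` gives the server `H^r|d⟩` and the client `d`. Up to a phase, `H P†` turns this
qubit into `(|0⟩ + i^r (-1)^d |1⟩)/√2`. A CNOT from the data wire onto it and a measurement with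
outcome `c` apply `P^r` to the data, up to `Z^(d + r c)`, which the client adds to its key. As `P X
P = X` up to a phase, the error is gone (`conj_proj`, `extract_correction`, `correction_sum`). With
ideal OSP outputs the template therefore implements `Q` exactly (`channel_template`).

Correctness with a real OSP. Tracing out the cells and wires of the subroutine turns a run of the
expanded protocol into a run of the template in which each call hands out the one-qubit states
`outState` (`red_osp`, `red_interact`, `real_expand`). Each of these is a multiple of the ideal
projector plus a difference of two positive operators of small trace
(`exists_rank_one_decomposition`). Replacing the calls by ideal ones accumulates such differences
linearly in the number of calls, also in the presence of a reference system (`exists_perturbation`),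
and the trace norm of a difference of positive operators is at most the sum of their traces
(`traceNorm_sub_le`). An OSP error `ε` costs at most `2 · tCount · (ε + 2√ε)` in diamond distance.

Blindness. Apart from the messages inside OSP calls, the client sends only its input bits masked by
fresh coins. If all OSP calls had input `0`, the effect of the client's program on the server would
not depend on the client's memory at all (`Oblivious`, `oblivious_inputBlock`, `oblivious_zeroC`).
The inputs of the calls are replaced by `0` from the last call to the first (`exists_hybrid`). When
a call is replaced, all later ones already have input `0`, so the rest of the program is oblivious
and a receiver attacking OSP can simulate it without knowing the sender's output bit. Such a
receiver simulates the client and the adversary before the call, lets the adversary play the call,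
simulates the rest, and outputs `0` if the key bit was `1` and the adversary outputs `0`. The calls
with key bit `0` are the same in both hybrids, so its advantage is exactly the difference of the two
hybrids (`exists_hybrid_step`).

An adversary is a pure circuit over the fixed gate set, so the randomised classical client has to be
simulated by quantum gates. Memory cells become wires kept free of coherence, NAND is built from
Clifford and `T†` gates (`flipBit_conj_and`), and coins are measured `|+⟩` states
(`exists_simulation`, `exists_reduction`). -/

theorem onWire_mul_apply {J : Type} (q : W) (u : Matrix Bool Bool ℂ)
    (M : Matrix (W → Bool) J ℂ) (w : W → Bool) (j : J) :
    (onWire q u * M) w j = ∑ a : Bool, u (w q) a * M (update w q a) j := by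
  have key : ∀ v : W → Bool, onWire q u w v = ∑ a : Bool, if v = update w q a then u (w q) a else 0 := by
    intro v
    by_cases h : ∀ j, j ≠ q → w j = v j
    · have hv : v = update w q (v q) := by
        funext j
        by_cases hj : j = q
        · subst hj; simp
        · simp [hj, h j hj]
      have : ∀ a, (v = update w q a) ↔ a = v q := by
        intro a
        constructor
        · intro e; rw [e]; simp
        · rintro rfl; exact hv
      simp only [this, Finset.sum_ite_eq', Finset.mem_univ, if_true]
      simp only [onWire, Matrix.of_apply, if_pos h]
    · rw [Finset.sum_eq_zero]
      · simp only [onWire, Matrix.of_apply, if_neg h]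
      · intro a _
        rw [if_neg]
        rintro rfl
        exact h fun j hj => by simp [hj]
  simp only [Matrix.mul_apply, key, Finset.sum_mul]
  rw [Finset.sum_comm]
  simp

theorem conj_mul {I : Type} [Fintype I] (A B ρ : Matrix I I ℂ) :
    conj (A * B) ρ = conj A (conj B ρ) := by
  simp [conj, Matrix.mul_assoc, Matrix.conjTranspose_mul]

theorem conj_onWire_apply (q : W) (u : Matrix Bool Bool ℂ) (ρ : Op W) (w w' : W → Bool) :
    conj (onWire q u) ρ w w' = ∑ a : Bool, ∑ b : Bool,
      u (w q) a * star (u (w' q) b) * ρ (update w q a) (update w' q b) := by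
  -- Written as `(U (U ρ)†)†`, the conjugation consists of two left multiplications, so the previous
  -- lemma is enough.
  have h : conj (onWire q u) ρ = (onWire q u * (onWire q u * ρ).conjTranspose).conjTranspose := by
    simp [conj, Matrix.conjTranspose_mul]
  rw [h, Matrix.conjTranspose_apply, onWire_mul_apply]
  simp only [Matrix.conjTranspose_apply, onWire_mul_apply, star_sum, star_mul', star_star, Finset.mul_sum]
  rw [Finset.sum_comm]
  refine Finset.sum_congr rfl fun a _ => Finset.sum_congr rfl fun b _ => ?_
  ring

/-- The map on basis labels implemented by CNOT. -/
def cx (c t : W) (w : W → Bool) : W → Bool := update w t (xor (w t) (w c))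

theorem cx_cx {c t : W} (h : c ≠ t) (w : W → Bool) : cx c t (cx c t w) = w := by
  funext j
  by_cases hj : j = t
  · subst hj; simp [cx, h]
  · simp [cx, hj]

/-- Since `cx` is an involution, the definition, which gives the row in terms of the column, can be
solved for the column. In this form the sums of a matrix product collapse. -/
theorem cnotMat_apply {c t : W} (h : c ≠ t) (w w' : W → Bool) :
    cnotMat c t w w' = if w' = cx c t w then 1 else 0 := by
  have : (w = cx c t w') ↔ w' = cx c t w :=
    ⟨fun e => by rw [e, cx_cx h], fun e => by rw [e, cx_cx h]⟩
  simp only [cnotMat, Matrix.of_apply, ← this]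
  rfl

theorem conj_cnot_apply {c t : W} (h : c ≠ t) (ρ : Op W) (w w' : W → Bool) :
    conj (cnotMat c t) ρ w w' = ρ (cx c t w) (cx c t w') := by
  simp [conj, Matrix.mul_apply, cnotMat_apply h, Matrix.conjTranspose_apply, apply_ite star]

/-! ### Linearity -/

/-- The operations on states are plain functions, so linearity is carried as a predicate.
Composition and `map_fsum` are what is needed to push them through sums over memories. -/
theorem _root_.IsLinearMap.compose {M N P : Type*} [AddCommMonoid M] [AddCommMonoid N] [AddCommMonoid P]
    [Module ℂ M] [Module ℂ N] [Module ℂ P] {g : N → P} {f : M → N}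
    (hg : IsLinearMap ℂ g) (hf : IsLinearMap ℂ f) : IsLinearMap ℂ fun x => g (f x) :=
  (hg.mk' g ∘ₗ hf.mk' f).isLinear

theorem _root_.IsLinearMap.map_fsum {ι M N : Type*} [AddCommMonoid M] [AddCommMonoid N]
    [Module ℂ M] [Module ℂ N] {g : M → N}
    (hg : IsLinearMap ℂ g) (s : Finset ι) (f : ι → M) : g (∑ i ∈ s, f i) = ∑ i ∈ s, g (f i) :=
  map_sum (hg.mk' g) f s

theorem isLinearMap_conj {I : Type} [Fintype I] (U : Matrix I I ℂ) : IsLinearMap ℂ (conj U) :=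
  ⟨fun x y => by simp [conj, Matrix.mul_add, Matrix.add_mul], fun c x => by simp [conj]⟩

theorem isLinearMap_setWire (q : W) (b : Bool) : IsLinearMap ℂ (setWire q b) := by
  constructor
  · intro x y; ext w w'; simp only [setWire, Matrix.of_apply, Matrix.add_apply, Finset.sum_add_distrib]
    split_ifs <;> simp
  · intro c x; ext w w'; simp only [setWire, Matrix.of_apply, Matrix.smul_apply, ← Finset.smul_sum]
    split_ifs <;> simp

theorem isLinearMap_projWire (q : W) (b : Bool) : IsLinearMap ℂ (projWire q b) := by
  constructor
  · intro x y; ext w w'; simp only [projWire, Matrix.of_apply, Matrix.add_apply]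
    split_ifs <;> simp
  · intro c x; ext w w'; simp only [projWire, Matrix.of_apply, Matrix.smul_apply]
    split_ifs <;> simp

theorem isLinearMap_apply (g : Gate W) : IsLinearMap ℂ g.apply := by
  cases g with
  | h q => exact isLinearMap_conj _
  | p q => exact isLinearMap_conj _
  | tdg q => exact isLinearMap_conj _
  | cnot c t ne => exact isLinearMap_conj _
  | reset q => exact isLinearMap_setWire q false

variable {A : Type} [Fintype A] [DecidableEq A]

theorem isLinearMap_extract (f : A ↪ W) : IsLinearMap ℂ (extract f) := by
  constructor
  · intro x y; ext w w'; simp only [extract, Matrix.of_apply, Matrix.add_apply, ← Finset.sum_add_distrib]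
    refine Finset.sum_congr rfl fun a _ => Finset.sum_congr rfl fun b _ => ?_
    split_ifs <;> simp
  · intro c x; ext w w'; simp only [extract, Matrix.of_apply, Matrix.smul_apply, Finset.smul_sum]
    refine Finset.sum_congr rfl fun a _ => Finset.sum_congr rfl fun b _ => ?_
    split_ifs <;> simp

/-! ### Blocks and partial traces -/

/-- The block of `ρ` in which the wires outside the image of `f` have the values `e` (row) and
`e'` (column). -/
def blk (f : A ↪ W) (e e' : W → Bool) (ρ : Op W) : Op A :=
  Matrix.of fun a a' => ρ (extend f a e) (extend f a' e')

theorem update_extend (f : A ↪ W) (a : A → Bool) (e : W → Bool) (q : A) (d : Bool) :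
    update (extend f a e) (f q) d = extend f (update a q d) e := by
  funext i
  by_cases hi : ∃ j, f j = i
  · obtain ⟨j, rfl⟩ := hi
    rw [f.injective.extend_apply]
    by_cases hj : j = q
    · subst hj; simp
    · rw [Function.update_of_ne (fun h => hj (f.injective h)), f.injective.extend_apply,
        Function.update_of_ne hj]
  · rw [Function.extend_apply' _ _ _ hi, Function.update_of_ne, Function.extend_apply' _ _ _ hi]
    rintro rfl
    exact hi ⟨q, rfl⟩

theorem extend_emb_apply (f : A ↪ W) (a : A → Bool) (e : W → Bool) (q : A) : extend f a e (f q) = a q :=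
  f.injective.extend_apply _ _ _

theorem extend_comp_emb (f : A ↪ W) (a : A → Bool) (e : W → Bool) : extend f a e ∘ f = a :=
  funext fun q => extend_emb_apply f a e q

theorem extend_comp_self (f : A ↪ W) (e e' : W → Bool) (h : ∀ i, (∀ j, f j ≠ i) → e i = e' i) :
    extend f (e ∘ f) e' = e := by
  funext i
  by_cases hi : ∃ j, f j = i
  · obtain ⟨j, rfl⟩ := hi
    rw [f.injective.extend_apply]; rfl
  · rw [Function.extend_apply' _ _ _ hi, h i]
    intro j hj; exact hi ⟨j, hj⟩

theorem cx_extend (f : A ↪ W) (a : A → Bool) (e : W → Bool) (c t : A) :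
    cx (f c) (f t) (extend f a e) = extend f (cx c t a) e := by
  rw [cx, update_extend, extend_emb_apply, extend_emb_apply, cx]

/-- A gate on the wires of `A` neither reads nor changes the others, so it acts on each block
separately. This includes the off-diagonal blocks `e ≠ e'`, which are operators but not states. -/
theorem blk_apply_map (f : A ↪ W) (e e' : W → Bool) (g : Gate A) (ρ : Op W) :
    blk f e e' ((g.map f).apply ρ) = g.apply (blk f e e' ρ) := by
  ext a a'
  cases g with
  | h q => simp [Gate.map, Gate.apply, blk, conj_onWire_apply, extend_emb_apply, update_extend]
  | p q => simp [Gate.map, Gate.apply, blk, conj_onWire_apply, extend_emb_apply, update_extend]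
  | tdg q => simp [Gate.map, Gate.apply, blk, conj_onWire_apply, extend_emb_apply, update_extend]
  | cnot c t ne =>
    simp only [Gate.map, Gate.apply, blk, Matrix.of_apply]
    rw [conj_cnot_apply ne, conj_cnot_apply (fun h => ne (f.injective h)), cx_extend, cx_extend]
    rfl
  | reset q => simp [Gate.map, Gate.apply, blk, setWire, extend_emb_apply, update_extend]

theorem blk_setWire (f : A ↪ W) (e e' : W → Bool) (q : A) (b : Bool) (ρ : Op W) :
    blk f e e' (setWire (f q) b ρ) = setWire q b (blk f e e' ρ) := by
  ext a a'
  simp [blk, setWire, extend_emb_apply, update_extend]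

theorem blk_projWire (f : A ↪ W) (e e' : W → Bool) (q : A) (b : Bool) (ρ : Op W) :
    blk f e e' (projWire (f q) b ρ) = projWire q b (blk f e e' ρ) := by
  ext a a'
  simp [blk, projWire, extend_emb_apply]

theorem isLinearMap_blk (f : A ↪ W) (e e' : W → Bool) : IsLinearMap ℂ (blk f e e') :=
  ⟨fun _ _ => rfl, fun _ _ => rfl⟩

/-- The prescribed values on `f` and the agreement with `w` elsewhere leave a single candidate for
the second label. -/
theorem extract_apply (f : A ↪ W) (ρ : Op W) (u u' : A → Bool) :
    extract f ρ u u' = ∑ w : W → Bool, if w ∘ f = u then ρ w (extend f u' w) else 0 := by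
  simp only [extract, Matrix.of_apply]
  refine Finset.sum_congr rfl fun w _ => ?_
  rw [Finset.sum_eq_single (extend f u' w)]
  · have h2 : ∀ i, (∀ j, f j ≠ i) → w i = extend f u' w i := fun i hi => by
      rw [Function.extend_apply']; rintro ⟨j, hj⟩; exact hi j hj
    simp only [extend_comp_emb, true_and]
    by_cases h : w ∘ f = u
    · rw [if_pos ⟨h, h2⟩, if_pos h]
    · rw [if_neg (fun x => h x.1), if_neg h]
  · intro w' _ hw'
    rw [if_neg]
    rintro ⟨_, h1, h2⟩
    apply hw'
    rw [← h1]
    exact (extend_comp_self f w' w fun i hi => (h2 i hi).symm).symm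
  · simp

/-- A partial trace adds up the diagonal blocks. As `blk` ignores the values of `e` on the image of
`f`, fixing them to an arbitrary `c` counts each block once. Operations that commute with all blocks
thereby commute with partial traces. -/
theorem extract_eq_sum_blk (f : A ↪ W) (c : A → Bool) (ρ : Op W) :
    extract f ρ = ∑ e : W → Bool, if e ∘ f = c then blk f e e ρ else 0 := by
  ext u u'
  rw [extract_apply, Matrix.sum_apply]
  have hee : ∀ (a b : A → Bool) (e : W → Bool), extend f a (extend f b e) = extend f a e := by
    intro a b e
    funext i
    by_cases hi : ∃ j, f j = i
    · obtain ⟨j, rfl⟩ := hi; simp only [f.injective.extend_apply]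
    · rw [Function.extend_apply' _ _ _ hi, Function.extend_apply' _ _ _ hi,
        Function.extend_apply' _ _ _ hi]
  have hcs : ∀ (a : A → Bool) (e : W → Bool), e ∘ f = a → extend f a e = e := by
    rintro a e rfl
    exact extend_comp_self f e e fun _ _ => rfl
  rw [← Finset.sum_filter]
  have : ∀ e : W → Bool, (if e ∘ f = c then blk f e e ρ else 0 : Op A) u u' =
      if e ∘ f = c then ρ (extend f u e) (extend f u' e) else 0 := by
    intro e; split_ifs <;> simp [blk]
  simp only [this]
  rw [← Finset.sum_filter]
  refine Finset.sum_nbij' (fun w => extend f c w) (fun w => extend f u w) ?_ ?_ ?_ ?_ ?_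
  · intro w _; simp [extend_comp_emb]
  · intro w _; simp [extend_comp_emb]
  · intro w hw; simp only [Finset.mem_filter] at hw; rw [hee, hcs _ _ hw.2]
  · intro w hw; simp only [Finset.mem_filter] at hw; rw [hee, hcs _ _ hw.2]
  · intro w hw
    simp only [Finset.mem_filter] at hw
    rw [hee, hee, hcs _ _ hw.2]

theorem extract_apply_map (f : A ↪ W) (g : Gate A) (ρ : Op W) :
    extract f ((g.map f).apply ρ) = g.apply (extract f ρ) := by
  rw [extract_eq_sum_blk f (fun _ => false), extract_eq_sum_blk f (fun _ => false) ρ,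
    (isLinearMap_apply g).map_fsum]
  refine Finset.sum_congr rfl fun e _ => ?_
  split_ifs
  · exact blk_apply_map f e e g ρ
  · exact ((isLinearMap_apply g).map_zero).symm

theorem extract_setWire (f : A ↪ W) (q : A) (b : Bool) (ρ : Op W) :
    extract f (setWire (f q) b ρ) = setWire q b (extract f ρ) := by
  rw [extract_eq_sum_blk f (fun _ => false), extract_eq_sum_blk f (fun _ => false) ρ,
    (isLinearMap_setWire q b).map_fsum]
  refine Finset.sum_congr rfl fun e _ => ?_
  split_ifs
  · exact blk_setWire f e e q b ρ
  · exact ((isLinearMap_setWire q b).map_zero).symm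

theorem extract_projWire (f : A ↪ W) (q : A) (b : Bool) (ρ : Op W) :
    extract f (projWire (f q) b ρ) = projWire q b (extract f ρ) := by
  rw [extract_eq_sum_blk f (fun _ => false), extract_eq_sum_blk f (fun _ => false) ρ,
    (isLinearMap_projWire q b).map_fsum]
  refine Finset.sum_congr rfl fun e _ => ?_
  split_ifs
  · exact blk_projWire f e e q b ρ
  · exact ((isLinearMap_projWire q b).map_zero).symm

end

/-! ### Interaction -/

section
variable {K W : Type} [Fintype K] [DecidableEq K] [Fintype W] [DecidableEq W]

theorem isLinearMap_pointwise {F : (K → Bool) → Op W → Op W} (h : ∀ m, IsLinearMap ℂ (F m)) :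
    IsLinearMap ℂ (fun (σ : JState K W) m => F m (σ m)) :=
  ⟨fun x y => funext fun m => (h m).map_add _ _, fun c x => funext fun m => (h m).map_smul _ _⟩

theorem isLinearMap_pushMem (f : (K → Bool) → (K → Bool)) :
    IsLinearMap ℂ (pushMem f : JState K W → JState K W) := by
  constructor
  · intro x y; funext m
    simp only [pushMem, Pi.add_apply, ← Finset.sum_add_distrib]
    refine Finset.sum_congr rfl fun a _ => ?_
    split_ifs <;> simp
  · intro c x; funext m
    simp only [pushMem, Pi.smul_apply, Finset.smul_sum]
    refine Finset.sum_congr rfl fun a _ => ?_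
    split_ifs <;> simp

theorem isLinearMap_clocal (c : CLocal K) : IsLinearMap ℂ (c.apply : JState K W → JState K W) := by
  cases c with
  | const t b => exact isLinearMap_pushMem _
  | nand i j t => exact isLinearMap_pushMem _
  | coin t =>
    constructor
    · intro x y; funext m
      simp only [CLocal.apply, Pi.add_apply, Finset.sum_add_distrib, smul_add]
    · intro c x; funext m
      simp only [CLocal.apply, Pi.smul_apply, ← Finset.smul_sum]
      rw [smul_comm]

theorem isLinearMap_toServer (i : K) (q : W) : IsLinearMap ℂ (toServer i q : JState K W → _) :=
  isLinearMap_pointwise (F := fun m => setWire q (m i)) fun m => isLinearMap_setWire q (m i)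

theorem isLinearMap_toClient (q : W) (i : K) : IsLinearMap ℂ (toClient q i : JState K W → _) := by
  constructor
  · intro x y; funext m
    simp only [toClient, Pi.add_apply, (isLinearMap_projWire q _).map_add, Finset.sum_add_distrib]
  · intro c x; funext m
    simp only [toClient, Pi.smul_apply, (isLinearMap_projWire q _).map_smul, ← Finset.smul_sum]

theorem isLinearMap_gates (g : Gate W) :
    IsLinearMap ℂ (fun (σ : JState K W) m => g.apply (σ m)) :=
  isLinearMap_pointwise (F := fun _ => g.apply) fun _ => isLinearMap_apply g

theorem interact_nil_gate (g : Gate W) (ss : List (SInstr W)) (σ : JState K W) :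
    interact [] (.gate g :: ss) σ = interact [] ss (fun m => g.apply (σ m)) := by rw [interact]

theorem interact_nil_comm (q : W) (ss : List (SInstr W)) (σ : JState K W) :
    interact [] (.comm q :: ss) σ = interact [] ss σ := by rw [interact]

theorem interact_nil_nil (σ : JState K W) : interact [] ([] : List (SInstr W)) σ = σ := by
  rw [interact]

theorem interact_loc (c : CLocal K) (cs : List (CInstr K)) (ss : List (SInstr W)) (σ : JState K W) :
    interact (.loc c :: cs) ss σ = interact cs ss (c.apply σ) := by rw [interact]

theorem interact_send_comm (i : K) (q : W) (cs : List (CInstr K)) (ss : List (SInstr W))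
    (σ : JState K W) :
    interact (.send i :: cs) (.comm q :: ss) σ = interact cs ss (toServer i q σ) := by rw [interact]

theorem interact_recv_comm (i : K) (q : W) (cs : List (CInstr K)) (ss : List (SInstr W))
    (σ : JState K W) :
    interact (.recv i :: cs) (.comm q :: ss) σ = interact cs ss (toClient q i σ) := by rw [interact]

theorem interact_send_nil (i : K) (cs : List (CInstr K)) (σ : JState K W) :
    interact (.send i :: cs) ([] : List (SInstr W)) σ = interact cs [] σ := by rw [interact]

theorem interact_recv_nil (i : K) (cs : List (CInstr K)) (σ : JState K W) :
    interact (.recv i :: cs) ([] : List (SInstr W)) σ =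
      interact cs [] ((CLocal.const i false).apply σ) := by rw [interact]

/-- Gates act on the server's state and commute with the local steps of the client. -/
theorem clocal_gate_comm (c : CLocal K) (g : Gate W) (σ : JState K W) :
    c.apply (fun m => g.apply (σ m)) = fun m => g.apply (c.apply σ m) := by
  have hp : ∀ f : (K → Bool) → (K → Bool),
      pushMem f (fun m => g.apply (σ m)) = fun m => g.apply (pushMem f σ m) := by
    intro f
    funext m
    simp only [pushMem, (isLinearMap_apply g).map_fsum]
    refine Finset.sum_congr rfl fun a _ => ?_
    split_ifs
    · rfl
    · exact ((isLinearMap_apply g).map_zero).symm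
  cases c with
  | const t b => exact hp _
  | nand i j t => exact hp _
  | coin t =>
    funext m
    simp only [CLocal.apply, (isLinearMap_apply g).map_smul, (isLinearMap_apply g).map_fsum]

/-- The definition performs a gate first only if the client is done or about to communicate. Local
steps of the client commute with gates, so a leading gate may be performed first in all cases. -/
theorem interact_gate (cs : List (CInstr K)) (g : Gate W) (ss : List (SInstr W)) (σ : JState K W) :
    interact cs (.gate g :: ss) σ = interact cs ss (fun m => g.apply (σ m)) := by
  induction cs generalizing σ with
  | nil => exact interact_nil_gate g ss σ
  | cons c cs ih =>
    cases c with
    | loc c => rw [interact_loc, ih, interact_loc, clocal_gate_comm]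
    | send i => rw [interact]
    | recv i => rw [interact]

/-- Induction along an interaction. -/
theorem interact_induction {motive : List (CInstr K) → List (SInstr W) → Prop}
    (nil : motive [] []) (gate : ∀ cs g ss, motive cs ss → motive cs (.gate g :: ss))
    (nil_comm : ∀ q ss, motive [] ss → motive [] (.comm q :: ss))
    (loc : ∀ c cs ss, motive cs ss → motive (.loc c :: cs) ss)
    (send_comm : ∀ i q cs ss, motive cs ss → motive (.send i :: cs) (.comm q :: ss))
    (recv_comm : ∀ i q cs ss, motive cs ss → motive (.recv i :: cs) (.comm q :: ss))
    (send_nil : ∀ i cs, motive cs [] → motive (.send i :: cs) [])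
    (recv_nil : ∀ i cs, motive cs [] → motive (.recv i :: cs) [])
    (cs : List (CInstr K)) (ss : List (SInstr W)) : motive cs ss := by
  suffices h : ∀ (n : ℕ) (cs : List (CInstr K)) (ss : List (SInstr W)), cs.length + ss.length ≤ n →
      motive cs ss from h _ cs ss le_rfl
  intro n
  induction n with
  | zero =>
    intro cs ss h
    have h1 : cs = [] := List.length_eq_zero_iff.1 (by omega)
    have h2 : ss = [] := List.length_eq_zero_iff.1 (by omega)
    subst h1 h2
    exact nil
  | succ n ih =>
    intro cs ss h
    match cs, ss with
    | [], [] => exact nil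
    | cs, .gate g :: ss => exact gate _ _ _ (ih _ _ (by simp only [List.length_cons] at h ⊢; omega))
    | [], .comm q :: ss => exact nil_comm _ _ (ih _ _ (by simp only [List.length_cons] at h ⊢; omega))
    | .loc c :: cs, ss => exact loc _ _ _ (ih _ _ (by simp only [List.length_cons] at h ⊢; omega))
    | .send i :: cs, .comm q :: ss =>
      exact send_comm _ _ _ _ (ih _ _ (by simp only [List.length_cons] at h ⊢; omega))
    | .recv i :: cs, .comm q :: ss =>
      exact recv_comm _ _ _ _ (ih _ _ (by simp only [List.length_cons] at h ⊢; omega))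
    | .send i :: cs, [] => exact send_nil _ _ (ih _ _ (by simp only [List.length_cons] at h ⊢; omega))
    | .recv i :: cs, [] => exact recv_nil _ _ (ih _ _ (by simp only [List.length_cons] at h ⊢; omega))

theorem isLinearMap_interact (cs : List (CInstr K)) (ss : List (SInstr W)) :
    IsLinearMap ℂ (interact cs ss : JState K W → JState K W) := by
  induction cs, ss using interact_induction with
  | nil =>
    rw [funext interact_nil_nil]
    exact ⟨fun _ _ => rfl, fun _ _ => rfl⟩
  | gate cs g ss ih =>
    rw [funext (interact_gate cs g ss)]
    exact ih.compose (isLinearMap_gates g)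
  | nil_comm q ss ih => rw [funext (interact_nil_comm q ss)]; exact ih
  | loc c cs ss ih =>
    rw [funext (interact_loc c cs ss)]
    exact ih.compose (isLinearMap_clocal c)
  | send_comm i q cs ss ih =>
    rw [funext (interact_send_comm i q cs ss)]
    exact ih.compose (isLinearMap_toServer i q)
  | recv_comm i q cs ss ih =>
    rw [funext (interact_recv_comm i q cs ss)]
    exact ih.compose (isLinearMap_toClient q i)
  | send_nil i cs ih => rw [funext (interact_send_nil i cs)]; exact ih
  | recv_nil i cs ih =>
    rw [funext (interact_recv_nil i cs)]
    exact ih.compose (isLinearMap_clocal _)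

end

section
variable {K W : Type} [Fintype K] [DecidableEq K] [Fintype W] [DecidableEq W]

/-! ### Splitting an interaction -/

/-- The part of a server program up to its `n`-th transmission. -/
def takeComm : ℕ → List (SInstr W) → List (SInstr W)
  | 0, _ => []
  | _ + 1, [] => []
  | n + 1, .gate g :: ss => .gate g :: takeComm (n + 1) ss
  | n + 1, .comm q :: ss => .comm q :: takeComm n ss

/-- The part of a server program after its `n`-th transmission. -/
def dropComm : ℕ → List (SInstr W) → List (SInstr W)
  | 0, ss => ss
  | _ + 1, [] => []
  | n + 1, .gate _ :: ss => dropComm (n + 1) ss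
  | n + 1, .comm _ :: ss => dropComm n ss

theorem takeComm_append_dropComm (n : ℕ) (ss : List (SInstr W)) :
    takeComm n ss ++ dropComm n ss = ss := by
  induction ss generalizing n with
  | nil => cases n <;> rfl
  | cons s ss ih =>
    cases n with
    | zero => rfl
    | succ n => cases s <;> simp [takeComm, dropComm, ih]

/-- The server's program is cut right after the last transmission that belongs to `cs`; gates after
the cut may wait. An arbitrary server is allowed: if it stops early, the second part is empty and
both sides use the default rules for lost messages. -/
theorem interact_append (cs cs' : List (CInstr K)) (ss : List (SInstr W)) (σ : JState K W) :
    interact (cs ++ cs') ss σ =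
      interact cs' (dropComm (cs.countP CInstr.isComm) ss)
        (interact cs (takeComm (cs.countP CInstr.isComm) ss) σ) := by
  induction cs generalizing ss σ with
  | nil => simp [takeComm, dropComm, interact_nil_nil]
  | cons c cs ih =>
    cases c with
    | loc c => simp [interact_loc, ih, CInstr.isComm]
    | send i =>
      have hn : (CInstr.send i :: cs).countP CInstr.isComm = cs.countP CInstr.isComm + 1 := by
        simp [CInstr.isComm, List.countP_cons]
      rw [hn, List.cons_append]
      induction ss generalizing σ with
      | nil =>
        rw [interact_send_nil, ih [] σ]
        cases h : cs.countP CInstr.isComm <;> simp only [takeComm, dropComm, interact_send_nil]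
      | cons s ss ih' =>
        cases s with
        | gate g => simp [takeComm, dropComm, interact_gate, ih']
        | comm q => simp [takeComm, dropComm, interact_send_comm, ih]
    | recv i =>
      have hn : (CInstr.recv i :: cs).countP CInstr.isComm = cs.countP CInstr.isComm + 1 := by
        simp [CInstr.isComm, List.countP_cons]
      rw [hn, List.cons_append]
      induction ss generalizing σ with
      | nil =>
        rw [interact_recv_nil, ih []]
        cases h : cs.countP CInstr.isComm <;> simp only [takeComm, dropComm, interact_recv_nil]
      | cons s ss ih' =>
        cases s with
        | gate g => simp [takeComm, dropComm, interact_gate, ih']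
        | comm q => simp [takeComm, dropComm, interact_recv_comm, ih]

/-- Here both programs come already cut, and equal numbers of transmissions make the two cuts match.
This is the version for honest runs. -/
theorem interact_append_append (cs cs' : List (CInstr K)) (ss ss' : List (SInstr W)) (σ : JState K W)
    (h : cs.countP CInstr.isComm = ss.countP SInstr.isComm) :
    interact (cs ++ cs') (ss ++ ss') σ = interact cs' ss' (interact cs ss σ) := by
  induction cs generalizing ss σ with
  | nil =>
    induction ss generalizing σ with
    | nil => simp [interact_nil_nil]
    | cons s ss ih =>
      cases s with
      | gate g =>
        simp only [List.nil_append, List.cons_append, interact_gate] at ih ⊢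
        exact ih _ (by simpa [SInstr.isComm, List.countP_cons] using h)
      | comm q => simp [SInstr.isComm, List.countP_cons] at h
  | cons c cs ih =>
    cases c with
    | loc c =>
      rw [List.cons_append, interact_loc, interact_loc, ih]
      simpa [CInstr.isComm, List.countP_cons] using h
    | send i =>
      rw [List.cons_append]
      induction ss generalizing σ with
      | nil => simp [CInstr.isComm, List.countP_cons] at h
      | cons s ss ih' =>
        cases s with
        | gate g =>
          rw [List.cons_append, interact_gate, interact_gate, ih']
          simpa [SInstr.isComm, List.countP_cons] using h
        | comm q =>
          rw [List.cons_append, interact_send_comm, interact_send_comm, ih]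
          simpa [SInstr.isComm, CInstr.isComm, List.countP_cons] using h
    | recv i =>
      rw [List.cons_append]
      induction ss generalizing σ with
      | nil => simp [CInstr.isComm, List.countP_cons] at h
      | cons s ss ih' =>
        cases s with
        | gate g =>
          rw [List.cons_append, interact_gate, interact_gate, ih']
          simpa [SInstr.isComm, List.countP_cons] using h
        | comm q =>
          rw [List.cons_append, interact_recv_comm, interact_recv_comm, ih]
          simpa [SInstr.isComm, CInstr.isComm, List.countP_cons] using h

/-- Local steps of the client, in order. -/
def locals (l : List (CLocal K)) (σ : JState K W) : JState K W := l.foldl (fun σ c => c.apply σ) σ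

/-- Gates of the server, in order. -/
def runGates (l : List (Gate W)) (ρ : Op W) : Op W := l.foldl (fun ρ g => g.apply ρ) ρ

theorem isLinearMap_runGates (l : List (Gate W)) : IsLinearMap ℂ (runGates l) := by
  induction l with
  | nil => exact ⟨fun _ _ => rfl, fun _ _ => rfl⟩
  | cons g l ih => exact ih.compose (isLinearMap_apply g)

theorem runGates_append (l l' : List (Gate W)) (ρ : Op W) :
    runGates (l ++ l') ρ = runGates l' (runGates l ρ) := List.foldl_append

theorem interact_locals_append (l : List (CLocal K)) (cs : List (CInstr K)) (ss : List (SInstr W))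
    (σ : JState K W) :
    interact (l.map .loc ++ cs) ss σ = interact cs ss (locals l σ) := by
  induction l generalizing σ with
  | nil => rfl
  | cons c l ih => rw [List.map_cons, List.cons_append, interact_loc, ih]; rfl

theorem interact_gates_append (l : List (Gate W)) (cs : List (CInstr K)) (ss : List (SInstr W))
    (σ : JState K W) :
    interact cs (l.map .gate ++ ss) σ = interact cs ss (fun m => runGates l (σ m)) := by
  induction l generalizing σ with
  | nil => rfl
  | cons c l ih => rw [List.map_cons, List.cons_append, interact_gate, ih]; rfl

/-- Whatever the server still does when the client reaches its last step consists of gates, which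
commute with it, and of transmissions without partner, which have no effect. -/
theorem interact_append_loc (cs : List (CInstr K)) (c : CLocal K) (ss : List (SInstr W))
    (σ : JState K W) :
    interact (cs ++ [.loc c]) ss σ = c.apply (interact cs ss σ) := by
  have h0 : ∀ (ss : List (SInstr W)) (σ : JState K W),
      interact [] ss (c.apply σ) = c.apply (interact [] ss σ) := by
    intro ss
    induction ss with
    | nil => intro σ; rw [interact_nil_nil, interact_nil_nil]
    | cons s ss ih =>
      intro σ
      cases s with
      | gate g => rw [interact_gate, interact_gate, ← ih, clocal_gate_comm]
      | comm q => rw [interact_nil_comm, interact_nil_comm, ih]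
  induction cs, ss using interact_induction generalizing σ with
  | nil => simp only [List.nil_append, interact_loc]; exact h0 _ _
  | gate cs g ss ih => rw [interact_gate, interact_gate, ih]
  | nil_comm q ss ih => simp only [List.nil_append, interact_loc]; exact h0 _ _
  | loc c cs ss ih => rw [List.cons_append, interact_loc, interact_loc, ih]
  | send_comm i q cs ss ih => rw [List.cons_append, interact_send_comm, interact_send_comm, ih]
  | recv_comm i q cs ss ih => rw [List.cons_append, interact_recv_comm, interact_recv_comm, ih]
  | send_nil i cs ih => rw [List.cons_append, interact_send_nil, interact_send_nil, ih]
  | recv_nil i cs ih => rw [List.cons_append, interact_recv_nil, interact_recv_nil, ih]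

theorem interact_append_locals (cs : List (CInstr K)) (l : List (CLocal K)) (ss : List (SInstr W))
    (σ : JState K W) :
    interact (cs ++ l.map .loc) ss σ = locals l (interact cs ss σ) := by
  induction l generalizing cs σ with
  | nil => simp [locals]
  | cons c l ih =>
    have : cs ++ (c :: l).map CInstr.loc = (cs ++ [.loc c]) ++ l.map .loc := by simp
    rw [this, ih, interact_append_loc]; rfl

/-! ### Sums over the client's memory -/

/-- Each old memory has exactly one image, so the sum over new memories turns into one over old
ones. Traces, marginals and decryptions are all treated by a suitable choice of `G`. -/
theorem sum_pushMem {E : Type*} [AddCommMonoid E] [Module ℂ E] (f : (K → Bool) → (K → Bool))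
    (σ : JState K W) {G : (K → Bool) → Op W → E} (hG : ∀ m, IsLinearMap ℂ (G m)) :
    ∑ m, G m (pushMem f σ m) = ∑ m, G (f m) (σ m) := by
  simp only [pushMem, (hG _).map_fsum]
  rw [Finset.sum_comm]
  refine Finset.sum_congr rfl fun m _ => ?_
  rw [Finset.sum_eq_single (f m)]
  · simp
  · intro b _ hb
    rw [if_neg (fun h => hb h.symm)]
    exact (hG b).map_zero
  · simp

/-- The map `(m, b) ↦ (update m t b, m t)` is an involution that exchanges the contents before and
after cell `t` is overwritten. -/
theorem sum_sum_update {E : Type*} [AddCommMonoid E] (t : K) (F : (K → Bool) → (K → Bool) → E) :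
    ∑ m, ∑ b : Bool, F m (update m t b) = ∑ m, ∑ b : Bool, F (update m t b) m := by
  rw [← Fintype.sum_prod_type', ← Fintype.sum_prod_type']
  refine Finset.sum_nbij' (fun p : (K → Bool) × Bool => (update p.1 t p.2, p.1 t))
    (fun p => (update p.1 t p.2, p.1 t)) ?_ ?_ ?_ ?_ ?_ <;> simp

theorem sum_coin {E : Type*} [AddCommMonoid E] [Module ℂ E] (t : K)
    (σ : JState K W) {G : (K → Bool) → Op W → E} (hG : ∀ m, IsLinearMap ℂ (G m)) :
    ∑ m, G m ((CLocal.coin t).apply σ m) = ∑ m, ∑ b : Bool, (1 / 2 : ℂ) • G (update m t b) (σ m) := by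
  simp only [CLocal.apply, (hG _).map_fsum, (hG _).map_smul, Finset.smul_sum]
  exact sum_sum_update t fun m m' => (1 / 2 : ℂ) • G m (σ m')

theorem sum_toClient {E : Type*} [AddCommMonoid E] [Module ℂ E] (q : W) (i : K)
    (σ : JState K W) {G : (K → Bool) → Op W → E} (hG : ∀ m, IsLinearMap ℂ (G m)) :
    ∑ m, G m (toClient q i σ m) = ∑ m, ∑ b : Bool, G (update m i b) (projWire q b (σ m)) := by
  simp only [toClient, (hG _).map_fsum]
  refine (sum_sum_update i fun m m' => G m (projWire q (m i) (σ m'))).trans ?_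
  simp

/-! ### Interactions on a part of the memory and of the wires -/

variable {K' A : Type} [Fintype K'] [DecidableEq K'] [Fintype A] [DecidableEq A]

/-- The blocks of a joint state for fixed memory `m` outside the image of `g` and fixed values
`e`, `e'` of the wires outside the image of `f`. -/
def blkJ (g : K' ↪ K) (f : A ↪ W) (m : K → Bool) (e e' : W → Bool) (σ : JState K W) : JState K' A :=
  fun m' => blk f e e' (σ (extend g m' m))

/-- By `h2` every memory that is mapped into the block of `m` already lies in it, and by `h1` the
update acts there as `F'`. -/
theorem blkJ_pushMem (g : K' ↪ K) (f : A ↪ W) (m : K → Bool) (e e' : W → Bool) (σ : JState K W)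
    (F : (K → Bool) → (K → Bool)) (F' : (K' → Bool) → (K' → Bool))
    (h1 : ∀ m' : K' → Bool, F (extend g m' m) = extend g (F' m') m)
    (h2 : ∀ M i, (∀ j, g j ≠ i) → F M i = M i) :
    blkJ g f m e e' (pushMem F σ) = pushMem F' (blkJ g f m e e' σ) := by
  funext m'
  simp only [blkJ, pushMem, (isLinearMap_blk f e e').map_fsum]
  have hinj : Function.Injective fun a : K' → Bool => extend g a m := fun a b hab => by
    rw [← extend_comp_emb g a m, ← extend_comp_emb g b m]; exact congrArg (· ∘ g) hab
  symm
  refine Fintype.sum_of_injective (fun a => extend g a m) hinj _ _ ?_ ?_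
  · intro M hM
    rw [if_neg]
    · rfl
    · intro hF
      refine hM ⟨M ∘ g, extend_comp_self g M m fun i hi => ?_⟩
      rw [← h2 M i hi, hF, Function.extend_apply']
      rintro ⟨j, hj⟩; exact hi j hj
  · intro a
    simp only [h1, hinj.eq_iff]
    split_ifs <;> rfl

theorem blkJ_clocal (g : K' ↪ K) (f : A ↪ W) (m : K → Bool) (e e' : W → Bool) (σ : JState K W)
    (c : CLocal K') :
    blkJ g f m e e' ((c.map g).apply σ) = c.apply (blkJ g f m e e' σ) := by
  cases c with
  | const t b =>
    refine blkJ_pushMem _ _ _ _ _ _ _ _ (fun m' => update_extend g m' m t b) fun M i hi => ?_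
    exact Function.update_of_ne (hi t).symm _ _
  | nand i j t =>
    refine blkJ_pushMem _ _ _ _ _ _ _ _ (fun m' => ?_) fun M i hi => ?_
    · rw [update_extend, extend_emb_apply, extend_emb_apply]
    · exact Function.update_of_ne (hi t).symm _ _
  | coin t =>
    funext m'
    simp only [CLocal.map, CLocal.apply, blkJ, (isLinearMap_blk f e e').map_smul,
      (isLinearMap_blk f e e').map_fsum, update_extend]

theorem blkJ_toServer (g : K' ↪ K) (f : A ↪ W) (m : K → Bool) (e e' : W → Bool) (σ : JState K W)
    (i : K') (q : A) :
    blkJ g f m e e' (toServer (g i) (f q) σ) = toServer i q (blkJ g f m e e' σ) := by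
  funext m'
  simp only [blkJ, toServer, extend_emb_apply, blk_setWire]

theorem blkJ_toClient (g : K' ↪ K) (f : A ↪ W) (m : K → Bool) (e e' : W → Bool) (σ : JState K W)
    (i : K') (q : A) :
    blkJ g f m e e' (toClient (f q) (g i) σ) = toClient q i (blkJ g f m e e' σ) := by
  funext m'
  simp only [blkJ, toClient, extend_emb_apply, (isLinearMap_blk f e e').map_fsum, update_extend,
    blk_projWire]

theorem blkJ_gate (g : K' ↪ K) (f : A ↪ W) (m : K → Bool) (e e' : W → Bool) (σ : JState K W)
    (G : Gate A) :
    blkJ g f m e e' (fun M => (G.map f).apply (σ M)) = fun m' => G.apply (blkJ g f m e e' σ m') := by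
  funext m'
  exact blk_apply_map f e e' G _

/-- A subprotocol touches only its own cells and wires, so it acts on every block as if it were run
alone. By linearity this needs no product structure of the joint state; it is what isolates an OSP
call from its surroundings. -/
theorem interact_blk (g : K' ↪ K) (f : A ↪ W) (m : K → Bool) (e e' : W → Bool)
    (cs : List (CInstr K')) (ss : List (SInstr A)) (σ : JState K W) :
    blkJ g f m e e' (interact (cs.map (CInstr.map g)) (ss.map (SInstr.map f)) σ) =
      interact cs ss (blkJ g f m e e' σ) := by
  induction cs, ss using interact_induction generalizing σ with
  | nil => simp only [List.map_nil, interact_nil_nil]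
  | gate cs G ss ih => simp only [List.map_cons, SInstr.map, interact_gate, ih, blkJ_gate]
  | nil_comm q ss ih =>
    simp only [List.map_cons, List.map_nil, SInstr.map, interact_nil_comm] at ih ⊢
    exact ih σ
  | loc c cs ss ih => simp only [List.map_cons, CInstr.map, interact_loc, ih, blkJ_clocal]
  | send_comm i q cs ss ih =>
    simp only [List.map_cons, CInstr.map, SInstr.map, interact_send_comm, ih, blkJ_toServer]
  | recv_comm i q cs ss ih =>
    simp only [List.map_cons, CInstr.map, SInstr.map, interact_recv_comm, ih, blkJ_toClient]
  | send_nil i cs ih =>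
    simp only [List.map_cons, List.map_nil, CInstr.map, interact_send_nil] at ih ⊢
    exact ih σ
  | recv_nil i cs ih =>
    simp only [List.map_cons, List.map_nil, CInstr.map, interact_recv_nil] at ih ⊢
    rw [ih, ← blkJ_clocal]; rfl

theorem map_refl_server (ss : List (SInstr W)) :
    ss.map (SInstr.map (Function.Embedding.refl W)) = ss := by
  have : (SInstr.map (Function.Embedding.refl W)) = id := by
    funext s
    rcases s with g | q
    · cases g <;> rfl
    · rfl
  rw [this, List.map_id]

theorem extend_refl (a e : W → Bool) : extend (Function.Embedding.refl W) a e = a :=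
  funext fun i => (Function.Embedding.refl W).injective.extend_apply a e i

end

section
variable {K W : Type} [Fintype K] [DecidableEq K] [Fintype W] [DecidableEq W]

/-! ### Deterministic local computations -/

/-- The effect of a deterministic local step on the memory. -/
def CLocal.eval : CLocal K → (K → Bool) → (K → Bool)
  | .const t b, m => update m t b
  | .nand i j t, m => update m t (!(m i && m j))
  | .coin _, m => m

/-- Is this step deterministic? -/
def CLocal.IsDet : CLocal K → Prop
  | .coin _ => False
  | _ => True

/-- The effect of a list of deterministic local steps on the memory. -/
def evalList (l : List (CLocal K)) (m : K → Bool) : K → Bool := l.foldl (fun m c => c.eval m) m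

theorem pushMem_pushMem (f g : (K → Bool) → (K → Bool)) (σ : JState K W) :
    pushMem g (pushMem f σ) = pushMem (fun m => g (f m)) σ := by
  funext m
  simp only [pushMem]
  have : ∀ x : K → Bool, (if g x = m then ∑ m', if f m' = x then σ m' else 0 else 0 : Op W) =
      ∑ m', if f m' = x then (if g (f m') = m then σ m' else 0) else 0 := by
    intro x
    split_ifs with h
    · refine Finset.sum_congr rfl fun a _ => ?_
      split_ifs with h1 h2
      · rfl
      · exact absurd (h1 ▸ h) h2
      · rfl
    · symm
      refine Finset.sum_eq_zero fun a _ => ?_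
      split_ifs with h1 h2
      · exact absurd (h1 ▸ h2) h
      · rfl
      · rfl
  simp only [this]
  rw [Finset.sum_comm]
  simp

theorem pushMem_id (σ : JState K W) : pushMem (fun m => m) σ = σ := by
  funext m
  simp [pushMem]

theorem locals_eq_pushMem (l : List (CLocal K)) (h : ∀ c ∈ l, c.IsDet) (σ : JState K W) :
    locals l σ = pushMem (evalList l) σ := by
  induction l generalizing σ with
  | nil => exact (pushMem_id σ).symm
  | cons c l ih =>
    have hc : c.apply σ = pushMem c.eval σ := by
      have := h c (by simp)
      cases c with
      | const t b => rfl
      | nand i j t => rfl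
      | coin t => exact this.elim
    change locals l (c.apply σ) = _
    rw [ih (fun c hc => h c (by simp [hc])), hc, pushMem_pushMem]
    rfl

theorem evalList_const_false {ι : Type} (f : ι → K) (l : List ι) (m : K → Bool) :
    evalList (l.map fun j => CLocal.const (f j) false) m =
      fun i => if i ∈ l.map f then false else m i := by
  induction l generalizing m with
  | nil => rfl
  | cons j l ih =>
    change evalList (l.map fun j => CLocal.const (f j) false) (update m (f j) false) = _
    rw [ih]
    funext i
    by_cases h : i = f j
    · subst h; simp
    · simp [h]

/-- Both sides vanish unless `x` and `m` agree off `t`, and then exactly one `b` contributes to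
each. -/
theorem sum_update_eq {E : Type*} [AddCommMonoid E] (x m : K → Bool) (t : K) (a : Bool → E) :
    (∑ b : Bool, if update x t b = m then a b else 0) =
      ∑ b : Bool, if x = update m t b then a (m t) else 0 := by
  by_cases h : ∀ j, j ≠ t → x j = m j
  · have h1 : ∀ b, update x t b = m ↔ b = m t := fun b => by
      constructor
      · rintro rfl; simp
      · rintro rfl; funext j
        by_cases hj : j = t
        · subst hj; simp
        · simp [hj, h j hj]
    have h2 : ∀ b, x = update m t b ↔ b = x t := fun b => by
      constructor
      · intro e; rw [e]; simp
      · rintro rfl; funext j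
        by_cases hj : j = t
        · subst hj; simp
        · simp [hj, h j hj]
    simp only [h1, h2, Finset.sum_ite_eq', Finset.mem_univ, if_true]
  · rw [Finset.sum_eq_zero, Finset.sum_eq_zero]
    · intro b _
      rw [if_neg]; rintro rfl; exact h fun j hj => by simp [hj]
    · intro b _
      rw [if_neg]; rintro rfl; exact h fun j hj => by simp [hj]

/-! ### Ideal executions of a template -/

/-- Discard wire `q` and replace it by the one-qubit operator `ω`. -/
def replaceWire (q : W) (ω : Matrix Bool Bool ℂ) (ρ : Op W) : Op W :=
  Matrix.of fun w w' => ω (w q) (w' q) * ∑ d : Bool, ρ (update w q d) (update w' q d)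

theorem isLinearMap_replaceWire (q : W) (ω : Matrix Bool Bool ℂ) :
    IsLinearMap ℂ (replaceWire q ω) := by
  constructor
  · intro x y; ext w w'
    simp only [replaceWire, Matrix.of_apply, Matrix.add_apply, Finset.sum_add_distrib, mul_add]
  · intro c x; ext w w'
    simp only [replaceWire, Matrix.of_apply, Matrix.smul_apply, smul_eq_mul, ← Finset.mul_sum]
    ring

end

/-- The effect of an instruction when an OSP call on input `b` yields, with client output `s`, the
(unnormalised) one-qubit state `Ω b s`. -/
def HInstr.step {k N : ℕ} (Ω : Bool → Bool → Matrix Bool Bool ℂ) :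
    HInstr k N → JState (Fin k) (Fin N) → JState (Fin k) (Fin N)
  | .client c, σ => c.apply σ
  | .server g, σ => fun m => g.apply (σ m)
  | .toServer i q, σ => OSP.toServer i q σ
  | .toClient q i, σ => OSP.toClient q i σ
  | .osp b s q, σ => fun m => ∑ m' : Fin k → Bool, ∑ d : Bool,
      if update m' s d = m then replaceWire q (Ω (m' b) d) (σ m') else 0

/-- A program run with OSP outputs `Ω`. -/
def runSteps {k N : ℕ} (Ω : Bool → Bool → Matrix Bool Bool ℂ) (p : List (HInstr k N))
    (σ : JState (Fin k) (Fin N)) : JState (Fin k) (Fin N) :=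
  p.foldl (fun σ h => h.step Ω σ) σ

/-- The unnormalised state of the receiver's output qubit when the sender has input `b` and
output `s`. -/
def OSPProtocol.outState (P : OSPProtocol) (b s : Bool) : Matrix Bool Bool ℂ :=
  Matrix.of fun u u' => ∑ m : Fin P.k → Bool, if m P.sOut = s then
    ∑ e : Fin P.N → Bool, if e P.qOut = false then
      interact P.client P.server (initState (P.initMem b) zeroState) m
        (update e P.qOut u) (update e P.qOut u') else 0
    else 0

/-! ### Tracing out the cells and wires of the subroutine -/

section
variable {k N : ℕ}

/-- Restriction of a joint state to the first `k` cells and the first `N` wires. -/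
def red {k' N' : ℕ} (σ : JState (Fin (k + k')) (Fin (N + N'))) : JState (Fin k) (Fin N) :=
  fun m => ∑ M : Fin (k + k') → Bool,
    if M ∘ Fin.castAdd k' = m then extract (Fin.castAddEmb N') (σ M) else 0

variable {k' N' : ℕ}

theorem isLinearMap_ite (p : Prop) [Decidable p] {E F : Type*} [AddCommMonoid E] [AddCommMonoid F]
    [Module ℂ E] [Module ℂ F] {f : E → F} (hf : IsLinearMap ℂ f) :
    IsLinearMap ℂ fun x => if p then f x else 0 := by
  split_ifs
  · exact hf
  · exact ⟨fun _ _ => by simp, fun _ _ => by simp⟩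

theorem update_castAdd_comp (M : Fin (k + k') → Bool) (t : Fin k) (b : Bool) :
    update M (Fin.castAdd k' t) b ∘ Fin.castAdd k' = update (M ∘ Fin.castAdd k') t b := by
  funext i
  by_cases h : i = t
  · subst h; simp
  · have : Fin.castAdd k' i ≠ Fin.castAdd k' t := fun e => h (Fin.castAdd_injective _ _ e)
    simp [h]

theorem red_pushMem (F : (Fin (k + k') → Bool) → (Fin (k + k') → Bool))
    (f : (Fin k → Bool) → (Fin k → Bool))
    (h : ∀ M, F M ∘ Fin.castAdd k' = f (M ∘ Fin.castAdd k'))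
    (σ : JState (Fin (k + k')) (Fin (N + N'))) :
    red (pushMem F σ) = pushMem f (red σ) := by
  funext m
  refine (sum_pushMem F σ (G := fun M ρ => if M ∘ Fin.castAdd k' = m then
    extract (Fin.castAddEmb N') ρ else 0) fun M => isLinearMap_ite _ (isLinearMap_extract _)).trans ?_
  simp only [red, pushMem, h]
  have : ∀ x : Fin k → Bool, (if f x = m then ∑ M : Fin (k + k') → Bool,
      if M ∘ Fin.castAdd k' = x then extract (Fin.castAddEmb N') (σ M) else 0 else 0 : Op (Fin N)) =
      ∑ M : Fin (k + k') → Bool, if M ∘ Fin.castAdd k' = x then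
        (if f (M ∘ Fin.castAdd k') = m then extract (Fin.castAddEmb N') (σ M) else 0) else 0 := by
    intro x
    split_ifs with h
    · refine Finset.sum_congr rfl fun a _ => ?_
      split_ifs with h1 h2
      · rfl
      · exact absurd (h1 ▸ h) h2
      · rfl
    · symm
      refine Finset.sum_eq_zero fun a _ => ?_
      split_ifs with h1 h2
      · exact absurd (h1 ▸ h2) h
      · rfl
      · rfl
  simp only [this]
  rw [Finset.sum_comm]
  simp

theorem red_clocal (c : CLocal (Fin k)) (σ : JState (Fin (k + k')) (Fin (N + N'))) :
    red ((c.map (Fin.castAdd k')).apply σ) = c.apply (red σ) := by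
  cases c with
  | const t b => exact red_pushMem _ _ (fun M => update_castAdd_comp M t b) σ
  | nand i j t => exact red_pushMem _ _ (fun M => update_castAdd_comp M t _) σ
  | coin t =>
    funext m
    refine (sum_coin (Fin.castAdd k' t) σ (G := fun M ρ => if M ∘ Fin.castAdd k' = m then
      extract (Fin.castAddEmb N') ρ else 0)
      fun M => isLinearMap_ite _ (isLinearMap_extract _)).trans ?_
    simp only [CLocal.apply, red, update_castAdd_comp]
    simp only [← Finset.smul_sum]
    congr 1
    rw [Finset.sum_comm (γ := Bool)]
    refine Finset.sum_congr rfl fun M _ => ?_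
    exact sum_update_eq (M ∘ Fin.castAdd k') m t fun _ => extract (Fin.castAddEmb N') (σ M)

theorem red_toServer (i : Fin k) (q : Fin N) (σ : JState (Fin (k + k')) (Fin (N + N'))) :
    red (toServer (Fin.castAdd k' i) (Fin.castAdd N' q) σ) = toServer i q (red σ) := by
  funext m
  simp only [red, toServer, (isLinearMap_setWire q _).map_fsum]
  refine Finset.sum_congr rfl fun M _ => ?_
  split_ifs with h
  · rw [← h]
    exact extract_setWire (Fin.castAddEmb N') q _ _
  · exact ((isLinearMap_setWire q _).map_zero).symm

theorem red_gate (g : Gate (Fin N)) (σ : JState (Fin (k + k')) (Fin (N + N'))) :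
    red (fun M => (g.map (Fin.castAddEmb N')).apply (σ M)) = fun m => g.apply (red σ m) := by
  funext m
  simp only [red, (isLinearMap_apply g).map_fsum]
  refine Finset.sum_congr rfl fun M _ => ?_
  split_ifs with h
  · exact extract_apply_map (Fin.castAddEmb N') g _
  · exact ((isLinearMap_apply g).map_zero).symm

theorem red_toClient (q : Fin N) (i : Fin k) (σ : JState (Fin (k + k')) (Fin (N + N'))) :
    red (toClient (Fin.castAdd N' q) (Fin.castAdd k' i) σ) = toClient q i (red σ) := by
  funext m
  refine (sum_toClient (Fin.castAdd N' q) (Fin.castAdd k' i) σ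
    (G := fun M ρ => if M ∘ Fin.castAdd k' = m then
      extract (Fin.castAddEmb N') ρ else 0)
      fun M => isLinearMap_ite _ (isLinearMap_extract _)).trans ?_
  simp only [toClient, red, update_castAdd_comp, (isLinearMap_projWire q _).map_fsum]
  rw [Finset.sum_comm (γ := Bool)]
  refine Finset.sum_congr rfl fun M _ => ?_
  have h := sum_update_eq (M ∘ Fin.castAdd k') m i
    fun b => projWire q b (extract (Fin.castAddEmb N') (σ M))
  have h2 : ∀ b, extract (Fin.castAddEmb N') (projWire (Fin.castAdd N' q) b (σ M)) =
    projWire q b (extract (Fin.castAddEmb N') (σ M)) := fun b => extract_projWire _ _ _ _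
  simp only [h2]
  rw [h]
  refine Finset.sum_congr rfl fun b _ => ?_
  split_ifs
  · rfl
  · exact ((isLinearMap_projWire q _).map_zero).symm

theorem sum_append {E : Type*} [AddCommMonoid E] (F : (Fin (k + k') → Bool) → E) :
    ∑ M, F M = ∑ m : Fin k → Bool, ∑ m' : Fin k' → Bool, F (Fin.append m m') := by
  rw [← Fintype.sum_prod_type', ← (Fin.appendEquiv k k').sum_comp]
  rfl

theorem append_comp_castAdd (m : Fin k → Bool) (m' : Fin k' → Bool) :
    Fin.append m m' ∘ Fin.castAdd k' = m := funext fun i => Fin.append_left _ _ _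

theorem append_comp_natAdd (m : Fin k → Bool) (m' : Fin k' → Bool) :
    Fin.append m m' ∘ Fin.natAdd k = m' := funext fun i => Fin.append_right _ _ _

theorem append_comp (M : Fin (k + k') → Bool) :
    Fin.append (M ∘ Fin.castAdd k') (M ∘ Fin.natAdd k) = M := by
  funext i
  refine Fin.addCases (fun i => ?_) (fun i => ?_) i
  · simp
  · simp

theorem extend_castAddEmb (u : Fin k → Bool) (M : Fin (k + k') → Bool) :
    extend (Fin.castAddEmb k') u M = Fin.append u (M ∘ Fin.natAdd k) := by
  funext i
  refine Fin.addCases (fun i => ?_) (fun i => ?_) i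
  · rw [Fin.append_left]; exact extend_emb_apply (Fin.castAddEmb k') u M i
  · rw [Fin.append_right, Function.extend_apply']
    · rfl
    · rintro ⟨j, hj⟩; exact castAdd_ne_natAdd j i hj

theorem extend_natAddEmb (u : Fin k' → Bool) (M : Fin (k + k') → Bool) :
    extend (Fin.natAddEmb k) u M = Fin.append (M ∘ Fin.castAdd k') u := by
  funext i
  refine Fin.addCases (fun i => ?_) (fun i => ?_) i
  · rw [Fin.append_left, Function.extend_apply']
    · rfl
    · rintro ⟨j, hj⟩; exact castAdd_ne_natAdd i j hj.symm
  · rw [Fin.append_right]; exact extend_emb_apply (Fin.natAddEmb k) u M i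

theorem extract_castAdd_apply (ρ : Op (Fin (k + k'))) (u u' : Fin k → Bool) :
    extract (Fin.castAddEmb k') ρ u u' =
      ∑ e : Fin k' → Bool, ρ (Fin.append u e) (Fin.append u' e) := by
  rw [extract_apply, sum_append, Finset.sum_eq_single u]
  · refine Finset.sum_congr rfl fun e _ => ?_
    rw [extend_castAddEmb, append_comp_natAdd, if_pos]
    exact append_comp_castAdd u e
  · intro b _ hb
    refine Finset.sum_eq_zero fun e _ => ?_
    rw [if_neg]
    intro h; exact hb ((append_comp_castAdd b e).symm.trans h)
  · simp

theorem red_apply (σ : JState (Fin (k + k')) (Fin (N + N'))) (m : Fin k → Bool) :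
    red σ m = ∑ m' : Fin k' → Bool, extract (Fin.castAddEmb N') (σ (Fin.append m m')) := by
  rw [red, sum_append, Finset.sum_eq_single m]
  · simp only [append_comp_castAdd, if_true]
  · intro b _ hb
    refine Finset.sum_eq_zero fun e _ => ?_
    rw [append_comp_castAdd, if_neg hb]
  · simp

/-- Resetting all additional wires. -/
theorem runGates_reset_natAdd (ρ : Op (Fin (k + k'))) (w w' : Fin (k + k') → Bool) :
    runGates ((List.finRange k').map fun j => Gate.reset (Fin.natAdd k j)) ρ w w' =
      if w ∘ Fin.natAdd k = (fun _ => false) ∧ w' ∘ Fin.natAdd k = (fun _ => false) then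
        extract (Fin.castAddEmb k') ρ (w ∘ Fin.castAdd k') (w' ∘ Fin.castAdd k') else 0 := by
  -- Resetting traced-out wires does not change the reduced state.
  have h1 : ∀ (l : List (Fin k')) (ρ : Op (Fin (k + k'))),
      extract (Fin.castAddEmb k') (runGates (l.map fun j => Gate.reset (Fin.natAdd k j)) ρ) =
        extract (Fin.castAddEmb k') ρ := by
    intro l
    induction l with
    | nil => intro ρ; rfl
    | cons j l ih =>
      intro ρ
      refine (ih _).trans ?_
      ext u u'
      rw [extract_castAdd_apply, extract_castAdd_apply]
      simp only [Gate.apply, setWire, Matrix.of_apply, Fin.append_right]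
      have hu : ∀ (v : Fin k → Bool) (e : Fin k' → Bool) d,
          update (Fin.append v e) (Fin.natAdd k j) d = Fin.append v (update e j d) := by
        intro v e d
        rw [← append_comp (update (Fin.append v e) (Fin.natAdd k j) d)]
        congr 1
        · funext i; simp [castAdd_ne_natAdd]
        · funext i
          by_cases h : i = j
          · subst h; simp
          · have : Fin.natAdd k i ≠ Fin.natAdd k j := fun e => h (Fin.natAdd_injective _ _ e)
            simp [h]
      simp only [hu, and_self]
      have := sum_sum_update j fun (e e' : Fin k' → Bool) =>
        if e j = false then ρ (Fin.append u e') (Fin.append u' e') else 0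
      simp only [Function.update_self, Finset.sum_ite_eq', Finset.mem_univ, if_true] at this
      rw [← this]
      refine Finset.sum_congr rfl fun e _ => ?_
      split_ifs <;> simp
  -- Invariant along the list: wire `j` is either still to be reset or already supported on `0`, and
  -- resets of other wires preserve the latter.
  have h2 : ∀ (l : List (Fin k')) (ρ : Op (Fin (k + k'))) (j : Fin k'),
      (j ∈ l ∨ ∀ w w', (w (Fin.natAdd k j) = true ∨ w' (Fin.natAdd k j) = true) → ρ w w' = 0) →
      ∀ w w', (w (Fin.natAdd k j) = true ∨ w' (Fin.natAdd k j) = true) →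
        runGates (l.map fun j => Gate.reset (Fin.natAdd k j)) ρ w w' = 0 := by
    intro l
    induction l with
    | nil => intro ρ j h w w' hw; exact (h.resolve_left (by simp)) w w' hw
    | cons i l ih =>
      intro ρ j h
      refine ih _ j ?_
      by_cases hij : j = i
      · right
        subst hij
        intro w w' hw
        simp only [Gate.apply, setWire, Matrix.of_apply]
        rw [if_neg]
        rintro ⟨a, b⟩
        rcases hw with hw | hw <;> simp_all
      · rcases h with h | h
        · left; simpa [hij] using h
        · right
          intro w w' hw
          simp only [Gate.apply, setWire, Matrix.of_apply]
          split_ifs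
          · refine Finset.sum_eq_zero fun d _ => h _ _ ?_
            have : Fin.natAdd k j ≠ Fin.natAdd k i := fun e => hij (Fin.natAdd_injective _ _ e)
            simpa [this] using hw
          · rfl
  split_ifs with h
  · rw [← h1 (List.finRange k') ρ, extract_castAdd_apply, Finset.sum_eq_single (fun _ => false)]
    · conv_rhs => rw [← h.1, append_comp, h.1, ← h.2, append_comp]
    · intro e _ he
      obtain ⟨j, hj⟩ : ∃ j, e j = true := by
        by_contra hc
        push Not at hc
        exact he (funext fun j => by simpa using hc j)
      exact h2 _ _ j (by simp) _ _ (by simp [hj])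
    · simp
  · obtain ⟨j, hj⟩ : ∃ j, w (Fin.natAdd k j) = true ∨ w' (Fin.natAdd k j) = true := by
      by_contra hc
      push Not at hc
      exact h ⟨funext fun j => by simpa using (hc j).1, funext fun j => by simpa using (hc j).2⟩
    exact h2 _ _ j (by simp) _ _ hj

end

/-! ### The effect of an OSP call on the reduced state -/

section
variable {k N : ℕ}

theorem countP_map_client {K K' : Type} (f : K → K') (cs : List (CInstr K)) :
    (cs.map (CInstr.map f)).countP CInstr.isComm = cs.countP CInstr.isComm := by
  rw [List.countP_map]; congr 1; funext c; cases c <;> rfl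

theorem countP_map_server {W W' : Type} (f : W ↪ W') (ss : List (SInstr W)) :
    (ss.map (SInstr.map f)).countP SInstr.isComm = ss.countP SInstr.isComm := by
  rw [List.countP_map]; congr 1; funext c; cases c <;> rfl

/-- The client's local steps before a call of `P` with input in cell `b`. -/
def preLocals (P : OSPProtocol) (b : Fin k) : List (CLocal (Fin (k + P.k))) :=
  (List.finRange P.k).map (fun j => .const (Fin.natAdd k j) false) ++
    [.nand (Fin.castAdd P.k b) (Fin.castAdd P.k b) (Fin.natAdd k P.bIn),
      .nand (Fin.natAdd k P.bIn) (Fin.natAdd k P.bIn) (Fin.natAdd k P.bIn)]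

/-- The client's local steps after a call of `P` with output stored in cell `s`. -/
def postLocals (P : OSPProtocol) (s : Fin k) : List (CLocal (Fin (k + P.k))) :=
  [.nand (Fin.natAdd k P.sOut) (Fin.natAdd k P.sOut) (Fin.castAdd P.k s),
    .nand (Fin.castAdd P.k s) (Fin.castAdd P.k s) (Fin.castAdd P.k s)]

theorem toC_osp (P : OSPProtocol) (b s : Fin k) (q : Fin N) :
    (HInstr.osp b s q).toC P = (preLocals P b).map .loc ++
      (P.client.map (CInstr.map (Fin.natAdd k)) ++ (postLocals P s).map .loc) := by
  simp [HInstr.toC, preLocals, postLocals, copyBit, Function.comp_def]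

/-- The first NAND writes the complement of the input bit, the second one negates it. Together with
the clearing, this makes every call start from `initMem`, whatever an earlier call left behind. -/
theorem pushMem_pre (P : OSPProtocol) (b : Fin k) {W : Type} [Fintype W] [DecidableEq W]
    (σ : JState (Fin (k + P.k)) W) :
    locals (preLocals P b) σ =
      pushMem (fun M => Fin.append (M ∘ Fin.castAdd P.k) (P.initMem (M (Fin.castAdd P.k b)))) σ := by
  rw [locals_eq_pushMem]
  · congr 1
    funext M
    have : evalList (preLocals P b) M =
      evalList [.nand (Fin.castAdd P.k b) (Fin.castAdd P.k b) (Fin.natAdd k P.bIn),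
        .nand (Fin.natAdd k P.bIn) (Fin.natAdd k P.bIn) (Fin.natAdd k P.bIn)]
        (evalList ((List.finRange P.k).map (fun j => CLocal.const (Fin.natAdd k j) false)) M) :=
      List.foldl_append
    rw [this, evalList_const_false]
    funext i
    refine Fin.addCases (fun i => ?_) (fun i => ?_) i
    · have h1 : ∀ x : Fin P.k, Fin.natAdd k x ≠ Fin.castAdd P.k i :=
        fun x e => castAdd_ne_natAdd i x e.symm
      simp [evalList, CLocal.eval, castAdd_ne_natAdd, h1]
    · rw [Fin.append_right]
      by_cases h : i = P.bIn
      · subst h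
        have h1 : ∀ x : Fin P.k, Fin.natAdd k x ≠ Fin.castAdd P.k b :=
          fun x e => castAdd_ne_natAdd b x e.symm
        simp [evalList, CLocal.eval, OSPProtocol.initMem, h1]
      · have : Fin.natAdd k i ≠ Fin.natAdd k P.bIn := fun e => h (Fin.natAdd_injective _ _ e)
        simp [evalList, CLocal.eval, OSPProtocol.initMem, h]
  · intro c hc
    simp only [preLocals, List.mem_append, List.mem_map] at hc
    rcases hc with ⟨j, _, rfl⟩ | hc
    · trivial
    · simp at hc
      rcases hc with rfl | rfl <;> trivial

theorem pushMem_post (P : OSPProtocol) (s : Fin k) {W : Type} [Fintype W] [DecidableEq W]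
    (σ : JState (Fin (k + P.k)) W) :
    locals (postLocals P s) σ =
      pushMem (fun M => update M (Fin.castAdd P.k s) (M (Fin.natAdd k P.sOut))) σ := by
  rw [locals_eq_pushMem]
  · congr 1
    funext M
    simp [evalList, CLocal.eval, postLocals]
  · intro c hc
    simp [postLocals] at hc
    rcases hc with rfl | rfl <;> trivial

theorem append_inj {m m' : Fin k → Bool} {k' : ℕ} {e e' : Fin k' → Bool}  :
    Fin.append m e = Fin.append m' e' ↔ m = m' ∧ e = e' := by
  constructor
  · intro h
    constructor
    · rw [← append_comp_castAdd m e, h, append_comp_castAdd]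
    · rw [← append_comp_natAdd m e, h, append_comp_natAdd]
  · rintro ⟨rfl, rfl⟩; rfl

/-- The three CNOTs at the end of a call swap two wires. -/
theorem cx_swap {W : Type} [DecidableEq W] {a b : W} (h : a ≠ b) (w : W → Bool) :
    cx a b (cx b a (cx a b w)) = update (update w a (w b)) b (w a) := by
  funext j
  by_cases h1 : j = a
  · subst h1
    cases h3 : w j <;> cases h4 : w b <;> simp [cx, h, h3, h4]
  · by_cases h2 : j = b
    · subst h2
      simp [cx, h, h1]
    · simp [cx, h1, h2]

theorem update_append_left {k' : ℕ} (m : Fin k → Bool) (e : Fin k' → Bool) (i : Fin k) (d : Bool) :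
    update (Fin.append m e) (Fin.castAdd k' i) d = Fin.append (update m i d) e := by
  rw [← append_comp (update (Fin.append m e) (Fin.castAdd k' i) d), update_castAdd_comp,
    append_comp_castAdd]
  congr 1
  funext j
  have : Fin.natAdd k j ≠ Fin.castAdd k' i := fun e => castAdd_ne_natAdd i j e.symm
  simp [this]

theorem update_append_right {k' : ℕ} (m : Fin k → Bool) (e : Fin k' → Bool) (i : Fin k') (d : Bool) :
    update (Fin.append m e) (Fin.natAdd k i) d = Fin.append m (update e i d) := by
  rw [← append_comp (update (Fin.append m e) (Fin.natAdd k i) d)]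
  congr 1
  · funext j; simp [castAdd_ne_natAdd]
  · funext j
    by_cases h : j = i
    · subst h; simp
    · have : Fin.natAdd k j ≠ Fin.natAdd k i := fun e => h (Fin.natAdd_injective _ _ e)
      simp [h]

theorem sum_split {K : Type} {E : Type*} [Fintype K] [DecidableEq K] [AddCommMonoid E] (t : K)
    (F : (K → Bool) → E) :
    ∑ e, F e = ∑ d : Bool, ∑ e : K → Bool, if e t = false then F (update e t d) else 0 := by
  rw [Finset.sum_comm]
  have h := sum_sum_update (E := E) t fun e e' => if e t = false then F e' else 0
  simp only [Function.update_self, Finset.sum_ite_eq', Finset.mem_univ, if_true] at h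
  exact h.symm

/-- After the resets, the subroutine's part is in a fixed state determined by the bit in cell `b`,
so the joint state is a product with `red σ` (`e1`). By `interact_blk` the run of `P` multiplies
each entry by an entry of the final state of `P` alone (`e2`). The final swap moves the output qubit
of `P` onto `q` and the old content of `q` among the traced-out wires (`e3`), which is `replaceWire`
with `outState`. -/
theorem red_osp (P : OSPProtocol) (b s : Fin k) (q : Fin N)
    (σ : JState (Fin (k + P.k)) (Fin (N + P.N))) :
    red (interact ((HInstr.osp b s q).toC P) ((HInstr.osp b s q).toS P) σ) =
      (HInstr.osp b s q).step P.outState (red σ) := by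
  have hS : (HInstr.osp b s q).toS P =
      ((List.finRange P.N).map (fun j => Gate.reset (Fin.natAdd N j))).map SInstr.gate ++
      (P.server.map (SInstr.map (Fin.natAddEmb N)) ++
      ([.cnot (Fin.castAdd P.N q) (Fin.natAdd N P.qOut) (castAdd_ne_natAdd _ _),
       .cnot (Fin.natAdd N P.qOut) (Fin.castAdd P.N q) (castAdd_ne_natAdd _ _).symm,
       .cnot (Fin.castAdd P.N q) (Fin.natAdd N P.qOut) (castAdd_ne_natAdd _ _)].map SInstr.gate
       ++ [])) := by
    simp [HInstr.toS, Function.comp_def]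
  rw [toC_osp, hS, interact_locals_append, interact_gates_append, ← List.append_assoc,
    interact_append_locals]
  rw [← List.append_nil (P.client.map _), List.append_assoc, interact_append_append _ _ _ _ _ (by
    rw [countP_map_client, countP_map_server, P.sync]), interact_gates_append, interact_nil_nil,
    pushMem_post, pushMem_pre]
  set σ1 : JState (Fin (k + P.k)) (Fin (N + P.N)) := fun m =>
    runGates ((List.finRange P.N).map (fun j => Gate.reset (Fin.natAdd N j)))
      (pushMem (fun M => Fin.append (M ∘ Fin.castAdd P.k) (P.initMem (M (Fin.castAdd P.k b)))) σ m)
    with hσ1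
  have e1 : ∀ M w w', σ1 M w w' = if w ∘ Fin.natAdd N = (fun _ => false) ∧
      w' ∘ Fin.natAdd N = (fun _ => false) then
      (if M ∘ Fin.natAdd k = P.initMem (M (Fin.castAdd P.k b)) then
        red σ (M ∘ Fin.castAdd P.k) (w ∘ Fin.castAdd P.N) (w' ∘ Fin.castAdd P.N) else 0) else 0 := by
    intro M w w'
    rw [hσ1]
    simp only [runGates_reset_natAdd]
    congr 1
    have : ∀ M', (Fin.append (M' ∘ Fin.castAdd P.k) (P.initMem (M' (Fin.castAdd P.k b))) = M) ↔
        (M ∘ Fin.natAdd k = P.initMem (M (Fin.castAdd P.k b)) ∧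
          M' ∘ Fin.castAdd P.k = M ∘ Fin.castAdd P.k) := by
      intro M'
      conv_lhs => rw [← append_comp M, append_inj]
      constructor
      · rintro ⟨h1, h2⟩
        exact ⟨by rw [← h2]; exact congrArg P.initMem (congrFun h1 b), h1⟩
      · rintro ⟨h1, h2⟩
        exact ⟨h2, by rw [h1]; exact congrArg P.initMem (congrFun h2 b)⟩
    simp only [pushMem, this, (isLinearMap_extract _).map_fsum, Matrix.sum_apply, red]
    split_ifs with h
    · refine Finset.sum_congr rfl fun a _ => ?_
      by_cases h2 : a ∘ Fin.castAdd P.k = M ∘ Fin.castAdd P.k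
      · rw [if_pos ⟨h, h2⟩, if_pos h2]
      · simp [h2, (isLinearMap_extract (Fin.castAddEmb P.N)).map_zero]
    · refine Finset.sum_eq_zero fun a _ => ?_
      simp [h, (isLinearMap_extract (Fin.castAddEmb P.N)).map_zero]
  set σ2 := interact (P.client.map (CInstr.map (Fin.natAdd k)))
    (P.server.map (SInstr.map (Fin.natAddEmb N))) σ1 with hσ2
  have e2 : ∀ m m' u u' e e', σ2 (Fin.append m m') (Fin.append u e) (Fin.append u' e') =
      red σ m u u' * interact P.client P.server (initState (P.initMem (m b)) zeroState) m' e e' := by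
    intro m m' u u' e e'
    have hb := interact_blk (Fin.natAddEmb k) (Fin.natAddEmb N) (Fin.append m m') (Fin.append u e)
      (Fin.append u' e') P.client P.server σ1
    have hl : σ2 (Fin.append m m') (Fin.append u e) (Fin.append u' e') =
        blkJ (Fin.natAddEmb k) (Fin.natAddEmb N) (Fin.append m m') (Fin.append u e)
          (Fin.append u' e') σ2 m' e e' := by
      simp only [blkJ, blk, Matrix.of_apply, extend_natAddEmb, append_comp_castAdd]
    rw [hl]
    refine (congrFun (congrFun (congrFun hb m') e) e').trans ?_
    have hr : blkJ (Fin.natAddEmb k) (Fin.natAddEmb N) (Fin.append m m') (Fin.append u e)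
          (Fin.append u' e') σ1 = red σ m u u' • initState (P.initMem (m b)) zeroState := by
      funext m'' 
      ext v v'
      simp only [blkJ, blk, Matrix.of_apply, extend_natAddEmb, append_comp_castAdd, e1,
        append_comp_natAdd, initState, Fin.append_left, Pi.smul_apply, Matrix.smul_apply]
      by_cases h1 : m'' = P.initMem (m b)
      · by_cases h2 : v = fun _ => false
        · by_cases h3 : v' = fun _ => false
          · simp [h1, h2, h3, zeroState]
          · have h3' : (fun _ => false) ≠ v' := fun e => h3 e.symm
            simp [h1, h2, h3, h3', zeroState, Matrix.single]
        · have h2' : (fun _ => false) ≠ v := fun e => h2 e.symm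
          simp [h1, h2, h2', zeroState, Matrix.single]
      · simp [h1]
    rw [hr, (isLinearMap_interact _ _).map_smul]
    rfl
  set σ3 : JState (Fin (k + P.k)) (Fin (N + P.N)) := fun m => runGates
    [.cnot (Fin.castAdd P.N q) (Fin.natAdd N P.qOut) (castAdd_ne_natAdd _ _),
      .cnot (Fin.natAdd N P.qOut) (Fin.castAdd P.N q) (castAdd_ne_natAdd _ _).symm,
      .cnot (Fin.castAdd P.N q) (Fin.natAdd N P.qOut) (castAdd_ne_natAdd _ _)] (σ2 m) with hσ3
  have e3 : ∀ m m' u u' e e', σ3 (Fin.append m m') (Fin.append u e) (Fin.append u' e') =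
      red σ m (update u q (e P.qOut)) (update u' q (e' P.qOut)) *
        interact P.client P.server (initState (P.initMem (m b)) zeroState) m'
          (update e P.qOut (u q)) (update e' P.qOut (u' q)) := by
    intro m m' u u' e e'
    have hc := castAdd_ne_natAdd q P.qOut
    rw [hσ3]
    simp only [runGates, List.foldl_cons, List.foldl_nil, Gate.apply]
    rw [conj_cnot_apply hc, conj_cnot_apply hc.symm, conj_cnot_apply hc, cx_swap hc, cx_swap hc]
    simp only [Fin.append_left, Fin.append_right, update_append_left, update_append_right, e2]
  funext m
  refine (sum_pushMem _ σ3 (G := fun M ρ => if M ∘ Fin.castAdd P.k = m then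
    extract (Fin.castAddEmb P.N) ρ else 0) fun M => isLinearMap_ite _ (isLinearMap_extract _)).trans ?_
  simp only [update_castAdd_comp]
  rw [sum_append]
  simp only [append_comp_castAdd, Fin.append_right, HInstr.step]
  refine Finset.sum_congr rfl fun m1 _ => ?_
  ext u u'
  simp only [Matrix.sum_apply]
  have hmid : ∀ m' : Fin P.k → Bool, (extract (Fin.castAddEmb P.N) (σ3 (Fin.append m1 m'))) u u' =
      (∑ e : Fin P.N → Bool, if e P.qOut = false then
        interact P.client P.server (initState (P.initMem (m1 b)) zeroState) m'
        (update e P.qOut (u q)) (update e P.qOut (u' q)) else 0) *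
      ∑ d : Bool, red σ m1 (update u q d) (update u' q d) := by
    intro m'
    rw [extract_castAdd_apply]
    simp only [e3]
    -- The value `d` of the wire `qOut` is split off: after the swap it is the discarded content of
    -- `q`.
    rw [sum_split P.qOut]
    simp only [Function.update_self, Function.update_idem]
    rw [Finset.mul_sum]
    refine Finset.sum_congr rfl fun d _ => ?_
    rw [Finset.sum_mul]
    refine Finset.sum_congr rfl fun e _ => ?_
    split_ifs
    · ring
    · simp
  have hl : ∀ m' : Fin P.k → Bool, (if update m1 s (m' P.sOut) = m then
      extract (Fin.castAddEmb P.N) (σ3 (Fin.append m1 m')) else 0 : Op (Fin N)) u u' =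
      ∑ d : Bool, if update m1 s d = m then (if m' P.sOut = d then
        (extract (Fin.castAddEmb P.N) (σ3 (Fin.append m1 m'))) u u' else 0) else 0 := by
    intro m'
    rw [Finset.sum_eq_single (m' P.sOut)]
    · split_ifs <;> simp_all
    · intro d _ hd; simp [hd.symm]
    · simp
  simp only [hl, hmid]
  rw [Finset.sum_comm]
  refine Finset.sum_congr rfl fun d _ => ?_
  split_ifs with h
  · simp only [replaceWire, Matrix.of_apply, OSPProtocol.outState]
    rw [Finset.sum_mul]
    refine Finset.sum_congr rfl fun m' _ => ?_
    split_ifs <;> simp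
  · simp

theorem countP_toC_toS (P : OSPProtocol) (h : HInstr k N) :
    (h.toC P).countP CInstr.isComm = (h.toS P).countP SInstr.isComm := by
  simpa using Template.sync_aux P [h]

theorem red_step (P : OSPProtocol) (h : HInstr k N) (σ : JState (Fin (k + P.k)) (Fin (N + P.N))) :
    red (interact (h.toC P) (h.toS P) σ) = h.step P.outState (red σ) := by
  cases h with
  | client c =>
    simp only [HInstr.toC, HInstr.toS, interact_loc, interact_nil_nil]
    exact red_clocal c σ
  | server g =>
    simp only [HInstr.toC, HInstr.toS, interact_gate, interact_nil_nil]
    exact red_gate g σ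
  | toServer i q =>
    simp only [HInstr.toC, HInstr.toS, interact_send_comm, interact_nil_nil]
    exact red_toServer i q σ
  | toClient q i =>
    simp only [HInstr.toC, HInstr.toS, interact_recv_comm, interact_nil_nil]
    exact red_toClient q i σ
  | osp b s q => exact red_osp P b s q σ

/-- Seen from the template, a run with the real subroutine is a run in which every call delivers
`outState`. All further analysis of correctness takes place on this smaller state space. -/
theorem red_interact (P : OSPProtocol) (p : List (HInstr k N))
    (σ : JState (Fin (k + P.k)) (Fin (N + P.N))) :
    red (interact (p.flatMap (HInstr.toC P)) (p.flatMap (HInstr.toS P)) σ) =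
      runSteps P.outState p (red σ) := by
  induction p generalizing σ with
  | nil => simp only [List.flatMap_nil, interact_nil_nil]; rfl
  | cons h p ih =>
    rw [List.flatMap_cons, List.flatMap_cons, interact_append_append _ _ _ _ _ (countP_toC_toS P h),
      ih, red_step]
    rfl

end

/-! ### The channel of an expanded template -/

namespace Template

variable {Q : QCircuit}

/-- The initial memory of the client of a template. -/
def initMem (T : Template Q) (x : Fin Q.n → Bool) : Fin T.k → Bool :=
  fun i => decide (∃ j, T.xIn j = i ∧ x j = true)

/-- The channel implemented by a template when OSP calls have outputs `Ω`. -/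
def channel (T : Template Q) (Ω : Bool → Bool → Matrix Bool Bool ℂ) (x : Fin Q.n → Bool)
    (ρ : Op (Fin Q.v)) : Op (Fin Q.w) :=
  ∑ m : Fin T.k → Bool, conj (pauli (m ∘ T.rOut) (m ∘ T.sOut))
    (extract T.wOut (runSteps Ω T.prog (initState (T.initMem x) (load T.vIn (fun _ => false) ρ)) m))

theorem extract_trans {A B W : Type} [Fintype A] [DecidableEq A] [Fintype B] [DecidableEq B]
    [Fintype W] [DecidableEq W] (f : A ↪ B) (g : B ↪ W) (ρ : Op W) :
    extract (f.trans g) ρ = extract f (extract g ρ) := by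
  ext u u'
  rw [extract_apply, extract_apply]
  simp only [extract_apply]
  have : ∀ v : B → Bool, (if v ∘ f = u then ∑ w : W → Bool, if w ∘ g = v then
      ρ w (extend g (extend f u' v) w) else 0 else 0 : ℂ) =
      ∑ w : W → Bool, if w ∘ g = v then
        (if v ∘ f = u then ρ w (extend g (extend f u' v) w) else 0) else 0 := by
    intro v
    split_ifs <;> simp
  simp only [this]
  rw [Finset.sum_comm]
  refine Finset.sum_congr rfl fun w _ => ?_
  simp only [Finset.sum_ite_eq, Finset.mem_univ, if_true]
  have h2 : extend (f.trans g) u' w = extend g (extend f u' (w ∘ g)) w := by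
    funext i
    by_cases hi : ∃ j, g j = i
    · obtain ⟨j, rfl⟩ := hi
      rw [g.injective.extend_apply]
      by_cases hj : ∃ l, f l = j
      · obtain ⟨l, rfl⟩ := hj
        rw [f.injective.extend_apply]
        exact (f.trans g).injective.extend_apply u' w l
      · rw [Function.extend_apply' _ _ _ hj, Function.extend_apply']
        · rfl
        · rintro ⟨l, hl⟩; exact hj ⟨l, g.injective hl⟩
    · rw [Function.extend_apply' _ _ _ hi, Function.extend_apply']
      rintro ⟨l, hl⟩; exact hi ⟨f l, hl⟩
  rw [h2]
  rfl

theorem extract_load_castAdd {A : Type} [Fintype A] [DecidableEq A] {N N' : ℕ} (f : A ↪ Fin N)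
    (ρ : Op A) :
    extract (Fin.castAddEmb N') (load (f.trans (Fin.castAddEmb N')) (fun _ => false) ρ) =
      load f (fun _ => false) ρ := by
  ext u u'
  rw [extract_castAdd_apply, Finset.sum_eq_single (fun _ => false)]
  · have hc : ∀ v : Fin N → Bool, (Fin.append v fun _ : Fin N' => false) ∘ (f.trans (Fin.castAddEmb N')) =
        v ∘ f := fun v => funext fun i => Fin.append_left _ _ _
    simp only [load, Matrix.of_apply, hc]
    congr 1
    apply propext
    constructor
    · intro h i hi
      have := h (Fin.castAdd N' i) fun j hj => hi j (Fin.castAdd_injective _ _ hj)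
      simpa using this
    · intro h i
      refine Fin.addCases (fun i => ?_) (fun i => ?_) i
      · intro hi
        rw [Fin.append_left, Fin.append_left]
        exact h i fun j hj => hi j (by rw [← hj]; rfl)
      · intro _
        simp
  · intro e _ he
    obtain ⟨j, hj⟩ : ∃ j, e j = true := by
      by_contra hc
      push Not at hc
      exact he (funext fun j => by simpa using hc j)
    simp only [load, Matrix.of_apply]
    rw [if_neg]
    intro h
    have := h (Fin.natAdd N j) fun i hi => castAdd_ne_natAdd (f i) j hi
    simp [hj] at this
  · simp

/-- The final keys and the output wires belong to the template's part, so the decrypted output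
depends only on `red` of the final state. -/
theorem real_expand (T : Template Q) (P : OSPProtocol) (x : Fin Q.n → Bool) (ρ : Op (Fin Q.v)) :
    (T.expand P).real x ρ = T.channel P.outState x ρ := by
  let I : Fin (T.k + P.k) → Bool := (T.expand P).initMem x
  let σ₀ : JState (Fin (T.k + P.k)) (Fin (T.N + P.N)) :=
    initState I (load (T.vIn.trans (Fin.castAddEmb P.N)) (fun _ => false) ρ)
  have hinit : red σ₀ = initState (T.initMem x) (load T.vIn (fun _ => false) ρ) := by
    funext m
    have hm : I = Fin.append (T.initMem x) fun _ => false := by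
      rw [← append_comp I]
      congr 1
      · funext i
        refine decide_eq_decide.2 ?_
        constructor
        · rintro ⟨j, h, hx⟩; exact ⟨j, Fin.castAdd_injective _ _ h, hx⟩
        · rintro ⟨j, h, hx⟩; exact ⟨j, by rw [← h]; rfl, hx⟩
      · funext i
        refine decide_eq_false (p := ∃ j, T.xIn.trans (Fin.castAddEmb P.k) j = Fin.natAdd T.k i ∧
          x j = true) ?_
        rintro ⟨j, h, _⟩
        exact castAdd_ne_natAdd (T.xIn j) i h
    rw [red_apply]
    simp only [σ₀, hm, initState, append_inj]
    rw [Finset.sum_eq_single (fun _ => false)]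
    · simp only [and_true]
      split_ifs
      · exact extract_load_castAdd T.vIn ρ
      · exact (isLinearMap_extract _).map_zero
    · intro e _ he
      simp [he, (isLinearMap_extract _).map_zero]
    · simp
  rw [channel, ← hinit, ← red_interact]
  change ∑ M : Fin (T.k + P.k) → Bool, conj (pauli ((M ∘ Fin.castAdd P.k) ∘ T.rOut)
    ((M ∘ Fin.castAdd P.k) ∘ T.sOut)) (extract (T.wOut.trans (Fin.castAddEmb P.N))
      (interact (T.prog.flatMap (HInstr.toC P)) (T.prog.flatMap (HInstr.toS P)) σ₀ M)) = _
  simp only [red, (isLinearMap_extract _).map_fsum, (isLinearMap_conj _).map_fsum]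
  rw [Finset.sum_comm]
  refine Finset.sum_congr rfl fun M _ => ?_
  rw [Finset.sum_eq_single (M ∘ Fin.castAdd P.k)]
  · rw [if_pos rfl, ← extract_trans]
  · intro m _ hm
    rw [if_neg hm.symm, (isLinearMap_extract _).map_zero, (isLinearMap_conj _).map_zero]
  · simp

end Template

/-! ### The quantum one-time pad -/

section
variable {W : Type} [Fintype W] [DecidableEq W]

/-- The sign `(-1)^{a b}`. -/
def sg (a b : Bool) : ℂ := if a && b then -1 else 1

/-- The sign `(-1)^{s · v}`. -/
def sgn (s v : W → Bool) : ℂ := ∏ i, sg (s i) (v i)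

/-- Bitwise sum. -/
def flip (r v : W → Bool) : W → Bool := fun i => xor (v i) (r i)

theorem sg_mul_self (a b : Bool) : sg a b * sg a b = 1 := by cases a <;> cases b <;> simp [sg]

theorem star_sgn (s v : W → Bool) : star (sgn s v) = sgn s v := by
  simp only [sgn, star_prod]
  refine Finset.prod_congr rfl fun i _ => ?_
  cases s i <;> cases v i <;> simp [sg]

theorem sgn_update_right (s v : W → Bool) (q : W) (a : Bool) :
    sgn s (update v q a) = sgn s v * sg (s q) (xor (v q) a) := by
  simp only [sgn]
  rw [← Finset.mul_prod_erase _ _ (Finset.mem_univ q), ← Finset.mul_prod_erase _ _ (Finset.mem_univ q)]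
  have : ∏ x ∈ Finset.univ.erase q, sg (s x) (update v q a x) =
      ∏ x ∈ Finset.univ.erase q, sg (s x) (v x) :=
    Finset.prod_congr rfl fun x hx => by rw [Function.update_of_ne (Finset.ne_of_mem_erase hx)]
  rw [this, Function.update_self]
  have : sg (s q) a = sg (s q) (v q) * sg (s q) (xor (v q) a) := by
    cases s q <;> cases v q <;> cases a <;> simp [sg]
  rw [this]; ring

theorem sgn_comm (s v : W → Bool) : sgn s v = sgn v s :=
  Finset.prod_congr rfl fun i _ => by cases s i <;> cases v i <;> rfl

theorem sgn_update_left (s v : W → Bool) (q : W) (a : Bool) :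
    sgn (update s q a) v = sgn s v * sg (xor (s q) a) (v q) := by
  rw [sgn_comm, sgn_update_right, sgn_comm]
  congr 1
  cases s q <;> cases v q <;> cases a <;> rfl

theorem conj_pauli_apply (r s : W → Bool) (ρ : Op W) (u u' : W → Bool) :
    conj (pauli r s) ρ u u' = sgn s (flip r u) * sgn s (flip r u') * ρ (flip r u) (flip r u') := by
  have hp : ∀ u y : W → Bool, pauli r s u y = if y = flip r u then sgn s y else 0 := by
    intro u y
    have : u = (fun i => xor (y i) (r i)) ↔ y = flip r u := by
      constructor
      · rintro rfl; funext i; simp [flip]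
      · rintro rfl; funext i; simp [flip]
    simp only [pauli, Matrix.of_apply, this]
    rfl
  simp only [conj, Matrix.mul_apply, hp, Matrix.conjTranspose_apply, apply_ite star, star_sgn, star_zero,
    ite_mul, zero_mul, mul_ite, mul_zero, Finset.sum_ite_eq', Finset.mem_univ, if_true]
  ring

theorem flip_update (r r' w : W → Bool) (q : W) (a : Bool) (hr : ∀ j, j ≠ q → r' j = r j) :
    flip r (update w q a) = update (flip r' w) q (xor a (r q)) := by
  funext j
  by_cases hj : j = q
  · subst hj; simp [flip]
  · simp [flip, hj, hr j hj]

theorem sum_xor {E : Type*} [AddCommMonoid E] (c : Bool) (f : Bool → E) :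
    ∑ a : Bool, f (xor a c) = ∑ a : Bool, f a := by
  cases c <;> simp [add_comm]

/-- A one-qubit gate commutes with the one-time pad up to an update of the keys on its wire. -/
theorem pad_onWire (q : W) (U : Matrix Bool Bool ℂ) (r s r' s' : W → Bool)
    (hr : ∀ j, j ≠ q → r' j = r j) (hs : ∀ j, j ≠ q → s' j = s j) (φ : ℂ) (hφ : φ * star φ = 1)
    (h : ∀ x a, sg (s' q) (xor x (r' q)) * U (xor x (r' q)) (xor a (r q)) =
      φ * U x a * sg (s q) (xor a (r q))) (ρ : Op W) :
    conj (pauli r' s') (conj (onWire q U) ρ) = conj (onWire q U) (conj (pauli r s) ρ) := by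
  have hsu : s' = update s q (s' q) := by
    funext j
    by_cases hj : j = q
    · subst hj; simp
    · simp [hj, hs j hj]
  -- This is the one-qubit identity `h` multiplied by the signs of the other wires. Its phase `φ`
  -- will cancel between row and column.
  have key : ∀ (w : W → Bool) (a : Bool),
      sgn s' (flip r' w) * U (flip r' w q) (xor a (r q)) =
        φ * U (w q) a * sgn s (update (flip r' w) q (xor a (r q))) := by
    intro w a
    have h1 := h (w q) a
    have h2 : flip r' w q = xor (w q) (r' q) := rfl
    rw [hsu, sgn_update_left, sgn_update_right, h2]
    have h3 : sg (xor (s q) (s' q)) (xor (w q) (r' q)) =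
        sg (s q) (xor (w q) (r' q)) * sg (s' q) (xor (w q) (r' q)) := by
      cases s q <;> cases s' q <;> cases w q <;> cases r' q <;> simp [sg]
    have h4 : sg (s q) (xor (xor (w q) (r' q)) (xor a (r q))) =
        sg (s q) (xor (w q) (r' q)) * sg (s q) (xor a (r q)) := by
      cases s q <;> cases a <;> cases w q <;> cases r' q <;> cases r q <;> simp [sg]
    rw [h3, h4]
    linear_combination (sgn s (flip r' w) * sg (s q) (xor (w q) (r' q))) * h1
  ext w w'
  rw [conj_pauli_apply, conj_onWire_apply, conj_onWire_apply, ← sum_xor (r q)]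
  rw [Finset.mul_sum]
  refine Finset.sum_congr rfl fun a _ => ?_
  rw [← sum_xor (r q), Finset.mul_sum]
  refine Finset.sum_congr rfl fun b _ => ?_
  rw [conj_pauli_apply, flip_update r r' w q a hr, flip_update r r' w' q b hr]
  have k1 := key w a
  have k2 := congrArg star (key w' b)
  simp only [star_mul', star_sgn] at k2
  generalize ρ (update (flip r' w) q (xor a (r q))) (update (flip r' w') q (xor b (r q))) = z
  calc _ = (sgn s' (flip r' w) * U (flip r' w q) (xor a (r q))) *
        (sgn s' (flip r' w') * star (U (flip r' w' q) (xor b (r q)))) * z := by ring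
    _ = (φ * star φ) * (U (w q) a * star (U (w' q) b) *
        (sgn s (update (flip r' w) q (xor a (r q))) * sgn s (update (flip r' w') q (xor b (r q))) *
          z)) := by rw [k1, k2]; ring
    _ = _ := by rw [hφ, one_mul]

/-- `H` exchanges `X` and `Z`, hence the two keys. Reordering the Paulis costs the sign `sg (s q) (r
q)`, which conjugation removes. -/
theorem pad_h (q : W) (r s : W → Bool) (ρ : Op W) :
    conj (pauli (update r q (s q)) (update s q (r q))) (conj (onWire q hMat) ρ) =
      conj (onWire q hMat) (conj (pauli r s) ρ) := by
  refine pad_onWire q hMat r s _ _ (fun j hj => by simp [hj]) (fun j hj => by simp [hj])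
    (sg (s q) (r q)) ?_ ?_ ρ
  · cases s q <;> cases r q <;> simp [sg]
  · intro x a
    simp only [Function.update_self]
    cases s q <;> cases r q <;> cases x <;> cases a <;> simp [sg, hMat, neg_div]

/-- Up to a phase `P X P†` is `X Z`, so the X-key is added to the Z-key. -/
theorem pad_p (q : W) (r s : W → Bool) (ρ : Op W) :
    conj (pauli r (update s q (xor (s q) (r q)))) (conj (onWire q pMat) ρ) =
      conj (onWire q pMat) (conj (pauli r s) ρ) := by
  refine pad_onWire q pMat r s _ _ (fun j hj => rfl) (fun j hj => by simp [hj])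
    (if r q then -Complex.I else 1) ?_ ?_ ρ
  · cases r q <;> simp
  · intro x a
    simp only [Function.update_self]
    cases s q <;> cases r q <;> cases x <;> cases a <;> simp [sg, pMat]

theorem flip_flip_cx (r w : W → Bool) {c t : W} (h : c ≠ t) : cx c t (flip (cx c t r) w) = flip r (cx c t w) := by
  funext j
  by_cases hj : j = t
  · subst hj
    cases h1 : w c <;> cases h2 : w j <;> cases h3 : r c <;> cases h4 : r j <;>
      simp [cx, flip, h, h1, h2, h3, h4]
  · simp [cx, flip, hj]

theorem sgn_cx (s v : W → Bool) {c t : W} (h : c ≠ t) :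
    sgn s (cx c t v) = sgn (update s c (xor (s c) (s t))) v := by
  rw [cx, sgn_update_right, sgn_update_left]
  congr 1
  cases s c <;> cases s t <;> cases v c <;> cases v t <;> rfl

/-- CNOT spreads `X` from the control to the target and `Z` from the target to the control. -/
theorem pad_cnot {c t : W} (h : c ≠ t) (r s : W → Bool) (ρ : Op W) :
    conj (pauli (update r t (xor (r t) (r c))) (update s c (xor (s c) (s t)))) (conj (cnotMat c t) ρ) =
      conj (cnotMat c t) (conj (pauli r s) ρ) := by
  ext w w'
  rw [conj_pauli_apply, conj_cnot_apply h, conj_cnot_apply h, conj_pauli_apply, ← sgn_cx _ _ h,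
    ← sgn_cx _ _ h]
  change sgn s (cx c t (flip (cx c t r) w)) * sgn s (cx c t (flip (cx c t r) w')) *
    ρ (cx c t (flip (cx c t r) w)) (cx c t (flip (cx c t r) w')) = _
  rw [flip_flip_cx _ _ h, flip_flip_cx _ _ h]

/-- An overwritten wire forgets its old keys, and the new ones are free: the new X-key shifts the
written value, and the sign of the new Z-key is the same in row and column. This covers resets and
encrypted inputs alike. -/
theorem pad_setWire (q : W) (r s r' s' : W → Bool) (b b' : Bool) (hb : b = xor b' (r' q))
    (hr : ∀ j, j ≠ q → r' j = r j) (hs : ∀ j, j ≠ q → s' j = s j) (ρ : Op W) :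
    conj (pauli r' s') (setWire q b' ρ) = setWire q b (conj (pauli r s) ρ) := by
  have hsu : s' = update s q (s' q) := by
    funext j
    by_cases hj : j = q
    · subst hj; simp
    · simp [hj, hs j hj]
  have hb2 : ∀ x : Bool, xor x (r' q) = b' ↔ x = b := by
    intro x; subst hb; cases x <;> cases b' <;> cases r' q <;> simp
  ext w w'
  rw [conj_pauli_apply]
  simp only [setWire, Matrix.of_apply, conj_pauli_apply]
  have hq : ∀ w, flip r' w q = xor (w q) (r' q) := fun w => rfl
  simp only [hq, hb2]
  split_ifs with hw
  · rw [← sum_xor (r q), Finset.mul_sum]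
    refine Finset.sum_congr rfl fun d _ => ?_
    rw [flip_update r r' w q d hr, flip_update r r' w' q d hr, hsu, sgn_update_left, sgn_update_left,
      sgn_update_right, sgn_update_right, hq, hq, hw.1, hw.2]
    generalize ρ _ _ = z
    have h1 := sg_mul_self (xor (s q) (s' q)) (xor b (r' q))
    have h2 := sg_mul_self (s q) (xor (xor b (r' q)) (xor d (r q)))
    linear_combination (sgn s (flip r' w) * sgn s (flip r' w') * z) * (h1 - h2)
  · simp

/-- On a traced-out wire the row and column labels agree, so its Z-signs square to `1`, and its
X-flip only permutes the summation. -/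
theorem pad_extract {A : Type} [Fintype A] [DecidableEq A] (f : A ↪ W) (r s : W → Bool) (ρ : Op W) :
    conj (pauli (r ∘ f) (s ∘ f)) (extract f ρ) = extract f (conj (pauli r s) ρ) := by
  have hf : ∀ (r r' : W → Bool), flip r (flip r r') = r' := fun r r' => by funext i; simp [flip]
  have hx : ∀ (u : A → Bool) (w : W → Bool),
      flip r (extend f u w) = extend f (flip (r ∘ f) u) (flip r w) := by
    intro u w
    rw [← extend_comp_self f (flip r (extend f u w)) (flip r w)]
    · congr 1
      funext i
      simp [flip, extend_emb_apply]
    · intro i hi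
      simp only [flip]
      rw [Function.extend_apply']
      rintro ⟨j, hj⟩; exact hi j hj
  have hsg : ∀ (u u' : A → Bool) (w : W → Bool), w ∘ f = u →
      sgn s w * sgn s (extend f u' w) = sgn (s ∘ f) u * sgn (s ∘ f) u' := by
    rintro u u' w rfl
    rw [sgn, sgn, ← Finset.prod_mul_distrib, sgn, sgn, ← Finset.prod_mul_distrib]
    symm
    refine Finset.prod_of_injOn f f.injective.injOn (fun _ _ => by simp) ?_ ?_
    · intro i _ hi
      have : ¬ ∃ j, f j = i := by simpa using hi
      rw [Function.extend_apply' _ _ _ this, sg_mul_self]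
    · intro i _
      simp [extend_emb_apply]
  ext u u'
  rw [conj_pauli_apply, extract_apply, extract_apply, Finset.mul_sum]
  refine Finset.sum_nbij' (flip r) (flip r) (by simp) (by simp) (fun w _ => hf r w)
    (fun w _ => hf r w) ?_
  intro w _
  have hc : w ∘ f = flip (r ∘ f) u ↔ flip r w ∘ f = u := by
    constructor
    · intro h
      have : flip r w ∘ f = flip (r ∘ f) (w ∘ f) := rfl
      rw [this, h]; funext i; simp [flip]
    · rintro rfl; funext i; simp [flip]
  rw [conj_pauli_apply, hf, hx, hf]
  simp only [hc]
  split_ifs with h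
  · rw [← hsg _ _ w (hc.2 h)]
  · simp

theorem pauli_zero (ρ : Op W) : conj (pauli (fun _ => false) (fun _ => false)) ρ = ρ := by
  ext u u'
  have h : ∀ u : W → Bool, flip (fun _ => false) u = u := fun u => by funext i; simp [flip]
  rw [conj_pauli_apply, h, h]
  simp [sgn, sg]

/-! ### Loading -/

theorem setWire_load {A : Type} [Fintype A] [DecidableEq A] (f : A ↪ W) (d : W → Bool) (ρ : Op A)
    (i : W) (hi : ∀ j, f j ≠ i) (b : Bool) :
    setWire i b (load f d ρ) = load f (update d i b) ρ := by
  ext w w'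
  simp only [setWire, load, Matrix.of_apply]
  have hc : ∀ (v : W → Bool) (x : Bool), update v i x ∘ f = v ∘ f := fun v x =>
    funext fun j => Function.update_of_ne (hi j) _ _
  simp only [hc]
  rw [Finset.sum_eq_single (d i)]
  · rw [← ite_and]
    congr 1
    apply propext
    constructor
    · rintro ⟨h1, h2⟩ l hl
      by_cases h : l = i
      · subst h; simp [h1]
      · simpa [h] using h2 l hl
    · intro h
      refine ⟨by simpa using h i hi, fun l hl => ?_⟩
      by_cases hh : l = i
      · subst hh; simp
      · simpa [hh] using h l hl
  · intro x _ hx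
    rw [if_neg]
    intro h
    exact hx (by simpa using (h i hi).1)
  · simp

theorem extract_load {A B : Type} [Fintype A] [DecidableEq A] [Fintype B] [DecidableEq B]
    (f : A ↪ B) (g : B ↪ W) (ρ : Op A) :
    extract g (load (f.trans g) (fun _ => false) ρ) = load f (fun _ => false) ρ := by
  ext u u'
  rw [extract_apply, Finset.sum_eq_single (extend g u fun _ => false)]
  · have hc : ∀ (v : B → Bool) e, extend g v e ∘ (f.trans g) = v ∘ f := fun v e =>
      funext fun i => extend_emb_apply g v e (f i)
    rw [if_pos (extend_comp_emb _ _ _)]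
    simp only [load, Matrix.of_apply, hc]
    congr 1
    apply propext
    constructor
    · intro h i hi
      simpa [extend_emb_apply] using h (g i) fun j hj => hi j (g.injective hj)
    · intro h i hi
      by_cases hg : ∃ j, g j = i
      · obtain ⟨j, rfl⟩ := hg
        rw [extend_emb_apply, extend_emb_apply]
        exact h j fun l hl => hi l (by rw [← hl]; rfl)
      · rw [Function.extend_apply' _ _ _ hg, Function.extend_apply' _ _ _ hg,
          Function.extend_apply' _ _ _ hg]
        simp
  · intro w _ hw
    split_ifs with h
    · subst h
      simp only [load, Matrix.of_apply]
      rw [if_neg]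
      intro h2
      apply hw
      symm
      refine extend_comp_self g w _ fun i hi => ?_
      exact (h2 i fun j hj => hi (f j) hj).1
    · rfl
  · simp

end

/-! ### The delegation protocol -/

section
variable {K : Type} [Fintype K] [DecidableEq K]

/-- `a := a xor b`, with scratch cell `t`. -/
def xorInto (a b t : K) : List (CLocal K) := [.nand a b t, .nand a t a, .nand b t t, .nand a t a]

theorem evalList_append (l l' : List (CLocal K)) (m : K → Bool) :
    evalList (l ++ l') m = evalList l' (evalList l m) := List.foldl_append

theorem evalList_xorInto {a b t : K} (hab : a ≠ b) (hat : a ≠ t) (hbt : b ≠ t) (m : K → Bool) :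
    evalList (xorInto a b t) m =
      update (update m t (!(m b && !m a))) a (xor (m a) (m b)) := by
  funext j
  by_cases h1 : j = a
  · subst h1
    cases h3 : m j <;> cases h4 : m b <;>
      simp [xorInto, evalList, CLocal.eval, hat, hat.symm, hab.symm, hbt, h3, h4]
  · by_cases h2 : j = t
    · subst h2
      cases h3 : m a <;> cases h4 : m b <;>
      simp [xorInto, evalList, CLocal.eval, hat, hab.symm, hbt, h1, h3, h4]
    · simp [xorInto, evalList, CLocal.eval, h1, h2]

theorem evalList_map {K' : Type} [Fintype K'] [DecidableEq K'] {e : K → K'} (he : Function.Injective e)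
    (l : List (CLocal K)) (m : K' → Bool) :
    evalList (l.map (CLocal.map e)) m ∘ e = evalList l (m ∘ e) := by
  induction l generalizing m with
  | nil => rfl
  | cons c l ih =>
    change evalList (l.map (CLocal.map e)) ((c.map e).eval m) ∘ e = evalList l (c.eval (m ∘ e))
    rw [ih]
    congr 1
    cases c with
    | const t b => exact Function.update_comp_eq_of_injective m he t b
    | nand i j t => exact Function.update_comp_eq_of_injective m he t _
    | coin t => rfl

end

/-- The wires of `Q`. -/
abbrev QCircuit.Wire (Q : QCircuit) := Fin Q.n ⊕ (Fin Q.v ⊕ Fin Q.a)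

/-- The cells of the client: `X`- and `Z`-keys of all wires, the input, and three auxiliary cells. -/
abbrev QCircuit.Cell (Q : QCircuit) := (Q.Wire ⊕ Q.Wire) ⊕ (Fin Q.n ⊕ Fin 3)

namespace QCircuit

variable (Q : QCircuit)

def numCells : ℕ := Fintype.card Q.Cell

def numWires : ℕ := Fintype.card (Q.Wire ⊕ Unit)

def cellEquiv : Q.Cell ≃ Fin Q.numCells := Fintype.equivFin _

def wireEquiv : Q.Wire ⊕ Unit ≃ Fin Q.numWires := Fintype.equivFin _

/-- The server's wire for a wire of `Q`. -/
def wire : Q.Wire ↪ Fin Q.numWires :=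
  ⟨fun q => Q.wireEquiv (.inl q), fun _ _ h => Sum.inl.inj (Q.wireEquiv.injective h)⟩

/-- The server's wire for the OSP output. -/
def helper : Fin Q.numWires := Q.wireEquiv (.inr ())

theorem wire_ne_helper (q : Q.Wire) : Q.wire q ≠ Q.helper := fun h =>
  Sum.inl_ne_inr (Q.wireEquiv.injective h)

variable {Q}

abbrev keyX (q : Q.Wire) : Q.Cell := .inl (.inl q)
abbrev keyZ (q : Q.Wire) : Q.Cell := .inl (.inr q)
abbrev inCell (i : Fin Q.n) : Q.Cell := .inr (.inl i)
abbrev auxCell (j : Fin 3) : Q.Cell := .inr (.inr j)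

/-- A list of local steps of the client, as a part of a template. -/
def clients (l : List (CLocal Q.Cell)) : List (HInstr Q.numCells Q.numWires) :=
  (l.map (CLocal.map Q.cellEquiv)).map .client

/-- The client encrypts its `i`-th input bit and sends it. -/
def inputBlock (i : Fin Q.n) : List (HInstr Q.numCells Q.numWires) :=
  clients [.coin (keyX (.inl i))] ++
    (clients (.const (auxCell 0) false :: (xorInto (auxCell 0) (inCell i) (auxCell 2) ++
      xorInto (auxCell 0) (keyX (.inl i)) (auxCell 2))) ++
      [.toServer (Q.cellEquiv (auxCell 0)) (Q.wire (.inl i))])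

/-- The update of the keys for the Clifford gates and resets. -/
def keyUpdate : Gate Q.Wire → List (CLocal Q.Cell)
  -- Three additions swap the two keys.
  | .h q => xorInto (keyX q) (keyZ q) (auxCell 2) ++
      (xorInto (keyZ q) (keyX q) (auxCell 2) ++ xorInto (keyX q) (keyZ q) (auxCell 2))
  | .p q => xorInto (keyZ q) (keyX q) (auxCell 2)
  | .cnot c t _ => xorInto (keyX t) (keyX c) (auxCell 2) ++ xorInto (keyZ c) (keyZ t) (auxCell 2)
  | .reset q => [.const (keyX q) false, .const (keyZ q) false]
  -- The Z-key grows by `d + r c`, where `d` is the OSP output in cell `0` and `c` the outcome in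
  -- cell `1`. A NAND followed by a negation forms `r c`.
  | .tdg q => xorInto (keyZ q) (auxCell 0) (auxCell 2) ++
      (.nand (keyX q) (auxCell 1) (auxCell 1) :: .nand (auxCell 1) (auxCell 1) (auxCell 1) ::
        xorInto (keyZ q) (auxCell 1) (auxCell 2))

/-- The server's measurement-based correction of a `T†` gate. -/
def correction (q : Q.Wire) : List (HInstr Q.numCells Q.numWires) :=
  [.osp (Q.cellEquiv (keyX q)) (Q.cellEquiv (auxCell 0)) Q.helper,
    -- Three phase gates are `P†`. Followed by `H` they turn `H^b|s⟩` into the equatorial state with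
    -- relative phase `i^b (-1)^s`.
    .server (.p Q.helper), .server (.p Q.helper), .server (.p Q.helper), .server (.h Q.helper),
    .server (.cnot (Q.wire q) Q.helper (Q.wire_ne_helper q)),
    .toClient Q.helper (Q.cellEquiv (auxCell 1))]

/-- The steps for one gate of `Q`. -/
def gateBlock (g : Gate Q.Wire) : List (HInstr Q.numCells Q.numWires) :=
  .server (g.map Q.wire) ::
    ((match g with
      | .tdg q => correction q
      | _ => []) ++ clients (keyUpdate g))

variable (Q)

/-- The delegation protocol for `Q`. -/
def template : Template Q where
  k := Q.numCells
  N := Q.numWires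
  prog := (List.finRange Q.n).flatMap inputBlock ++ Q.gates.flatMap gateBlock
  xIn := ⟨fun i => Q.cellEquiv (inCell i), fun _ _ h =>
    Sum.inl.inj (Sum.inr.inj (Q.cellEquiv.injective h))⟩
  rOut := fun i => Q.cellEquiv (keyX (Q.out i))
  sOut := fun i => Q.cellEquiv (keyZ (Q.out i))
  vIn := Q.vWires.trans Q.wire
  wOut := Q.out.trans Q.wire

theorem ospCalls_template : Q.template.ospCalls = Q.tCount := by
  have hc : ∀ l : List (CLocal Q.Cell), (clients l).countP HInstr.isOSP = 0 := by
    intro l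
    rw [List.countP_eq_zero]
    intro a ha
    simp only [clients, List.mem_map] at ha
    obtain ⟨c, _, rfl⟩ := ha
    simp [HInstr.isOSP]
  have h1 : ∀ l : List (Fin Q.n), (l.flatMap inputBlock).countP (HInstr.isOSP) = 0 := by
    intro l
    induction l with
    | nil => rfl
    | cons i l ih =>
      rw [List.flatMap_cons, List.countP_append, ih, inputBlock, List.countP_append,
        List.countP_append, hc, hc]
      rfl
  have h2 : ∀ l : List (Gate Q.Wire), (l.flatMap gateBlock).countP (HInstr.isOSP) =
      l.countP Gate.isTdg := by
    intro l
    induction l with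
    | nil => rfl
    | cons g l ih =>
      have hb : (gateBlock g).countP HInstr.isOSP = if g.isTdg then 1 else 0 := by
        cases g with
        | tdg q =>
          have : (correction q).countP HInstr.isOSP = 1 := rfl
          simp [gateBlock, hc, this, HInstr.isOSP, Gate.isTdg]
        | _ => simp [gateBlock, hc, HInstr.isOSP, Gate.isTdg]
      rw [List.flatMap_cons, List.countP_append, ih, hb, List.countP_cons, add_comm]
  have h3 : ((List.finRange Q.n).flatMap inputBlock ++ Q.gates.flatMap gateBlock).countP HInstr.isOSP =
      Q.gates.countP Gate.isTdg := by rw [List.countP_append, h1, h2, zero_add]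
  exact h3

end QCircuit

/-! ### Correctness with ideal OSP outputs -/

namespace QCircuit

variable {Q : QCircuit}

/-- The decrypted register for memory `m`, if the client's input is `y`. -/
def decAt (y : Fin Q.n → Bool) (m : Fin Q.numCells → Bool) (ρ : Op (Fin Q.numWires)) : Op Q.Wire :=
  if (fun i => m (Q.cellEquiv (inCell i))) = y then
    conj (pauli (fun q => m (Q.cellEquiv (keyX q))) (fun q => m (Q.cellEquiv (keyZ q))))
      (extract Q.wire ρ) else 0

/-- The decrypted register, split according to the client's input. -/
def dec (σ : JState (Fin Q.numCells) (Fin Q.numWires)) : JState (Fin Q.n) Q.Wire :=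
  fun y => ∑ m, decAt y m (σ m)

theorem isLinearMap_decAt (y : Fin Q.n → Bool) (m : Fin Q.numCells → Bool) :
    IsLinearMap ℂ (decAt y m) :=
  isLinearMap_ite _ ((isLinearMap_conj _).compose (isLinearMap_extract _))

theorem runSteps_append {k N : ℕ} (Ω : Bool → Bool → Matrix Bool Bool ℂ) (p p' : List (HInstr k N))
    (σ : JState (Fin k) (Fin N)) : runSteps Ω (p ++ p') σ = runSteps Ω p' (runSteps Ω p σ) :=
  List.foldl_append

theorem runSteps_cons {k N : ℕ} (Ω : Bool → Bool → Matrix Bool Bool ℂ) (h : HInstr k N)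
    (p : List (HInstr k N)) (σ : JState (Fin k) (Fin N)) :
    runSteps Ω (h :: p) σ = runSteps Ω p (h.step Ω σ) := rfl

theorem runSteps_clients (Ω : Bool → Bool → Matrix Bool Bool ℂ) (l : List (CLocal Q.Cell))
    (σ : JState (Fin Q.numCells) (Fin Q.numWires)) :
    runSteps Ω (clients l) σ = locals (l.map (CLocal.map Q.cellEquiv)) σ := by
  simp only [runSteps, clients, locals, List.foldl_map]
  rfl

theorem isDet_xorInto {K : Type} {a b t : K} : ∀ c ∈ xorInto a b t, c.IsDet := by
  intro c hc
  simp only [xorInto, List.mem_cons, List.not_mem_nil, or_false] at hc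
  rcases hc with rfl | rfl | rfl | rfl <;> trivial

theorem isDet_keyUpdate (g : Gate Q.Wire) : ∀ c ∈ keyUpdate g, c.IsDet := by
  intro c hc
  cases g with
  | h q =>
    simp only [keyUpdate, List.mem_append] at hc
    rcases hc with hc | hc | hc <;> exact isDet_xorInto c hc
  | p q => exact isDet_xorInto c hc
  | tdg q =>
    simp only [keyUpdate, List.mem_append, List.mem_cons] at hc
    rcases hc with hc | rfl | rfl | hc
    · exact isDet_xorInto c hc
    · trivial
    · trivial
    · exact isDet_xorInto c hc
  | cnot a b h =>
    simp only [keyUpdate, List.mem_append] at hc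
    rcases hc with hc | hc <;> exact isDet_xorInto c hc
  | reset q =>
    simp only [keyUpdate, List.mem_cons, List.not_mem_nil, or_false] at hc
    rcases hc with rfl | rfl <;> trivial

/-- `decAt` in terms of the memory as a function of `Cell`. -/
def decCell (y : Fin Q.n → Bool) (M : Q.Cell → Bool) (ρ : Op Q.Wire) : Op Q.Wire :=
  if (fun i => M (inCell i)) = y then
    conj (pauli (fun q => M (keyX q)) (fun q => M (keyZ q))) ρ else 0

theorem sum_decAt_clients (Ω : Bool → Bool → Matrix Bool Bool ℂ) (l : List (CLocal Q.Cell))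
    (hl : ∀ c ∈ l, c.IsDet) (y : Fin Q.n → Bool) (σ : JState (Fin Q.numCells) (Fin Q.numWires)) :
    dec (runSteps Ω (clients l) σ) y =
      ∑ m, decCell y (evalList l (m ∘ Q.cellEquiv)) (extract Q.wire (σ m)) := by
  rw [runSteps_clients, locals_eq_pushMem]
  · refine (sum_pushMem _ σ fun m => isLinearMap_decAt y m).trans ?_
    refine Finset.sum_congr rfl fun m _ => ?_
    rw [← evalList_map Q.cellEquiv.injective]
    rfl
  · intro c hc
    obtain ⟨d, hd, rfl⟩ := List.mem_map.1 hc
    have := hl d hd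
    cases d with
    | coin t => exact this.elim
    | _ => trivial

/-- Apart from `T†`, the key update is right for each memory content separately, with no sum over
outcomes. This is where the `pad_*` lemmas meet the client's program. -/
theorem decCell_keyUpdate (g : Gate Q.Wire) (hg : ∀ q, g ≠ .tdg q) (y : Fin Q.n → Bool)
    (M : Q.Cell → Bool) (ρ : Op Q.Wire) :
    decCell y (evalList (keyUpdate g) M) (g.apply ρ) = g.apply (decCell y M ρ) := by
  suffices h : (fun i => evalList (keyUpdate g) M (inCell i)) = (fun i => M (inCell i)) ∧
      conj (pauli (fun q => evalList (keyUpdate g) M (keyX q))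
        (fun q => evalList (keyUpdate g) M (keyZ q))) (g.apply ρ) =
      g.apply (conj (pauli (fun q => M (keyX q)) (fun q => M (keyZ q))) ρ) by
    simp only [decCell, h.1]
    split_ifs
    · exact h.2
    · exact ((isLinearMap_apply g).map_zero).symm
  cases g with
  | h q =>
    simp only [keyUpdate, evalList_append, evalList_xorInto, ne_eq, reduceCtorEq, not_false_eq_true,
      Sum.inl.injEq]
    refine ⟨by funext i; simp, ?_⟩
    refine Eq.trans ?_ (pad_h q _ _ ρ)
    congr 2
    · funext j
      by_cases hj : j = q
      · subst hj; simp
      · simp [hj]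
    · funext j
      by_cases hj : j = q
      · subst hj
        cases M (keyX j) <;> cases h2 : M (keyZ j) <;> simp [h2]
      · simp [hj]
  | p q =>
    simp only [keyUpdate, evalList_xorInto, ne_eq, reduceCtorEq, not_false_eq_true,
      Sum.inl.injEq]
    refine ⟨by funext i; simp, ?_⟩
    refine Eq.trans ?_ (pad_p q _ _ ρ)
    congr 2
    · funext j
      by_cases hj : j = q
      · subst hj; simp
      · simp [hj]
  | tdg q => exact absurd rfl (hg q)
  | cnot c t ne =>
    simp only [keyUpdate, evalList_append, evalList_xorInto, ne_eq, reduceCtorEq, not_false_eq_true,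
      Sum.inl.injEq, Sum.inr.injEq, ne, ne.symm]
    refine ⟨by funext i; simp, ?_⟩
    refine Eq.trans ?_ (pad_cnot ne _ _ ρ)
    congr 2
    · funext j
      by_cases hj : j = t
      · subst hj; simp
      · simp [hj]
    · funext j
      by_cases hj : j = c
      · subst hj; simp
      · simp [hj]
  | reset q =>
    refine ⟨by funext i; simp [keyUpdate, evalList, CLocal.eval], ?_⟩
    refine pad_setWire q _ _ _ _ _ _ ?_ ?_ ?_ ρ
    · simp [keyUpdate, evalList, CLocal.eval]
    · intro j hj; simp [keyUpdate, evalList, CLocal.eval, hj]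
    · intro j hj; simp [keyUpdate, evalList, CLocal.eval, hj]

theorem dec_gateBlock_clifford (Ω : Bool → Bool → Matrix Bool Bool ℂ) (g : Gate Q.Wire)
    (hg : ∀ q, g ≠ .tdg q) (σ : JState (Fin Q.numCells) (Fin Q.numWires)) :
    dec (runSteps Ω (gateBlock g) σ) = fun y => g.apply (dec σ y) := by
  have hb : gateBlock g = .server (g.map Q.wire) :: clients (keyUpdate g) := by
    cases g with
    | tdg q => exact absurd rfl (hg q)
    | _ => rfl
  funext y
  rw [hb, runSteps_cons, sum_decAt_clients _ _ (isDet_keyUpdate g)]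
  simp only [HInstr.step, extract_apply_map, dec, (isLinearMap_apply g).map_fsum]
  exact Finset.sum_congr rfl fun m _ => decCell_keyUpdate g hg y _ _

/-- Decryption undoes the pad for either value of the coin, so both branches give the same register
and their weights `1/2` add up to `1`. -/
theorem dec_inputBlock (Ω : Bool → Bool → Matrix Bool Bool ℂ) (i : Fin Q.n)
    (σ : JState (Fin Q.numCells) (Fin Q.numWires)) :
    dec (runSteps Ω (inputBlock i) σ) = fun y => setWire (.inl i) (y i) (dec σ y) := by
  funext y
  rw [inputBlock, runSteps_append, runSteps_append, runSteps_clients, runSteps_clients,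
    locals_eq_pushMem]
  · set τ := locals ([CLocal.coin (keyX (.inl i))].map (CLocal.map Q.cellEquiv)) σ with hτ
    refine (sum_pushMem _ τ (G := fun m ρ => decAt y m
      (setWire (Q.wire (.inl i)) (m (Q.cellEquiv (auxCell 0))) ρ)) fun m =>
        (isLinearMap_decAt y m).compose (isLinearMap_setWire _ _)).trans ?_
    set l : List (CLocal Q.Cell) := (.const (auxCell 0) false ::
      (xorInto (auxCell 0) (inCell i) (auxCell 2) ++
      xorInto (auxCell 0) (keyX (.inl i)) (auxCell 2))) with hl
    refine (sum_coin (Q.cellEquiv (keyX (.inl i))) σ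
      (G := fun m ρ => decAt y (evalList (l.map (CLocal.map Q.cellEquiv)) m)
        (setWire (Q.wire (.inl i)) (evalList (l.map (CLocal.map Q.cellEquiv)) m
          (Q.cellEquiv (auxCell 0))) ρ)) fun m =>
        (isLinearMap_decAt y _).compose (isLinearMap_setWire _ _)).trans ?_
    simp only [dec, (isLinearMap_setWire _ _).map_fsum]
    refine Finset.sum_congr rfl fun m _ => ?_
    have hb : ∀ b : Bool, decAt y (evalList (l.map (CLocal.map Q.cellEquiv))
        (update m (Q.cellEquiv (keyX (.inl i))) b)) (setWire (Q.wire (.inl i))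
        ((evalList (l.map (CLocal.map Q.cellEquiv))
        (update m (Q.cellEquiv (keyX (.inl i))) b)) (Q.cellEquiv (auxCell 0))) (σ m)) =
        setWire (.inl i) (y i) (decAt y m (σ m)) := by
      intro b
      have hE := evalList_map Q.cellEquiv.injective l (update m (Q.cellEquiv (keyX (.inl i))) b)
      rw [Function.update_comp_eq_of_injective m Q.cellEquiv.injective] at hE
      have hev : ∀ c, evalList (l.map (CLocal.map Q.cellEquiv))
          (update m (Q.cellEquiv (keyX (.inl i))) b) (Q.cellEquiv c) =
          evalList l (update (m ∘ Q.cellEquiv) (keyX (.inl i)) b) c := fun c => congrFun hE c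
      have h0 : evalList l (update (m ∘ Q.cellEquiv) (keyX (.inl i)) b) (auxCell 0) =
          xor (m (Q.cellEquiv (inCell i))) b := by
        simp [hl, evalList, xorInto, CLocal.eval]
        cases m (Q.cellEquiv (inCell i)) <;> cases b <;> rfl
      have hX : ∀ q, evalList l (update (m ∘ Q.cellEquiv) (keyX (.inl i)) b) (keyX q) =
          update (fun q => m (Q.cellEquiv (keyX q))) (.inl i) b q := by
        intro q
        by_cases hq : q = .inl i
        · subst hq; simp [hl, evalList, xorInto, CLocal.eval]
        · simp [hl, evalList, xorInto, CLocal.eval, hq]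
      have hZ : ∀ q, evalList l (update (m ∘ Q.cellEquiv) (keyX (.inl i)) b) (keyZ q) =
          m (Q.cellEquiv (keyZ q)) := by
        intro q
        simp [hl, evalList, xorInto, CLocal.eval]
      have hI : ∀ q, evalList l (update (m ∘ Q.cellEquiv) (keyX (.inl i)) b) (inCell q) =
          m (Q.cellEquiv (inCell q)) := by
        intro q
        simp [hl, evalList, xorInto, CLocal.eval]
      simp only [decAt, hev, h0, hX, hZ, hI]
      split_ifs with hy
      · rw [extract_setWire]
        refine pad_setWire _ _ _ _ _ _ _ ?_ ?_ (fun _ _ => rfl) _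
        · simp [← hy]
        · intro j hj; simp [hj]
      · exact ((isLinearMap_setWire _ _).map_zero).symm
    simp only [hb, Fintype.sum_bool, ← add_smul]
    norm_num
  · intro c hc
    obtain ⟨d, hd, rfl⟩ := List.mem_map.1 hc
    simp only [List.mem_cons, List.mem_append] at hd
    have : d.IsDet := by
      rcases hd with rfl | hd | hd
      · trivial
      · exact isDet_xorInto d hd
      · exact isDet_xorInto d hd
    cases d with
    | coin t => exact this.elim
    | _ => trivial

end QCircuit

/-! ### The gadget that corrects a `T†` gate -/

section
variable {W : Type} [Fintype W] [DecidableEq W]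

theorem conj_onWire_replaceWire (h : W) (U ω : Matrix Bool Bool ℂ) (ρ : Op W) :
    conj (onWire h U) (replaceWire h ω ρ) = replaceWire h (conj U ω) ρ := by
  ext w w'
  rw [conj_onWire_apply]
  simp only [replaceWire, Matrix.of_apply, Function.update_self, Function.update_idem, conj,
    Matrix.mul_apply, Matrix.conjTranspose_apply, Finset.sum_mul]
  rw [Finset.sum_comm]
  refine Finset.sum_congr rfl fun a _ => Finset.sum_congr rfl fun b _ => ?_
  ring

theorem conj_onWire_diagonal (q : W) (f : Bool → ℂ) (ρ : Op W) (w w' : W → Bool) :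
    conj (onWire q (Matrix.diagonal f)) ρ w w' = f (w q) * star (f (w' q)) * ρ w w' := by
  rw [conj_onWire_apply, Finset.sum_eq_single (w q), Finset.sum_eq_single (w' q)]
  · simp
  · intro b _ hb; simp [Matrix.diagonal_apply_ne _ hb.symm]
  · simp
  · intro a _ ha; simp [Matrix.diagonal_apply_ne _ ha.symm]
  · simp

/-- The relative phase of the corrected OSP output. -/
def phase (b s x : Bool) : ℂ :=
  if x then (if b then Complex.I else 1) * (if s then -1 else 1) else 1

/-- The diagonal of `T†`. -/
def tdgDiag (b : Bool) : ℂ := if b then Complex.exp (-(Real.pi / 4 : ℝ) * Complex.I) else 1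

theorem tdgMat_eq : tdgMat = Matrix.diagonal tdgDiag := rfl

/-- Scalar core of the gadget. For fixed `d` and `c`, the Z-correction, the gadget's phase and the
diagonal of `T†` at the padded bit multiply to the diagonal of `T†` at the bare bit, up to a phase
that does not depend on the bit. Hence each branch contributes `p d / 2` of the ideal entry, and
only the normalisation of `p` is used. -/
theorem correction_sum (p : Bool → ℂ) (hp : ∑ s, p s = 1) (b a a' : Bool) :
    ∑ d : Bool, ∑ c : Bool, sg (xor d (b && c)) (xor a b) * sg (xor d (b && c)) (xor a' b) *
      (p d * (1 / 2 * phase b d (xor c (xor a b)) * star (phase b d (xor c (xor a' b))))) *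
      (tdgDiag (xor a b) * star (tdgDiag (xor a' b))) = tdgDiag a * star (tdgDiag a') := by
  obtain ⟨t, ht⟩ : ∃ t : ℂ, t = Complex.exp (-(Real.pi / 4 : ℝ) * Complex.I) := ⟨_, rfl⟩
  have hd : ∀ b, tdgDiag b = if b then t else 1 := fun b => by rw [tdgDiag, ht]
  have ht2 : t * t = -Complex.I := by
    rw [ht, ← Complex.exp_add]
    have : -((Real.pi / 4 : ℝ) : ℂ) * Complex.I + -((Real.pi / 4 : ℝ) : ℂ) * Complex.I =
      -((Real.pi / 2 : ℝ) : ℂ) * Complex.I := by push_cast; ring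
    rw [this, neg_mul, Complex.exp_neg, Complex.ofReal_div, Complex.ofReal_ofNat,
      Complex.exp_pi_div_two_mul_I]
    simp
  have hts : t * star t = 1 := by
    rw [ht, Complex.star_def, Complex.mul_conj, Complex.normSq_eq_norm_sq, ← Complex.ofReal_neg,
      Complex.norm_exp_ofReal_mul_I]
    norm_num
  -- With this relation every case becomes a polynomial identity in `t` and `I`.
  have hst : star t = Complex.I * t := by
    linear_combination -(Complex.I * star t) * ht2 + (Complex.I * t) * hts + star t * Complex.I_sq
  have hI := Complex.I_sq
  have hX : t * (Complex.I * t) = 1 := hst ▸ hts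
  rw [Fintype.sum_bool] at hp
  simp only [hd, Fintype.sum_bool]
  cases b <;> cases a <;> cases a' <;> simp [sg, phase] at hst ⊢ <;> (try rw [hst])
  · linear_combination hp
  · linear_combination (Complex.I * t) * hp
  · linear_combination t * hp
  · linear_combination (t * (Complex.I * t)) * hp
  · linear_combination (-(1 / 2) * (t * (Complex.I * t)) * (p true + p false)) * hI +
      (t * (Complex.I * t)) * hp + hX
  · linear_combination (Complex.I * t) * hp
  · linear_combination (-(t * (p true + p false))) * hI + t * hp
  · linear_combination (-(1 / 2) * (p true + p false)) * hI + hp - hX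

/-- For `b = 0`, `P†` only adds a phase to `|s⟩` and `H` moves it to the equator. For `b = 1`, `P†`
rotates `H|s⟩` along the equator and `H` maps the result to relative phase `±i`. -/
theorem conj_proj (b s x x' : Bool) :
    conj hMat (conj pMat (conj pMat (conj pMat (OSPProtocol.proj b s)))) x x' =
      1 / 2 * phase b s x * star (phase b s x') := by
  have h2 : (Real.sqrt 2 : ℂ) * (Real.sqrt 2 : ℂ) = 2 := by
    rw [← Complex.ofReal_mul, Real.mul_self_sqrt (by norm_num)]; norm_num
  have h3 : (Real.sqrt 2 : ℂ)⁻¹ * (Real.sqrt 2 : ℂ)⁻¹ = 1 / 2 := by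
    rw [← mul_inv, h2]; norm_num
  have hp : ∀ (ω : Matrix Bool Bool ℂ) x x', conj pMat ω x x' =
      (if x then Complex.I else 1) * star (if x' then Complex.I else 1) * ω x x' := by
    intro ω x x'
    simp only [conj, pMat, Matrix.diagonal_conjTranspose, Matrix.mul_diagonal, Matrix.diagonal_mul,
      Pi.star_apply]
    ring
  have hh : ∀ (ω : Matrix Bool Bool ℂ) x x', conj hMat ω x x' = 1 / 2 *
      ∑ a : Bool, ∑ b : Bool, (if x && a then -1 else 1) * (if x' && b then -1 else 1) * ω a b := by
    intro ω x x'
    rw [← h3]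
    simp only [conj, hMat, Matrix.mul_apply, Matrix.conjTranspose_apply, Matrix.of_apply,
      Fintype.sum_bool]
    cases x <;> cases x' <;> simp <;> ring
  have hproj : ∀ a b', OSPProtocol.proj b s a b' = if b then
      1 / 2 * ((if a && s then -1 else 1) * (if b' && s then -1 else 1)) else
      (if a = s ∧ b' = s then 1 else 0) := by
    intro a b'
    have hm : hMat.conjTranspose = hMat := by
      ext a b; cases a <;> cases b <;> simp [hMat]
    cases b
    · simp [OSPProtocol.proj, Matrix.single, eq_comm]
    · have := hh (Matrix.single s s 1) a b'
      rw [conj, hm] at this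
      simp only [OSPProtocol.proj, if_true]
      rw [this]
      congr 1
      cases s <;> simp
  rw [hh]
  simp only [hp, hproj, Fintype.sum_bool, phase]
  cases b <;> cases s <;> cases x <;> cases x' <;> simp <;> ring_nf <;> simp <;> ring_nf

/-- Outcome `c` after the CNOT means that the helper had the value `c` plus the data bit before it.
So the entry of the data is multiplied by the entry of `η` at these values. -/
theorem extract_correction {A : Type} [Fintype A] [DecidableEq A] (f : A ↪ W) (h : W)
    (hf : ∀ q, f q ≠ h) (q : A) (c : Bool) (η : Matrix Bool Bool ℂ) (ρ : Op W) (u u' : A → Bool) :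
    extract f (projWire h c (conj (cnotMat (f q) h) (replaceWire h η ρ))) u u' =
      η (xor c (u q)) (xor c (u' q)) * extract f ρ u u' := by
  have hh : ∀ (v : A → Bool) (w : W → Bool), extend f v w h = w h := fun v w => by
    rw [Function.extend_apply']; rintro ⟨j, hj⟩; exact hf j hj
  have hu : ∀ (v : A → Bool) (w : W → Bool) d, update (extend f v w) h d = extend f v (update w h d) := by
    intro v w d
    funext i
    by_cases hi : ∃ j, f j = i
    · obtain ⟨j, rfl⟩ := hi
      rw [Function.update_of_ne (hf j), extend_emb_apply, extend_emb_apply]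
    · by_cases hi2 : i = h
      · subst hi2; rw [hh]; simp
      · rw [Function.update_of_ne hi2, Function.extend_apply' _ _ _ hi, Function.extend_apply' _ _ _ hi,
          Function.update_of_ne hi2]
  have hc : ∀ (w : W → Bool) d, update w h d ∘ f = w ∘ f := fun w d =>
    funext fun j => Function.update_of_ne (hf j) _ _
  have hcx : ∀ (w : W → Bool), cx (f q) h w h = xor (w h) (w (f q)) := fun w => by simp [cx]
  have hcu : ∀ (w : W → Bool) d, update (cx (f q) h w) h d = update w h d := fun w d => by simp [cx]
  have key : ∀ w : W → Bool, (if w ∘ f = u then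
      projWire h c (conj (cnotMat (f q) h) (replaceWire h η ρ)) w (extend f u' w) else 0) =
      η (xor c (u q)) (xor c (u' q)) * ∑ d : Bool, if w h = c then (if update w h d ∘ f = u then
        ρ (update w h d) (extend f u' (update w h d)) else 0) else 0 := by
    intro w
    simp only [hc]
    split_ifs with h1 h2
    · have h3 : w (f q) = u q := congrFun h1 q
      simp only [projWire, Matrix.of_apply, hh, h2, and_self, if_true, conj_cnot_apply (hf q),
        replaceWire, hcx, hcu, extend_emb_apply, hu, h3]
    · simp [projWire, h2]
    · simp
    · simp
  rw [extract_apply, extract_apply, Finset.sum_congr rfl fun w _ => key w, ← Finset.mul_sum]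
  congr 1
  have := sum_sum_update h fun (w w' : W → Bool) =>
    if w h = c then (if w' ∘ f = u then ρ w' (extend f u' w') else 0) else 0
  rw [this]
  simp

end

theorem sum_osp {k N : ℕ} {E : Type*} [AddCommMonoid E] [Module ℂ E]
    (Ω : Bool → Bool → Matrix Bool Bool ℂ) (b s : Fin k) (q : Fin N)
    (σ : JState (Fin k) (Fin N)) {G : (Fin k → Bool) → Op (Fin N) → E} (hG : ∀ m, IsLinearMap ℂ (G m)) :
    ∑ m, G m ((HInstr.osp b s q).step Ω σ m) =
      ∑ m, ∑ d : Bool, G (update m s d) (replaceWire q (Ω (m b) d) (σ m)) := by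
  simp only [HInstr.step, (hG _).map_fsum]
  rw [Finset.sum_comm]
  refine Finset.sum_congr rfl fun m _ => ?_
  rw [Finset.sum_comm]
  refine Finset.sum_congr rfl fun d _ => ?_
  rw [Finset.sum_eq_single (update m s d)]
  · simp
  · intro m' _ hm
    rw [if_neg hm.symm]
    exact (hG m').map_zero
  · simp

namespace QCircuit

variable {Q : QCircuit}

theorem evalList_keyUpdate_tdg (q : Q.Wire) (M : Q.Cell → Bool) :
    (∀ i, evalList (keyUpdate (.tdg q)) M (inCell i) = M (inCell i)) ∧
    (∀ q', evalList (keyUpdate (.tdg q)) M (keyX q') = M (keyX q')) ∧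
    (∀ q', evalList (keyUpdate (.tdg q)) M (keyZ q') =
      update (fun q' => M (keyZ q')) q (xor (M (keyZ q)) (xor (M (auxCell 0))
        (M (keyX q) && M (auxCell 1)))) q') := by
  have h : evalList (keyUpdate (.tdg q)) M = evalList (xorInto (keyZ q) (auxCell 1) (auxCell 2))
      ((CLocal.nand (auxCell 1) (auxCell 1) (auxCell 1)).eval
        ((CLocal.nand (keyX q) (auxCell 1) (auxCell 1)).eval
          (evalList (xorInto (keyZ q) (auxCell 0) (auxCell 2)) M))) := by
    simp only [keyUpdate, evalList_append]; rfl
  rw [h]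
  simp only [evalList_xorInto, ne_eq, reduceCtorEq, not_false_eq_true, Sum.inr.injEq, Fin.reduceEq]
  refine ⟨?_, ?_, ?_⟩
  · intro i; simp [CLocal.eval]
  · intro i; simp [CLocal.eval]
  · intro j
    by_cases hj : j = q
    · subst hj
      simp [CLocal.eval]
    · simp [CLocal.eval, hj]

/-- The key update, the measurement and the OSP call are moved into the decryption in turn. For each
memory this leaves a double sum over the OSP output and the measurement outcome, which entry by
entry is `correction_sum`. -/
theorem dec_gateBlock_tdg (p : Bool → Bool → ℂ) (hp : ∀ b, ∑ s, p b s = 1) (q : Q.Wire)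
    (σ : JState (Fin Q.numCells) (Fin Q.numWires)) :
    dec (runSteps (fun b s => p b s • OSPProtocol.proj b s) (gateBlock (.tdg q)) σ) =
      fun y => (Gate.tdg q).apply (dec σ y) := by
  set Ω : Bool → Bool → Matrix Bool Bool ℂ := fun b s => p b s • OSPProtocol.proj b s with hΩ
  funext y
  have hb : gateBlock (.tdg q) =
    .server ((Gate.tdg q).map Q.wire) :: (correction q ++ clients (keyUpdate (.tdg q))) := rfl
  rw [hb, runSteps_cons, runSteps_append, sum_decAt_clients _ _ (isDet_keyUpdate _)]
  set σ0 := (HInstr.server ((Gate.tdg q).map Q.wire)).step Ω σ with hσ0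
  simp only [correction, runSteps_cons]
  change ∑ m, decCell y (evalList (keyUpdate (.tdg q)) (m ∘ Q.cellEquiv)) (extract Q.wire
    (toClient Q.helper (Q.cellEquiv (auxCell 1)) _ m)) = _
  have hlinC : ∀ M : Q.Cell → Bool, IsLinearMap ℂ (decCell y M) := fun M =>
    isLinearMap_ite _ (isLinearMap_conj _)
  refine (sum_toClient Q.helper (Q.cellEquiv (auxCell 1)) _ (G := fun m ρ =>
    decCell y (evalList (keyUpdate (.tdg q)) (m ∘ Q.cellEquiv)) (extract Q.wire ρ))
      fun m => (hlinC _).compose (isLinearMap_extract _)).trans ?_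
  simp only [HInstr.step]
  have hG : ∀ m : Fin Q.numCells → Bool, IsLinearMap ℂ fun ρ : Op (Fin Q.numWires) => ∑ c : Bool,
      decCell y (evalList (keyUpdate (.tdg q)) (update m (Q.cellEquiv (auxCell 1)) c ∘ Q.cellEquiv))
        (extract Q.wire (projWire Q.helper c
          ((Gate.cnot (Q.wire q) Q.helper (Q.wire_ne_helper q)).apply ((Gate.h Q.helper).apply
            ((Gate.p Q.helper).apply ((Gate.p Q.helper).apply ((Gate.p Q.helper).apply ρ))))))) := by
    intro m
    have : ∀ c : Bool, IsLinearMap ℂ fun ρ : Op (Fin Q.numWires) =>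
      decCell y (evalList (keyUpdate (.tdg q)) (update m (Q.cellEquiv (auxCell 1)) c ∘ Q.cellEquiv))
        (extract Q.wire (projWire Q.helper c
          ((Gate.cnot (Q.wire q) Q.helper (Q.wire_ne_helper q)).apply ((Gate.h Q.helper).apply
            ((Gate.p Q.helper).apply ((Gate.p Q.helper).apply ((Gate.p Q.helper).apply ρ))))))) :=
      fun c => (hlinC _).compose ((isLinearMap_extract _).compose ((isLinearMap_projWire _ _).compose
        ((isLinearMap_apply _).compose ((isLinearMap_apply _).compose ((isLinearMap_apply _).compose
          ((isLinearMap_apply _).compose (isLinearMap_apply _)))))))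
    constructor
    · intro a b; simp only [(this _).map_add, Finset.sum_add_distrib]
    · intro a b; simp only [(this _).map_smul, Finset.smul_sum]
  refine (sum_osp Ω (Q.cellEquiv (keyX q)) (Q.cellEquiv (auxCell 0)) Q.helper σ0 hG).trans ?_
  simp only [dec, (isLinearMap_apply _).map_fsum]
  refine Finset.sum_congr rfl fun m _ => ?_
  have hup : ∀ d c : Bool, update (update m (Q.cellEquiv (auxCell 0)) d) (Q.cellEquiv (auxCell 1)) c ∘
      Q.cellEquiv = update (update (m ∘ Q.cellEquiv) (auxCell 0) d) (auxCell 1) c := by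
    intro d c
    rw [Function.update_comp_eq_of_injective _ Q.cellEquiv.injective,
      Function.update_comp_eq_of_injective _ Q.cellEquiv.injective]
  simp only [hup]
  have hE := fun M => evalList_keyUpdate_tdg q (M : Q.Cell → Bool)
  simp only [decCell, (hE _).1, (hE _).2.1, (hE _).2.2]
  simp only [decAt]
  have h01 : (auxCell 0 : Q.Cell) ≠ auxCell 1 := by simp
  simp only [Function.update_of_ne h01, Function.update_self, Function.update_of_ne, ne_eq, reduceCtorEq,
    not_false_eq_true, Sum.inr.injEq, Function.comp_apply]
  by_cases hy : (fun i => m (Q.cellEquiv (inCell i))) = y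
  swap
  · simp only [hy, if_false, Finset.sum_const_zero, (isLinearMap_apply (Gate.tdg q)).map_zero]
  simp only [hy, if_true]
  set r : Q.Wire → Bool := fun q => m (Q.cellEquiv (keyX q)) with hr
  set s : Q.Wire → Bool := fun q => m (Q.cellEquiv (keyZ q)) with hs
  change ∑ d : Bool, ∑ c : Bool, conj (pauli r (update s q (xor (s q) (xor d (r q && c)))))
    (extract Q.wire (projWire Q.helper c (conj (cnotMat (Q.wire q) Q.helper)
      (conj (onWire Q.helper hMat) (conj (onWire Q.helper pMat) (conj (onWire Q.helper pMat)
        (conj (onWire Q.helper pMat) (replaceWire Q.helper (Ω (r q) d) (σ0 m))))))))) = _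
  simp only [conj_onWire_replaceWire]
  ext w w'
  simp only [Matrix.sum_apply, conj_pauli_apply, extract_correction Q.wire Q.helper Q.wire_ne_helper]
  have hσ0m : extract Q.wire (σ0 m) = (Gate.tdg q).apply (extract Q.wire (σ m)) :=
    extract_apply_map Q.wire (Gate.tdg q) (σ m)
  rw [hσ0m]
  simp only [hΩ, (isLinearMap_conj _).map_smul, Matrix.smul_apply, conj_proj, Gate.apply, tdgMat_eq,
    conj_onWire_diagonal, conj_pauli_apply, sgn_update_left, smul_eq_mul]
  have hflip : ∀ w : Q.Wire → Bool, flip r w q = xor (w q) (r q) := fun _ => rfl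
  simp only [hflip]
  generalize extract Q.wire (σ m) (flip r w) (flip r w') = z
  generalize sgn s (flip r w) = g
  generalize sgn s (flip r w') = g'
  have hxor : ∀ a b : Bool, xor a (xor a b) = b := by decide
  simp only [hxor]
  have hz := correction_sum (p (r q)) (hp (r q)) (r q) (w q) (w' q)
  simp only [Fintype.sum_bool] at hz ⊢
  linear_combination (g * g' * z) * hz

theorem dec_gateBlock (p : Bool → Bool → ℂ) (hp : ∀ b, ∑ s, p b s = 1) (g : Gate Q.Wire)
    (σ : JState (Fin Q.numCells) (Fin Q.numWires)) :
    dec (runSteps (fun b s => p b s • OSPProtocol.proj b s) (gateBlock g) σ) =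
      fun y => g.apply (dec σ y) := by
  by_cases h : ∃ q, g = .tdg q
  · obtain ⟨q, rfl⟩ := h
    exact dec_gateBlock_tdg p hp q σ
  · exact dec_gateBlock_clifford _ g (fun q hq => h ⟨q, hq⟩) σ

theorem dec_gateBlocks (p : Bool → Bool → ℂ) (hp : ∀ b, ∑ s, p b s = 1) (l : List (Gate Q.Wire))
    (σ : JState (Fin Q.numCells) (Fin Q.numWires)) :
    dec (runSteps (fun b s => p b s • OSPProtocol.proj b s) (l.flatMap gateBlock) σ) =
      fun y => runGates l (dec σ y) := by
  induction l generalizing σ with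
  | nil => rfl
  | cons g l ih => rw [List.flatMap_cons, runSteps_append, ih, dec_gateBlock p hp]; rfl

theorem dec_inputBlocks (Ω : Bool → Bool → Matrix Bool Bool ℂ) (l : List (Fin Q.n))
    (σ : JState (Fin Q.numCells) (Fin Q.numWires)) :
    dec (runSteps Ω (l.flatMap inputBlock) σ) =
      fun y => l.foldl (fun ρ i => setWire (.inl i) (y i) ρ) (dec σ y) := by
  induction l generalizing σ with
  | nil => rfl
  | cons i l ih => rw [List.flatMap_cons, runSteps_append, ih, dec_inputBlock]; rfl

theorem foldl_setWire_load (y : Fin Q.n → Bool) (ρ : Op (Fin Q.v)) :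
    (List.finRange Q.n).foldl (fun ρ i => setWire (.inl i) (y i) ρ)
      (load Q.vWires (fun _ => false) ρ) = load Q.vWires (Sum.elim y fun _ => false) ρ := by
  have h : ∀ (l : List (Fin Q.n)) (d : Q.Wire → Bool),
      l.foldl (fun ρ i => setWire (.inl i) (y i) ρ) (load Q.vWires d ρ) =
        load Q.vWires (fun j => Sum.casesOn j (fun i => if i ∈ l then y i else d (.inl i))
          (fun j => d (.inr j))) ρ := by
    intro l
    induction l with
    | nil =>
      intro d
      rw [List.foldl_nil]
      congr 1
      funext j
      cases j <;> simp
    | cons i l ih =>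
      intro d
      rw [List.foldl_cons, setWire_load Q.vWires d ρ (.inl i) (fun j h => Sum.inl_ne_inr h.symm), ih]
      congr 1
      funext j
      rcases j with j | j
      · by_cases h : j = i
        · subst h; simp
        · simp [h]
      · simp
  rw [h]
  congr 1
  funext j
  cases j <;> simp

/-- With ideal OSP outputs the template implements the circuit. -/
theorem channel_template (p : Bool → Bool → ℂ) (hp : ∀ b, ∑ s, p b s = 1) (x : Fin Q.n → Bool)
    (ρ : Op (Fin Q.v)) :
    Q.template.channel (fun b s => p b s • OSPProtocol.proj b s) x ρ = Q.ideal x ρ := by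
  let m₀ : Fin Q.numCells → Bool := Q.template.initMem x
  let σ₀ : JState (Fin Q.numCells) (Fin Q.numWires) :=
    initState m₀ (load (Q.vWires.trans Q.wire) (fun _ => false) ρ)
  let σ₁ : JState (Fin Q.numCells) (Fin Q.numWires) :=
    runSteps (fun b s => p b s • OSPProtocol.proj b s)
      ((List.finRange Q.n).flatMap inputBlock ++ Q.gates.flatMap gateBlock) σ₀
  have hm : ∀ c, m₀ (Q.cellEquiv c) = Sum.elim (fun _ => false)
      (Sum.elim x fun _ => false) c := by
    intro c
    have h : ∀ j, Q.template.xIn j = Q.cellEquiv c ↔ inCell j = c := fun j =>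
      Q.cellEquiv.injective.eq_iff
    simp only [m₀, Template.initMem, h]
    rcases c with c | c | c
    · simp
    · simp
    · simp
  -- All keys start at `0`, so decryption is trivial here. The splitting by the content `y` of the
  -- input cells lets the input blocks refer to the input; only `y = x` occurs.
  have h0 : dec σ₀ = fun y => if y = x then load Q.vWires (fun _ => false) ρ else 0 := by
    funext y
    rw [dec, Finset.sum_eq_single m₀]
    · simp only [decAt, hm, σ₀, initState, if_true, extract_load]
      simp only [Sum.elim_inl, Sum.elim_inr, pauli_zero, eq_comm]
    · intro m _ hne
      have : σ₀ m = 0 := if_neg hne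
      rw [this]
      exact (isLinearMap_decAt y m).map_zero
    · simp
  have h1 : dec σ₁ = fun y => if y = x then runGates Q.gates
      (load Q.vWires (Sum.elim x fun _ => false) ρ) else 0 := by
    rw [show σ₁ = _ from runSteps_append _ _ _ σ₀, dec_gateBlocks p hp, dec_inputBlocks, h0]
    funext y
    split_ifs with h
    · subst h; simp only [if_true]; rw [foldl_setWire_load]
    · have : ∀ l : List (Fin Q.n), l.foldl (fun ρ i => setWire (.inl i) (y i) ρ)
          (0 : Op Q.Wire) = 0 := by
        intro l
        induction l with
        | nil => rfl
        | cons i l ih => rw [List.foldl_cons, (isLinearMap_setWire _ _).map_zero, ih]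
      simp only [if_neg h, this, (isLinearMap_runGates _).map_zero]
  have h2 : Q.ideal x ρ = ∑ y, extract Q.out (dec σ₁ y) := by
    rw [h1, Finset.sum_eq_single x]
    · simp only [if_true]; rfl
    · intro y _ hy; simp only [if_neg hy, (isLinearMap_extract _).map_zero]
    · simp
  rw [h2]
  simp only [dec, (isLinearMap_extract _).map_fsum]
  rw [Finset.sum_comm]
  change ∑ m : Fin Q.numCells → Bool, conj (pauli ((fun q => m (Q.cellEquiv (keyX q))) ∘ Q.out)
    ((fun q => m (Q.cellEquiv (keyZ q))) ∘ Q.out)) (extract (Q.out.trans Q.wire) (σ₁ m)) = _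
  refine Finset.sum_congr rfl fun m _ => ?_
  rw [Template.extract_trans, pad_extract, Finset.sum_eq_single (fun i => m (Q.cellEquiv (inCell i)))]
  · rw [decAt, if_pos rfl]
  · intro y _ hy
    rw [decAt, if_neg hy.symm, (isLinearMap_extract _).map_zero]
  · simp

end QCircuit

/-! ### The trace norm of a difference of positive matrices -/

/-- In an eigenbasis of `P - N`, each eigenvalue is a difference of diagonal entries of `P` and `N`.
These are nonnegative, so its absolute value is at most their sum; summing gives the traces. -/
theorem traceNorm_sub_le {I : Type} [Fintype I] [DecidableEq I] {P N : Matrix I I ℂ}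
    (hP : P.PosSemidef) (hN : N.PosSemidef) : traceNorm (P - N) ≤ P.trace.re + N.trace.re := by
  set A := P - N with hAdef
  have hA : A.IsHermitian := hP.isHermitian.sub hN.isHermitian
  set U : Matrix I I ℂ := (hA.eigenvectorUnitary : Matrix I I ℂ) with hU
  have hUU : U.conjTranspose * U = 1 := Matrix.mem_unitaryGroup_iff'.1 hA.eigenvectorUnitary.2
  have hUU' : U * U.conjTranspose = 1 := Matrix.mem_unitaryGroup_iff.1 hA.eigenvectorUnitary.2
  set D : Matrix I I ℂ := Matrix.diagonal (RCLike.ofReal ∘ hA.eigenvalues) with hD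
  have hspec : A = U * D * U.conjTranspose := by
    conv_lhs => rw [hA.spectral_theorem]
    rfl
  have hdiag : U.conjTranspose * A * U = D := by
    rw [hspec]
    calc U.conjTranspose * (U * D * U.conjTranspose) * U
        = (U.conjTranspose * U) * D * (U.conjTranspose * U) := by simp only [Matrix.mul_assoc]
      _ = D := by rw [hUU, Matrix.one_mul, Matrix.mul_one]
  have hB := Matrix.isHermitian_conjTranspose_mul_self A
  have hsq : A.conjTranspose * A = U * (D * D) * U.conjTranspose := by
    rw [hA.eq]
    conv_lhs => rw [hspec]
    calc U * D * U.conjTranspose * (U * D * U.conjTranspose)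
        = U * D * (U.conjTranspose * U) * (D * U.conjTranspose) := by simp only [Matrix.mul_assoc]
      _ = U * (D * D) * U.conjTranspose := by rw [hUU, Matrix.mul_one]; simp only [Matrix.mul_assoc]
  -- `traceNorm` uses the eigenvalues of `A† A`, listed in an order of their own. They are matched
  -- with the squares of those of `A` as multisets of roots.
  have hchar : (A.conjTranspose * A).charpoly =
      ∏ i, (Polynomial.X - Polynomial.C (((hA.eigenvalues i : ℂ)) * (hA.eigenvalues i : ℂ))) := by
    rw [hsq, Matrix.charpoly_mul_comm, ← Matrix.mul_assoc, hUU, Matrix.one_mul, hD,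
      Matrix.diagonal_mul_diagonal, Matrix.charpoly_diagonal]
    rfl
  have hroots : (Finset.univ : Finset I).val.map (fun i => (hB.eigenvalues i : ℂ)) =
      (Finset.univ : Finset I).val.map
        (fun i => (hA.eigenvalues i : ℂ) * (hA.eigenvalues i : ℂ)) := by
    have h1 := hB.roots_charpoly_eq_eigenvalues
    have h2 : (∏ i, (Polynomial.X - Polynomial.C
        (((hA.eigenvalues i : ℂ)) * (hA.eigenvalues i : ℂ)))).roots =
        (Finset.univ : Finset I).val.map
        (fun i => (hA.eigenvalues i : ℂ) * (hA.eigenvalues i : ℂ)) := by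
      have := Polynomial.roots_multiset_prod_X_sub_C ((Finset.univ : Finset I).val.map
        (fun i => (hA.eigenvalues i : ℂ) * (hA.eigenvalues i : ℂ)))
      rw [Multiset.map_map] at this
      exact this
    rw [hchar, h2] at h1
    exact h1.symm
  have hsum : traceNorm A = ∑ i, |hA.eigenvalues i| := by
    have h := congrArg (fun s : Multiset ℂ => (s.map fun z : ℂ => Real.sqrt z.re).sum) hroots
    simp only [Multiset.map_map] at h
    have hl : ((Finset.univ : Finset I).val.map
        ((fun z : ℂ => Real.sqrt z.re) ∘ fun i => (hB.eigenvalues i : ℂ))).sum = traceNorm A := rfl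
    rw [hl] at h
    rw [h]
    change ∑ i, Real.sqrt ((hA.eigenvalues i : ℂ) * (hA.eigenvalues i : ℂ)).re = _
    refine Finset.sum_congr rfl fun i _ => ?_
    rw [← Complex.ofReal_mul, Complex.ofReal_re, Real.sqrt_mul_self_eq_abs]
  have htr : ∀ M : Matrix I I ℂ, M.trace = ∑ i, (U.conjTranspose * M * U) i i := by
    intro M
    change M.trace = (U.conjTranspose * M * U).trace
    rw [Matrix.trace_mul_comm, ← Matrix.mul_assoc, hUU', Matrix.one_mul]
  rw [hsum, htr P, htr N, Complex.re_sum, Complex.re_sum, ← Finset.sum_add_distrib]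
  refine Finset.sum_le_sum fun i _ => ?_
  have hp := (Complex.le_def.1 ((hP.conjTranspose_mul_mul_same U).diag_nonneg (i := i))).1
  have hn := (Complex.le_def.1 ((hN.conjTranspose_mul_mul_same U).diag_nonneg (i := i))).1
  simp only [Complex.zero_re] at hp hn
  have hd : hA.eigenvalues i =
      ((U.conjTranspose * P * U) i i).re - ((U.conjTranspose * N * U) i i).re := by
    have h1 : D i i = (U.conjTranspose * P * U) i i - (U.conjTranspose * N * U) i i := by
      rw [← hdiag, hAdef, Matrix.mul_sub, Matrix.sub_mul, Matrix.sub_apply]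
    have h2 := congrArg Complex.re h1
    simpa [hD] using h2
  rw [hd, abs_le]
  constructor <;> linarith

/-! ### Complete positivity -/

section
variable {F I J : Type} [Fintype F] [DecidableEq F] [Fintype I] [DecidableEq I] [Fintype J]
  [DecidableEq J]

/-- The block matrix with blocks `σ i j` is positive. -/
def BlockPos (σ : F → F → Matrix I I ℂ) : Prop :=
  (Matrix.of fun p p' : I × F => σ p.2 p'.2 p.1 p'.1).PosSemidef

theorem BlockPos.sum {ι : Type} (s : Finset ι) {σ : ι → F → F → Matrix I I ℂ}
    (h : ∀ a ∈ s, BlockPos (σ a)) : BlockPos (fun i j => ∑ a ∈ s, σ a i j) := by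
  have := Matrix.posSemidef_sum s h
  unfold BlockPos
  convert this using 1
  ext p p'
  simp [Matrix.sum_apply]

theorem BlockPos.add {σ τ : F → F → Matrix I I ℂ} (h : BlockPos σ) (h' : BlockPos τ) :
    BlockPos (fun i j => σ i j + τ i j) := Matrix.PosSemidef.add h h'

theorem BlockPos.zero : BlockPos (fun _ _ => 0 : F → F → Matrix I I ℂ) :=
  (Matrix.PosSemidef.zero : (0 : Matrix (I × F) (I × F) ℂ).PosSemidef)

theorem BlockPos.smul {σ : F → F → Matrix I I ℂ} (h : BlockPos σ) {c : ℂ} (hc : 0 ≤ c) :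
    BlockPos (fun i j => c • σ i j) := Matrix.PosSemidef.smul h hc

theorem BlockPos.submatrix {σ : F → F → Matrix I I ℂ} (h : BlockPos σ) (f : J → I) :
    BlockPos (fun i j => (σ i j).submatrix f f) :=
  Matrix.PosSemidef.submatrix h (fun p : J × F => (f p.1, p.2))

theorem BlockPos.indicator {σ : F → F → Matrix I I ℂ} (h : BlockPos σ) (p : I → Prop)
    [DecidablePred p] :
    BlockPos (fun i j => Matrix.of fun w w' => if p w ∧ p w' then σ i j w w' else 0) := by
  have := Matrix.PosSemidef.mul_mul_conjTranspose_same h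
    (Matrix.diagonal fun r : I × F => if p r.1 then (1 : ℂ) else 0)
  unfold BlockPos
  convert this using 1
  ext r r'
  simp only [Matrix.of_apply, Matrix.diagonal_conjTranspose, Matrix.mul_diagonal,
    Matrix.diagonal_mul, Pi.star_apply]
  by_cases h1 : p r.1 <;> by_cases h2 : p r'.1 <;> simp [h1, h2]

theorem BlockPos.conj {σ : F → F → Matrix I I ℂ} (h : BlockPos σ) (U : Matrix I I ℂ) :
    BlockPos (fun i j => OSP.conj U (σ i j)) := by
  have := Matrix.PosSemidef.mul_mul_conjTranspose_same h
    (Matrix.of fun p p' : I × F => if p.2 = p'.2 then U p.1 p'.1 else 0)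
  unfold BlockPos
  convert this using 1
  ext p p'
  simp only [OSP.conj, Matrix.of_apply, Matrix.mul_apply, Matrix.conjTranspose_apply,
    Fintype.sum_prod_type, ite_mul, zero_mul, Finset.sum_ite_eq, Finset.mem_univ, if_true,
    apply_ite star, star_zero, mul_ite, mul_zero]

theorem BlockPos.ite {σ : F → F → Matrix I I ℂ} (p : Prop) [Decidable p] (h : p → BlockPos σ) :
    BlockPos (fun i j => if p then σ i j else 0) := by
  split_ifs with hp
  · exact h hp
  · exact BlockPos.zero

variable {W : Type} [Fintype W] [DecidableEq W]

theorem BlockPos.setWire {σ : F → F → Op W} (h : BlockPos σ) (q : W) (b : Bool) :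
    BlockPos (fun i j => OSP.setWire q b (σ i j)) := by
  have := (BlockPos.sum (Finset.univ : Finset Bool) fun d _ =>
    h.submatrix fun w => update w q d).indicator (fun w => w q = b)
  convert this using 4 with i j
  ext w w'
  simp [OSP.setWire, Matrix.sum_apply]

theorem BlockPos.projWire {σ : F → F → Op W} (h : BlockPos σ) (q : W) (b : Bool) :
    BlockPos (fun i j => OSP.projWire q b (σ i j)) := h.indicator (fun w => w q = b)

theorem BlockPos.apply {σ : F → F → Op W} (h : BlockPos σ) (g : Gate W) :
    BlockPos (fun i j => g.apply (σ i j)) := by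
  cases g with
  | reset q => exact h.setWire q false
  | _ => exact h.conj _

variable {A : Type} [Fintype A] [DecidableEq A]

theorem BlockPos.load {σ : F → F → Op A} (h : BlockPos σ) (f : A ↪ W) (d : W → Bool) :
    BlockPos (fun i j => OSP.load f d (σ i j)) := by
  have := (h.submatrix fun w : W → Bool => w ∘ f).indicator (fun w => ∀ i, (∀ j, f j ≠ i) → w i = d i)
  convert this using 4 with i j
  ext w w'
  simp only [OSP.load, Matrix.of_apply, Matrix.submatrix_apply, ← forall_and]

theorem BlockPos.extract {σ : F → F → Op W} (h : BlockPos σ) (f : A ↪ W) :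
    BlockPos (fun i j => OSP.extract f (σ i j)) := by
  simp only [extract_eq_sum_blk f fun _ => false]
  exact BlockPos.sum _ fun e _ => BlockPos.ite _ fun _ => h.submatrix fun a => extend f a e

/-- The block matrix is the entrywise product of a pullback of `ω` and a partial trace of `σ`, so it
is positive by the Schur product theorem. -/
theorem BlockPos.replaceWire {σ : F → F → Op W} (h : BlockPos σ) (q : W) {ω : Matrix Bool Bool ℂ}
    (hω : ω.PosSemidef) : BlockPos (fun i j => OSP.replaceWire q ω (σ i j)) := by
  have h1 := BlockPos.sum (Finset.univ : Finset Bool) fun d _ => h.submatrix fun w => update w q d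
  have h2 := (hω.submatrix fun p : (W → Bool) × F => p.1 q).hadamard h1
  have e : (Matrix.of fun p p' : (W → Bool) × F => OSP.replaceWire q ω (σ p.2 p'.2) p.1 p'.1) =
      (ω.submatrix (fun p : (W → Bool) × F => p.1 q) (fun p => p.1 q)).hadamard
        (Matrix.of fun p p' : (W → Bool) × F =>
          (∑ d : Bool, (σ p.2 p'.2).submatrix (fun w => update w q d) (fun w => update w q d))
            p.1 p'.1) := by
    ext p p'
    simp [OSP.replaceWire, Matrix.sum_apply]
  rw [BlockPos, e]
  exact h2

end

section
variable {F K W : Type} [Fintype F] [DecidableEq F] [Fintype K] [DecidableEq K] [Fintype W]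
  [DecidableEq W]

/-- Positivity of a block matrix of joint states. -/
def JBlockPos (σ : F → F → JState K W) : Prop := ∀ m, BlockPos fun i j => σ i j m

theorem JBlockPos.pushMem {σ : F → F → JState K W} (h : JBlockPos σ) (f : (K → Bool) → (K → Bool)) :
    JBlockPos (fun i j => OSP.pushMem f (σ i j)) := fun m =>
  BlockPos.sum _ fun m' _ => BlockPos.ite _ fun _ => h m'

theorem JBlockPos.clocal {σ : F → F → JState K W} (h : JBlockPos σ) (c : CLocal K) :
    JBlockPos (fun i j => c.apply (σ i j)) := by
  cases c with
  | const t b => exact h.pushMem _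
  | nand i j t => exact h.pushMem _
  | coin t => exact fun m => (BlockPos.sum Finset.univ fun b _ => h (update m t b)).smul (by
      rw [Complex.le_def]; norm_num)

theorem JBlockPos.gate {σ : F → F → JState K W} (h : JBlockPos σ) (g : Gate W) :
    JBlockPos (fun i j m => g.apply (σ i j m)) := fun m => (h m).apply g

theorem JBlockPos.toServer {σ : F → F → JState K W} (h : JBlockPos σ) (i : K) (q : W) :
    JBlockPos (fun a b => OSP.toServer i q (σ a b)) := fun m => (h m).setWire q (m i)

theorem JBlockPos.toClient {σ : F → F → JState K W} (h : JBlockPos σ) (q : W) (i : K) :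
    JBlockPos (fun a b => OSP.toClient q i (σ a b)) := fun m =>
  BlockPos.sum Finset.univ fun d _ => (h (update m i d)).projWire q (m i)

theorem JBlockPos.interact {σ : F → F → JState K W} (h : JBlockPos σ) (cs : List (CInstr K))
    (ss : List (SInstr W)) : JBlockPos (fun a b => OSP.interact cs ss (σ a b)) := by
  induction cs, ss using interact_induction generalizing σ with
  | nil => simpa only [interact_nil_nil] using h
  | gate cs g ss ih => simpa only [interact_gate] using ih (h.gate g)
  | nil_comm q ss ih => simpa only [interact_nil_comm] using ih h
  | loc c cs ss ih => simpa only [interact_loc] using ih (h.clocal c)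
  | send_comm i q cs ss ih => simpa only [interact_send_comm] using ih (h.toServer i q)
  | recv_comm i q cs ss ih => simpa only [interact_recv_comm] using ih (h.toClient q i)
  | send_nil i cs ih => simpa only [interact_send_nil] using ih h
  | recv_nil i cs ih => simpa only [interact_recv_nil] using ih (h.clocal _)

variable {k N : ℕ}

theorem JBlockPos.step {σ : F → F → JState (Fin k) (Fin N)} (h : JBlockPos σ)
    {Ω : Bool → Bool → Matrix Bool Bool ℂ} (hΩ : ∀ b s, (Ω b s).PosSemidef) (H : HInstr k N) :
    JBlockPos (fun a b => H.step Ω (σ a b)) := by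
  cases H with
  | client c => exact h.clocal c
  | server g => exact h.gate g
  | toServer i q => exact h.toServer i q
  | toClient q i => exact h.toClient q i
  | osp b s q =>
    exact fun m => BlockPos.sum _ fun m' _ => BlockPos.sum _ fun d _ => BlockPos.ite _ fun _ =>
      (h m').replaceWire q (hΩ _ _)

theorem JBlockPos.runSteps {σ : F → F → JState (Fin k) (Fin N)} (h : JBlockPos σ)
    {Ω : Bool → Bool → Matrix Bool Bool ℂ} (hΩ : ∀ b s, (Ω b s).PosSemidef) (p : List (HInstr k N)) :
    JBlockPos (fun a b => OSP.runSteps Ω p (σ a b)) := by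
  induction p generalizing σ with
  | nil => exact h
  | cons H p ih => exact ih (h.step hΩ H)

end

/-! ### Traces -/

section
variable {K W : Type} [Fintype K] [DecidableEq K] [Fintype W] [DecidableEq W]

theorem trace_conj {I : Type} [Fintype I] [DecidableEq I] {U : Matrix I I ℂ}
    (hU : U.conjTranspose * U = 1) (ρ : Matrix I I ℂ) : (conj U ρ).trace = ρ.trace := by
  rw [conj, Matrix.trace_mul_comm, ← Matrix.mul_assoc, hU, Matrix.one_mul]

theorem onWire_unitary (q : W) {u : Matrix Bool Bool ℂ} (hu : u.conjTranspose * u = 1) :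
    (onWire q u).conjTranspose * onWire q u = 1 := by
  have h1 : (onWire q u).conjTranspose = onWire q u.conjTranspose := by
    ext w w'
    simp only [onWire, Matrix.conjTranspose_apply, Matrix.of_apply, apply_ite star, star_zero]
    congr 1
    apply propext
    exact ⟨fun h j hj => (h j hj).symm, fun h j hj => (h j hj).symm⟩
  rw [h1]
  ext w w'
  rw [onWire_mul_apply]
  have h2 : ∀ a, onWire q u (update w q a) w' =
      if ∀ j, j ≠ q → w j = w' j then u a (w' q) else 0 := by
    intro a
    simp only [onWire, Matrix.of_apply, Function.update_self]
    congr 1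
    apply propext
    exact ⟨fun h j hj => by simpa [hj] using h j hj, fun h j hj => by simpa [hj] using h j hj⟩
  have h3 : ∑ a, u.conjTranspose (w q) a * u a (w' q) = (1 : Matrix Bool Bool ℂ) (w q) (w' q) := by
    rw [← hu, Matrix.mul_apply]
  simp only [h2, mul_ite, mul_zero]
  by_cases h : ∀ j, j ≠ q → w j = w' j
  · simp only [if_pos h, h3, Matrix.one_apply]
    congr 1
    apply propext
    exact ⟨fun e => funext fun j => if hj : j = q then by subst hj; exact e else h j hj, fun e => e ▸ rfl⟩
  · simp only [if_neg h, Finset.sum_const_zero]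
    exact (Matrix.one_apply_ne fun e => h fun j _ => congrFun e j).symm

end

/-! ### Trace preservation -/

theorem hMat_unitary : hMat.conjTranspose * hMat = 1 := by
  have h2 : (Real.sqrt 2 : ℂ) * Real.sqrt 2 = 2 := by
    rw [← Complex.ofReal_mul, Real.mul_self_sqrt (by norm_num)]; norm_num
  have h0 : (Real.sqrt 2 : ℂ) ≠ 0 := fun h => by rw [h] at h2; norm_num at h2
  ext a b
  cases a <;> cases b <;>
    simp [hMat, Matrix.mul_apply, Complex.conj_ofReal] <;> field_simp <;> rw [pow_two, h2] <;> norm_num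

theorem pMat_unitary : pMat.conjTranspose * pMat = 1 := by
  rw [pMat, Matrix.diagonal_conjTranspose, Matrix.diagonal_mul_diagonal, ← Matrix.diagonal_one]
  congr 1
  funext b
  cases b <;> simp

theorem tdgMat_unitary : tdgMat.conjTranspose * tdgMat = 1 := by
  rw [tdgMat, Matrix.diagonal_conjTranspose, Matrix.diagonal_mul_diagonal, ← Matrix.diagonal_one]
  congr 1
  funext b
  cases b
  · simp
  · simp only [if_true, Pi.star_apply, Complex.star_def, ← Complex.exp_conj]
    rw [← Complex.exp_add]
    simp only [map_mul, map_neg, Complex.conj_ofReal, Complex.conj_I]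
    ring_nf
    exact Complex.exp_zero

section
variable {A K W : Type} [Fintype A] [DecidableEq A] [Fintype K] [DecidableEq K] [Fintype W]
  [DecidableEq W]

theorem trace_conj_cnot {c t : W} (h : c ≠ t) (ρ : Op W) : (conj (cnotMat c t) ρ).trace = ρ.trace := by
  simp only [Matrix.trace, Matrix.diag_apply, conj_cnot_apply h]
  exact Equiv.sum_comp (Function.Involutive.toPerm (cx c t) (cx_cx h)) fun w => ρ w w

theorem trace_conj_pauli (r s : W → Bool) (ρ : Op W) : (conj (pauli r s) ρ).trace = ρ.trace := by
  simp only [Matrix.trace, Matrix.diag_apply, conj_pauli_apply]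
  have h : ∀ u : W → Bool, sgn s u * sgn s u = 1 := fun u => by
    rw [sgn, ← Finset.prod_mul_distrib]
    exact Finset.prod_eq_one fun i _ => sg_mul_self _ _
  simp only [h, one_mul]
  exact Equiv.sum_comp (Function.Involutive.toPerm (flip r) fun u => by funext i; simp [flip])
    fun w => ρ w w

theorem trace_setWire (q : W) (b : Bool) (ρ : Op W) : (setWire q b ρ).trace = ρ.trace := by
  have h : (setWire q b ρ).trace =
      ∑ w : W → Bool, ∑ d : Bool, if w q = b then ρ (update w q d) (update w q d) else 0 := by
    simp only [Matrix.trace, Matrix.diag_apply, setWire, Matrix.of_apply, and_self, Finset.sum_ite_irrel,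
      Finset.sum_const_zero]
  rw [h, sum_sum_update q fun m m' => if m q = b then ρ m' m' else 0]
  simp [Matrix.trace]

theorem sum_trace_projWire (q : W) (ρ : Op W) : ∑ b, (projWire q b ρ).trace = ρ.trace := by
  simp only [Matrix.trace, Matrix.diag_apply, projWire, Matrix.of_apply, and_self]
  rw [Finset.sum_comm]
  simp

theorem trace_replaceWire (q : W) (ω : Matrix Bool Bool ℂ) (ρ : Op W) :
    (replaceWire q ω ρ).trace = ω.trace * ρ.trace := by
  have h : (replaceWire q ω ρ).trace =
      ∑ w : W → Bool, ∑ d : Bool, ω (w q) (w q) * ρ (update w q d) (update w q d) := by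
    simp only [Matrix.trace, Matrix.diag_apply, replaceWire, Matrix.of_apply, Finset.mul_sum]
  rw [h, sum_sum_update q fun m m' => ω (m q) (m q) * ρ m' m']
  simp only [Function.update_self, Matrix.trace, Matrix.diag_apply, Finset.sum_mul_sum]
  rw [Finset.sum_comm]

theorem trace_extract (f : A ↪ W) (ρ : Op W) : (extract f ρ).trace = ρ.trace := by
  simp only [Matrix.trace, Matrix.diag_apply, extract_apply]
  rw [Finset.sum_comm]
  simp only [Finset.sum_ite_eq, Finset.mem_univ, if_true]
  exact Finset.sum_congr rfl fun w _ => by rw [extend_comp_self _ _ _ fun _ _ => rfl]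

theorem trace_load (f : A ↪ W) (d : W → Bool) (ρ : Op A) : (load f d ρ).trace = ρ.trace := by
  simp only [Matrix.trace, Matrix.diag_apply, load, Matrix.of_apply, and_self]
  rw [← Finset.sum_filter]
  refine Finset.sum_nbij' (fun w => w ∘ f) (fun a => extend f a d) ?_ ?_ ?_ ?_ ?_
  · simp
  · intro a _
    simp only [Finset.mem_filter, Finset.mem_univ, true_and]
    intro i hi
    exact Function.extend_apply' _ _ _ fun ⟨j, hj⟩ => hi j hj
  · intro w hw
    simp only [Finset.mem_filter, Finset.mem_univ, true_and] at hw
    exact extend_comp_self f w d hw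
  · intro a _; exact extend_comp_emb f a d
  · intro w _; rfl

theorem trace_apply (g : Gate W) (ρ : Op W) : (g.apply ρ).trace = ρ.trace := by
  cases g with
  | h q => exact trace_conj (onWire_unitary q hMat_unitary) ρ
  | p q => exact trace_conj (onWire_unitary q pMat_unitary) ρ
  | tdg q => exact trace_conj (onWire_unitary q tdgMat_unitary) ρ
  | cnot c t ne => exact trace_conj_cnot ne ρ
  | reset q => exact trace_setWire q false ρ

/-- The total trace of a joint state. -/
def trJ (σ : JState K W) : ℂ := ∑ m, (σ m).trace

theorem isLinearMap_trace {I : Type} [Fintype I] : IsLinearMap ℂ (Matrix.trace : Matrix I I ℂ → ℂ) :=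
  ⟨Matrix.trace_add, Matrix.trace_smul⟩

theorem trJ_pushMem (f : (K → Bool) → (K → Bool)) (σ : JState K W) : trJ (pushMem f σ) = trJ σ :=
  sum_pushMem f σ fun _ => isLinearMap_trace

theorem trJ_clocal (c : CLocal K) (σ : JState K W) : trJ (c.apply σ) = trJ σ := by
  cases c with
  | const t b => exact trJ_pushMem _ _
  | nand i j t => exact trJ_pushMem _ _
  | coin t =>
    refine (sum_coin t σ fun _ => isLinearMap_trace).trans (Finset.sum_congr rfl fun m _ => ?_)
    simp only [Fintype.sum_bool, smul_eq_mul]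
    ring

theorem trJ_gate (g : Gate W) (σ : JState K W) : trJ (fun m => g.apply (σ m)) = trJ σ :=
  Finset.sum_congr rfl fun m _ => trace_apply g _

theorem trJ_toServer (i : K) (q : W) (σ : JState K W) : trJ (toServer i q σ) = trJ σ :=
  Finset.sum_congr rfl fun m _ => trace_setWire q _ _

theorem trJ_toClient (q : W) (i : K) (σ : JState K W) : trJ (toClient q i σ) = trJ σ :=
  (sum_toClient q i σ fun _ => isLinearMap_trace).trans
    (Finset.sum_congr rfl fun m _ => sum_trace_projWire q _)

theorem trJ_interact (cs : List (CInstr K)) (ss : List (SInstr W)) (σ : JState K W) :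
    trJ (interact cs ss σ) = trJ σ := by
  induction cs, ss using interact_induction generalizing σ with
  | nil => simp only [interact_nil_nil]
  | gate cs g ss ih => rw [interact_gate, ih, trJ_gate]
  | nil_comm q ss ih => rw [interact_nil_comm, ih]
  | loc c cs ss ih => rw [interact_loc, ih, trJ_clocal]
  | send_comm i q cs ss ih => rw [interact_send_comm, ih, trJ_toServer]
  | recv_comm i q cs ss ih => rw [interact_recv_comm, ih, trJ_toClient]
  | send_nil i cs ih => rw [interact_send_nil, ih]
  | recv_nil i cs ih => rw [interact_recv_nil, ih, trJ_clocal]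

theorem trJ_initState (m₀ : K → Bool) (ρ : Op W) : trJ (initState m₀ ρ) = ρ.trace := by
  simp [trJ, initState, apply_ite Matrix.trace]

theorem trJ_osp {k N : ℕ} (Ω : Bool → Bool → Matrix Bool Bool ℂ) (b s : Fin k) (q : Fin N)
    (σ : JState (Fin k) (Fin N)) :
    trJ ((HInstr.osp b s q).step Ω σ) = ∑ m, (∑ d, (Ω (m b) d).trace) * (σ m).trace := by
  simp only [trJ, HInstr.step, isLinearMap_trace.map_fsum, apply_ite Matrix.trace, Matrix.trace_zero,
    trace_replaceWire, Finset.sum_mul]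
  rw [Finset.sum_comm]
  refine Finset.sum_congr rfl fun m _ => ?_
  rw [Finset.sum_comm]
  simp

end

/-! ### Stability under perturbation of the OSP outputs -/

section
variable {k N : ℕ}

theorem isLinearMap_step (Ω : Bool → Bool → Matrix Bool Bool ℂ) (H : HInstr k N) :
    IsLinearMap ℂ (H.step Ω) := by
  cases H with
  | client c => exact isLinearMap_clocal c
  | server g => exact isLinearMap_gates g
  | toServer i q => exact isLinearMap_toServer i q
  | toClient q i => exact isLinearMap_toClient q i
  | osp b s q =>
    have h := fun x => (isLinearMap_replaceWire (W := Fin N) q x)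
    constructor
    · intro σ τ
      funext m
      simp only [HInstr.step, Pi.add_apply, (h _).map_add, ← Finset.sum_add_distrib]
      refine Finset.sum_congr rfl fun _ _ => Finset.sum_congr rfl fun _ _ => ?_
      split_ifs <;> simp
    · intro c σ
      funext m
      simp only [HInstr.step, Pi.smul_apply, (h _).map_smul, Finset.smul_sum, smul_ite, smul_zero]

theorem isLinearMap_runSteps (Ω : Bool → Bool → Matrix Bool Bool ℂ) (p : List (HInstr k N)) :
    IsLinearMap ℂ (runSteps Ω p) := by
  induction p with
  | nil => exact ⟨fun _ _ => rfl, fun _ _ => rfl⟩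
  | cons H p ih => exact ih.compose (isLinearMap_step Ω H)

theorem trJ_step {Ω : Bool → Bool → Matrix Bool Bool ℂ} (hΩ : ∀ b, ∑ d, (Ω b d).trace = 1)
    (H : HInstr k N) (σ : JState (Fin k) (Fin N)) : trJ (H.step Ω σ) = trJ σ := by
  cases H with
  | client c => exact trJ_clocal c σ
  | server g => exact trJ_gate g σ
  | toServer i q => exact trJ_toServer i q σ
  | toClient q i => exact trJ_toClient q i σ
  | osp b s q => rw [trJ_osp]; simp only [hΩ, one_mul]; rfl

theorem trJ_runSteps {Ω : Bool → Bool → Matrix Bool Bool ℂ} (hΩ : ∀ b, ∑ d, (Ω b d).trace = 1)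
    (p : List (HInstr k N)) (σ : JState (Fin k) (Fin N)) : trJ (runSteps Ω p σ) = trJ σ := by
  induction p generalizing σ with
  | nil => rfl
  | cons H p ih => exact (ih _).trans (trJ_step hΩ H σ)

theorem trJ_add {K W : Type} [Fintype K] [DecidableEq K] [Fintype W] [DecidableEq W]
    (σ τ : JState K W) : trJ (σ + τ) = trJ σ + trJ τ := by
  simp [trJ, Finset.sum_add_distrib]

variable {F : Type} [Fintype F] [DecidableEq F]

theorem BlockPos.trace_nonneg {I : Type} [Fintype I] [DecidableEq I] {σ : F → F → Matrix I I ℂ}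
    (h : BlockPos σ) (i : F) : 0 ≤ (σ i i).trace :=
  (Matrix.PosSemidef.submatrix h fun a : I => (a, i)).trace_nonneg

theorem trJ_osp_le {σ : F → F → JState (Fin k) (Fin N)} (hσ : JBlockPos σ)
    {E : Bool → Bool → Matrix Bool Bool ℂ} {η : ℝ} (hE : ∀ b, ∑ d, (E b d).trace ≤ (η : ℂ))
    (b s : Fin k) (q : Fin N) :
    ∑ i, trJ ((HInstr.osp b s q).step E (σ i i)) ≤ η * ∑ i, trJ (σ i i) := by
  rw [Finset.mul_sum]
  refine Finset.sum_le_sum fun i _ => ?_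
  rw [trJ_osp, trJ, Finset.mul_sum]
  exact Finset.sum_le_sum fun m _ => mul_le_mul_of_nonneg_right (hE _) ((hσ m).trace_nonneg i)

/-- Telescoping over the calls: run with `Ω` up to a call, make the error `E` or `E'` there, and
finish with `Ω₀`. Every run preserves trace and positivity, so each call adds at most `η` times the
initial trace to either part. Keeping the error as two positive parts makes its trace norm readable
from traces, and the index type `F` carries a reference system. -/
theorem exists_perturbation {Ω Ω₀ E E' : Bool → Bool → Matrix Bool Bool ℂ} {η : ℝ}
    (hΩ : ∀ b d, (Ω b d).PosSemidef) (hΩ₀ : ∀ b d, (Ω₀ b d).PosSemidef)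
    (hE : ∀ b d, (E b d).PosSemidef) (hE' : ∀ b d, (E' b d).PosSemidef)
    (tΩ : ∀ b, ∑ d, (Ω b d).trace = 1) (tΩ₀ : ∀ b, ∑ d, (Ω₀ b d).trace = 1)
    (tE : ∀ b, ∑ d, (E b d).trace ≤ (η : ℂ)) (tE' : ∀ b, ∑ d, (E' b d).trace ≤ (η : ℂ))
    (hdiff : ∀ b d, Ω b d = Ω₀ b d + E b d - E' b d) (p : List (HInstr k N))
    (σ : F → F → JState (Fin k) (Fin N)) (hσ : JBlockPos σ) :
    ∃ π ν : F → F → JState (Fin k) (Fin N), JBlockPos π ∧ JBlockPos ν ∧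
      (∀ i j, runSteps Ω p (σ i j) = runSteps Ω₀ p (σ i j) + π i j - ν i j) ∧
      ∑ i, trJ (π i i) ≤ (p.countP HInstr.isOSP : ℂ) * (η * ∑ i, trJ (σ i i)) ∧
      ∑ i, trJ (ν i i) ≤ (p.countP HInstr.isOSP : ℂ) * (η * ∑ i, trJ (σ i i)) := by
  induction p generalizing σ with
  | nil =>
    refine ⟨fun _ _ => 0, fun _ _ => 0, fun _ => BlockPos.zero, fun _ => BlockPos.zero, ?_, ?_, ?_⟩
    · intro i j; simp [runSteps]
    · simp [trJ]
    · simp [trJ]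
  | cons H p ih =>
    obtain ⟨π, ν, hπ, hν, e, tπ, tν⟩ := ih _ (hσ.step hΩ H)
    simp only [trJ_step tΩ] at tπ tν
    by_cases hH : H.isOSP = true
    · cases H with
      | osp b s q =>
        refine ⟨fun i j => π i j + runSteps Ω₀ p ((HInstr.osp b s q).step E (σ i j)),
          fun i j => ν i j + runSteps Ω₀ p ((HInstr.osp b s q).step E' (σ i j)),
          fun m => (hπ m).add ((hσ.step hE _).runSteps hΩ₀ p m),
          fun m => (hν m).add ((hσ.step hE' _).runSteps hΩ₀ p m), ?_, ?_, ?_⟩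
        · intro i j
          have h1 : (HInstr.osp b s q).step Ω (σ i j) = (HInstr.osp b s q).step Ω₀ (σ i j) +
              (HInstr.osp b s q).step E (σ i j) - (HInstr.osp b s q).step E' (σ i j) := by
            funext m
            simp only [HInstr.step, Pi.add_apply, Pi.sub_apply, ← Finset.sum_add_distrib,
              ← Finset.sum_sub_distrib]
            refine Finset.sum_congr rfl fun _ _ => Finset.sum_congr rfl fun _ _ => ?_
            split_ifs
            · rw [hdiff]
              ext w w'
              simp only [replaceWire, Matrix.of_apply, Matrix.add_apply, Matrix.sub_apply]
              ring
            · simp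
          have hL := isLinearMap_runSteps (k := k) (N := N) Ω₀ p
          change runSteps Ω p _ = runSteps Ω₀ p _ + _ - _
          rw [e, h1, hL.map_sub, hL.map_add]
          funext m
          simp only [Pi.add_apply, Pi.sub_apply]
          abel
        · simp only [trJ_add, trJ_runSteps tΩ₀, Finset.sum_add_distrib]
          refine (add_le_add tπ (trJ_osp_le hσ tE b s q)).trans (le_of_eq ?_)
          simp only [List.countP_cons, HInstr.isOSP, if_true]
          push_cast
          ring
        · simp only [trJ_add, trJ_runSteps tΩ₀, Finset.sum_add_distrib]
          refine (add_le_add tν (trJ_osp_le hσ tE' b s q)).trans (le_of_eq ?_)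
          simp only [List.countP_cons, HInstr.isOSP, if_true]
          push_cast
          ring
      | _ => cases hH
    · refine ⟨π, ν, hπ, hν, ?_, ?_, ?_⟩
      · intro i j
        have h1 : H.step Ω₀ (σ i j) = H.step Ω (σ i j) := by
          cases H with
          | osp b s q => exact absurd rfl hH
          | _ => rfl
        change runSteps Ω p _ = runSteps Ω₀ p (H.step Ω₀ (σ i j)) + _ - _
        rw [e, h1]
      · rwa [List.countP_cons_of_neg hH]
      · rwa [List.countP_cons_of_neg hH]

end

namespace Template

variable {Q : QCircuit}

theorem isLinearMap_initState {K W : Type} [Fintype K] [DecidableEq K] [Fintype W] [DecidableEq W]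
    (m₀ : K → Bool) : IsLinearMap ℂ (initState m₀ : Op W → JState K W) := by
  constructor
  · intro x y; funext m; by_cases h : m = m₀ <;> simp [initState, h]
  · intro c x; funext m; by_cases h : m = m₀ <;> simp [initState, h]

/-- Discarding wires and decrypting (`fin`) is linear, completely positive and trace preserving, so
the two parts of the perturbation stay positive with the same traces. The factor `2` counts the two
parts. -/
theorem diamondDist_channel_le (T : Template Q) {Ω Ω₀ E E' : Bool → Bool → Matrix Bool Bool ℂ} {η : ℝ}
    (hΩ : ∀ b d, (Ω b d).PosSemidef) (hΩ₀ : ∀ b d, (Ω₀ b d).PosSemidef)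
    (hE : ∀ b d, (E b d).PosSemidef) (hE' : ∀ b d, (E' b d).PosSemidef)
    (tΩ : ∀ b, ∑ d, (Ω b d).trace = 1) (tΩ₀ : ∀ b, ∑ d, (Ω₀ b d).trace = 1)
    (tE : ∀ b, ∑ d, (E b d).trace ≤ (η : ℂ)) (tE' : ∀ b, ∑ d, (E' b d).trace ≤ (η : ℂ))
    (hdiff : ∀ b d, Ω b d = Ω₀ b d + E b d - E' b d) (x : Fin Q.n → Bool) :
    diamondDist (T.channel Ω x) (T.channel Ω₀ x) ≤ ENNReal.ofReal (2 * (T.ospCalls * η)) := by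
  refine iSup_le fun n => iSup_le fun ρ => iSup_le fun hρ => ENNReal.ofReal_le_ofReal ?_
  set ρb : Fin n → Fin n → Op (Fin Q.v) := fun i j => Matrix.of fun a a' => ρ (a, i) (a', j) with hρb
  have hb : BlockPos ρb := hρ.1
  set σ : Fin n → Fin n → JState (Fin T.k) (Fin T.N) := fun i j =>
    initState (T.initMem x) (load T.vIn (fun _ => false) (ρb i j)) with hσdef
  have hσ : JBlockPos σ := fun m =>
    BlockPos.ite (m = T.initMem x) fun _ => hb.load T.vIn fun _ => false
  have trσ : ∑ i, trJ (σ i i) = 1 := by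
    simp only [hσdef, trJ_initState, trace_load]
    rw [← hρ.2]
    simp only [Matrix.trace, Matrix.diag_apply, hρb, Matrix.of_apply, Fintype.sum_prod_type]
    exact Finset.sum_comm
  obtain ⟨π, ν, hπ, hν, e, tπ, tν⟩ :=
    exists_perturbation hΩ hΩ₀ hE hE' tΩ tΩ₀ tE tE' hdiff T.prog σ hσ
  rw [trσ, mul_one] at tπ tν
  let fin : JState (Fin T.k) (Fin T.N) → Op (Fin Q.w) := fun τ =>
    ∑ m : Fin T.k → Bool, OSP.conj (pauli (m ∘ T.rOut) (m ∘ T.sOut)) (OSP.extract T.wOut (τ m))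
  have hfin : ∀ τ τ' τ'', fin (τ + τ' - τ'') - fin τ = fin τ' - fin τ'' := by
    intro τ τ' τ''
    simp only [fin, ← Finset.sum_sub_distrib, Pi.add_apply, Pi.sub_apply]
    refine Finset.sum_congr rfl fun m _ => ?_
    have h := (isLinearMap_conj (pauli (m ∘ T.rOut) (m ∘ T.sOut))).compose (isLinearMap_extract T.wOut)
    have h1 := h.map_sub (τ m + τ' m) (τ'' m)
    have h2 := h.map_add (τ m) (τ' m)
    rw [h1, h2]
    abel
  have hpos : ∀ τ : Fin n → Fin n → JState (Fin T.k) (Fin T.N), JBlockPos τ →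
      BlockPos fun i j => fin (τ i j) := fun τ hτ =>
    BlockPos.sum _ fun m _ => ((hτ m).extract T.wOut).conj _
  have htr : ∀ τ : Fin n → Fin n → JState (Fin T.k) (Fin T.N),
      (Matrix.of fun p p' : (Fin Q.w → Bool) × Fin n => fin (τ p.2 p'.2) p.1 p'.1).trace =
        ∑ i, trJ (τ i i) := by
    intro τ
    have h1 : ∀ τ, (fin τ).trace = trJ τ := fun τ => by
      simp only [fin, isLinearMap_trace.map_fsum, trace_conj_pauli, trace_extract, trJ]
    rw [← Finset.sum_congr rfl fun i _ => h1 (τ i i)]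
    simp only [Matrix.trace, Matrix.diag_apply, Matrix.of_apply, Fintype.sum_prod_type]
    exact Finset.sum_comm
  have hA : ampl (T.channel Ω x) ρ - ampl (T.channel Ω₀ x) ρ =
      (Matrix.of fun p p' : (Fin Q.w → Bool) × Fin n => fin (π p.2 p'.2) p.1 p'.1) -
        Matrix.of fun p p' : (Fin Q.w → Bool) × Fin n => fin (ν p.2 p'.2) p.1 p'.1 := by
    ext p p'
    have h1 : T.channel Ω x (ρb p.2 p'.2) = fin (runSteps Ω T.prog (σ p.2 p'.2)) := rfl
    have h2 : T.channel Ω₀ x (ρb p.2 p'.2) = fin (runSteps Ω₀ T.prog (σ p.2 p'.2)) := rfl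
    change T.channel Ω x (ρb p.2 p'.2) p.1 p'.1 - T.channel Ω₀ x (ρb p.2 p'.2) p.1 p'.1 =
      fin (π p.2 p'.2) p.1 p'.1 - fin (ν p.2 p'.2) p.1 p'.1
    rw [h1, h2, e, ← Matrix.sub_apply, hfin, Matrix.sub_apply]
  rw [hA]
  refine (traceNorm_sub_le (hpos π hπ) (hpos ν hν)).trans ?_
  rw [htr, htr]
  have h1 := (Complex.le_def.1 tπ).1
  have h2 := (Complex.le_def.1 tν).1
  have h3 : ((T.prog.countP HInstr.isOSP : ℂ) * (η : ℂ)).re = T.ospCalls * η := by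
    rw [← Complex.ofReal_natCast, ← Complex.ofReal_mul, Complex.ofReal_re]; rfl
  rw [h3] at h1 h2
  linarith

end Template

/-! ### The output of an OSP protocol -/

theorem zeroState_posSemidef {W : Type} [Fintype W] [DecidableEq W] :
    (zeroState : Op W).PosSemidef := by
  rw [zeroState, ← Matrix.diagonal_single]
  refine Matrix.PosSemidef.diagonal fun w => ?_
  by_cases h : w = fun _ => false
  · subst h; simp
  · simp [h]

theorem trace_zeroState {W : Type} [Fintype W] [DecidableEq W] : (zeroState : Op W).trace = 1 := by
  simp [zeroState]

theorem hMat_conjTranspose : hMat.conjTranspose = hMat := by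
  ext a b
  cases a <;> cases b <;> simp [hMat, Matrix.conjTranspose_apply, Complex.conj_ofReal]

theorem hMat_mul_hMat : hMat * hMat = 1 := by
  have := hMat_unitary
  rwa [hMat_conjTranspose] at this

namespace OSPProtocol

theorem proj_conjTranspose (b s : Bool) : (proj b s).conjTranspose = proj b s := by
  have h : (Matrix.single s s (1 : ℂ)).conjTranspose = Matrix.single s s 1 := by simp
  cases b
  · exact h
  · simp only [proj, if_true, Matrix.conjTranspose_mul, h, hMat_conjTranspose, Matrix.mul_assoc]

/-- The projector has rank one, so every compression to its range is a multiple of it. -/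
theorem proj_mul_mul (b s : Bool) (X : Matrix Bool Bool ℂ) :
    proj b s * X * proj b s = (proj b s * X).trace • proj b s := by
  have h : ∀ Y : Matrix Bool Bool ℂ, Matrix.single s s (1 : ℂ) * Y * Matrix.single s s 1 =
      (Matrix.single s s (1 : ℂ) * Y).trace • Matrix.single s s 1 := by
    intro Y
    ext u v
    cases s <;> cases u <;> cases v <;> simp [Matrix.mul_apply, Matrix.trace, Matrix.single]
  cases b
  · exact h X
  · simp only [proj, if_true]
    have e := h (hMat * X * hMat)
    have e2 : (Matrix.single s s (1 : ℂ) * (hMat * X * hMat)).trace =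
        (hMat * Matrix.single s s 1 * hMat * X).trace := by
      rw [← Matrix.mul_assoc, Matrix.trace_mul_comm]
      simp only [Matrix.mul_assoc]
    rw [e2] at e
    calc hMat * Matrix.single s s 1 * hMat * X * (hMat * Matrix.single s s 1 * hMat)
        = hMat * (Matrix.single s s (1 : ℂ) * (hMat * X * hMat) * Matrix.single s s 1) * hMat := by
          simp only [Matrix.mul_assoc]
      _ = _ := by rw [e]; simp only [Matrix.mul_smul, Matrix.smul_mul]

theorem trace_proj (b s : Bool) : (proj b s).trace = 1 := by
  cases b
  · simp [proj]
  · simp only [proj, if_true]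
    rw [Matrix.trace_mul_comm, ← Matrix.mul_assoc, hMat_mul_hMat, Matrix.one_mul]
    simp

theorem proj_mul_self (b s : Bool) : proj b s * proj b s = proj b s := by
  have h := proj_mul_mul b s 1
  rwa [Matrix.mul_one, trace_proj, one_smul] at h

theorem proj_posSemidef (b s : Bool) : (proj b s).PosSemidef := by
  have h := Matrix.posSemidef_conjTranspose_mul_self (proj b s)
  rwa [proj_conjTranspose, proj_mul_self] at h

variable (P : OSPProtocol)

/-- The joint state at the end of an honest execution on input `b`. -/
def finalState (b : Bool) : JState (Fin P.k) (Fin P.N) :=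
  interact P.client P.server (initState (P.initMem b) zeroState)

theorem outState_eq (b s : Bool) : P.outState b s =
    ∑ m : Fin P.k → Bool, if m P.sOut = s then
      ∑ e : Fin P.N → Bool, (if e P.qOut = false then
        (P.finalState b m).submatrix (update e P.qOut) (update e P.qOut) else 0) else 0 := by
  ext u u'
  simp only [outState, Matrix.of_apply, Matrix.sum_apply]
  refine Finset.sum_congr rfl fun m _ => ?_
  split_ifs
  · rw [Matrix.sum_apply]
    refine Finset.sum_congr rfl fun e _ => ?_
    split_ifs <;> rfl
  · rfl

theorem outState_posSemidef (b s : Bool) : (P.outState b s).PosSemidef := by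
  have h0 : JBlockPos (fun _ _ : Unit => initState (P.initMem b) (zeroState : Op (Fin P.N))) := fun m =>
    BlockPos.ite (m = P.initMem b) fun _ =>
      Matrix.PosSemidef.submatrix zeroState_posSemidef (fun p : (Fin P.N → Bool) × Unit => p.1)
  have h1 := h0.interact P.client P.server
  have h2 : BlockPos (fun _ _ : Unit => P.outState b s) := by
    simp only [outState_eq]
    exact BlockPos.sum _ fun m _ => BlockPos.ite _ fun _ => BlockPos.sum _ fun e _ =>
      BlockPos.ite _ fun _ => (h1 m).submatrix _
  exact Matrix.PosSemidef.submatrix h2 fun a : Bool => (a, ())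

/-- An observable on the output wire sees only the reduced state. With `u = 1` this gives the
normalisation of `outState`, with `u = proj b s` the correctness probability. -/
theorem trace_mul_outState (b s : Bool) (u : Matrix Bool Bool ℂ) :
    (u * P.outState b s).trace =
      ∑ m : Fin P.k → Bool, if m P.sOut = s then (onWire P.qOut u * P.finalState b m).trace else 0 := by
  simp only [outState_eq, Matrix.mul_sum, isLinearMap_trace.map_fsum, mul_ite, Matrix.mul_zero,
    apply_ite Matrix.trace, Matrix.trace_zero]
  refine Finset.sum_congr rfl fun m _ => ?_
  split_ifs
  swap; · rfl
  set ρ := P.finalState b m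
  set q := P.qOut
  have h1 : (onWire q u * ρ).trace = ∑ w, ∑ a, u (w q) a * ρ (update w q a) w := by
    simp only [Matrix.trace, Matrix.diag_apply, onWire_mul_apply]
  have h2 : ∀ e : Fin P.N → Bool, (u * ρ.submatrix (update e q) (update e q)).trace =
      ∑ v, ∑ a, u v a * ρ (update e q a) (update e q v) := fun e => by
    simp only [Matrix.trace, Matrix.diag_apply, Matrix.mul_apply, Matrix.submatrix_apply]
  simp only [h1, h2]
  have h3 := sum_sum_update q fun e e' => if e q = false then
    ∑ a, u (e' q) a * ρ (update e' q a) e' else 0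
  simp only [Function.update_self, Function.update_idem, Finset.sum_ite_irrel, Finset.sum_const_zero,
    Finset.sum_ite_eq', Finset.mem_univ, if_true] at h3
  rw [← h3]

theorem sum_trace_outState (b : Bool) : ∑ s, (P.outState b s).trace = 1 := by
  have h : ∀ s, (P.outState b s).trace =
      ∑ m : Fin P.k → Bool, if m P.sOut = s then (P.finalState b m).trace else 0 := fun s => by
    have h1 : onWire P.qOut (1 : Matrix Bool Bool ℂ) = 1 := by
      have := onWire_unitary P.qOut (u := 1) (by simp)
      ext w w'
      rw [onWire, Matrix.of_apply]
      simp only [Matrix.one_apply, ← ite_and]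
      congr 1
      apply propext
      refine ⟨fun h => funext fun j => ?_, fun e => by subst e; simp⟩
      by_cases hj : j = P.qOut
      · subst hj; exact h.2
      · exact h.1 j hj
    have := P.trace_mul_outState b s 1
    simpa only [h1, Matrix.one_mul] using this
  simp only [h]
  rw [Finset.sum_comm]
  simp only [Finset.sum_ite_eq, Finset.mem_univ, if_true]
  exact (trJ_interact _ _ _).trans ((trJ_initState _ _).trans trace_zeroState)

theorem sum_trace_proj_mul_outState (b : Bool) :
    (∑ s, (proj b s * P.outState b s).trace).re = P.correctProb b := by
  simp only [trace_mul_outState]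
  rw [Finset.sum_comm, correctProb, Complex.re_sum]
  refine Finset.sum_congr rfl fun m _ => ?_
  simp only [Finset.sum_ite_eq, Finset.mem_univ, if_true]
  rfl

end OSPProtocol

/-- With `q = 1 - p`, the block `pωp` is `Tr ω • p` up to `Tr(qω) • p`, and `qωq` is small. The
cross terms `pωq + qωp` have no sign, but they are `DωD - t²pωp - t⁻²qωq` for `D = t p + t⁻¹ q`, a
difference of positive operators. If `Tr(qω) ≤ t⁴`, all traces are of order `t²`: the usual
square-root loss, obtained without square roots of operators. -/
theorem exists_rank_one_decomposition {p ω : Matrix Bool Bool ℂ} (hp : p.PosSemidef) (hpp : p * p = p)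
    (htr : p.trace = 1) (hω : ω.PosSemidef) (hpw : p * ω * p = (p * ω).trace • p) {t : ℝ} (ht : 0 < t) :
    ∃ E E' : Matrix Bool Bool ℂ, E.PosSemidef ∧ E'.PosSemidef ∧ ω = ω.trace • p + E - E' ∧
      E.trace = ((1 - p) * ω).trace + (t : ℂ) ^ 2 * (p * ω).trace + ((t : ℂ) ^ 2)⁻¹ * ((1 - p) * ω).trace ∧
      E'.trace = ((1 - p) * ω).trace + (t : ℂ) ^ 2 * (p * ω).trace + ((t : ℂ) ^ 2)⁻¹ * ((1 - p) * ω).trace := by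
  set q := 1 - p with hq
  have hph : p.conjTranspose = p := hp.isHermitian
  have hqh : q.conjTranspose = q := by rw [hq, Matrix.conjTranspose_sub, hph, Matrix.conjTranspose_one]
  have hqq : q * q = q := by rw [hq]; simp [sub_mul, mul_sub, hpp]
  have hqp : q * p = 0 := by rw [hq]; simp [sub_mul, hpp]
  have hpq : p * q = 0 := by rw [hq]; simp [mul_sub, hpp]
  have hsum : p + q = 1 := by rw [hq]; abel
  have t0 : (t : ℂ) ≠ 0 := by exact_mod_cast ht.ne'
  have hposp : (p * ω * p).PosSemidef := by
    have := hω.mul_mul_conjTranspose_same p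
    rwa [hph] at this
  have hposq : (q * ω * q).PosSemidef := by
    have := hω.mul_mul_conjTranspose_same q
    rwa [hqh] at this
  have hc : (0 : ℂ) ≤ (t : ℂ) ^ 2 := by rw [← Complex.ofReal_pow]; exact Complex.zero_le_real.2 (by positivity)
  have hc' : (0 : ℂ) ≤ ((t : ℂ) ^ 2)⁻¹ := by
    rw [← Complex.ofReal_pow, ← Complex.ofReal_inv]; exact Complex.zero_le_real.2 (by positivity)
  have tq : (q * ω * q).trace = (q * ω).trace := by
    rw [Matrix.trace_mul_comm, ← Matrix.mul_assoc, hqq]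
  have tp : (p * ω * p).trace = (p * ω).trace := by
    rw [Matrix.trace_mul_comm, ← Matrix.mul_assoc, hpp]
  set D : Matrix Bool Bool ℂ := (t : ℂ) • p + (t : ℂ)⁻¹ • q with hD
  have hDh : D.conjTranspose = D := by
    rw [hD, Matrix.conjTranspose_add, Matrix.conjTranspose_smul, Matrix.conjTranspose_smul, hph, hqh]
    simp [Complex.conj_ofReal]
  have hDpos : (D * ω * D).PosSemidef := by
    have := hω.mul_mul_conjTranspose_same D
    rwa [hDh] at this
  have hDD : D * ω * D = (t : ℂ) ^ 2 • (p * ω * p) + (p * ω * q + q * ω * p) +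
      ((t : ℂ) ^ 2)⁻¹ • (q * ω * q) := by
    rw [hD]
    simp only [add_mul, mul_add, Matrix.smul_mul, Matrix.mul_smul, smul_smul, mul_inv_cancel₀ t0,
      inv_mul_cancel₀ t0, one_smul, pow_two, mul_inv]
    abel
  have tpq : (p * ω * q).trace = 0 := by
    rw [Matrix.trace_mul_comm, ← Matrix.mul_assoc, hqp, Matrix.zero_mul, Matrix.trace_zero]
  have tqp : (q * ω * p).trace = 0 := by
    rw [Matrix.trace_mul_comm, ← Matrix.mul_assoc, hpq, Matrix.zero_mul, Matrix.trace_zero]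
  have hωsum : ω = p * ω * p + (p * ω * q + q * ω * p) + q * ω * q := by
    calc ω = (p + q) * ω * (p + q) := by rw [hsum, Matrix.one_mul, Matrix.mul_one]
      _ = _ := by simp only [add_mul, mul_add]; abel
  have hωtr : ω.trace = (p * ω).trace + (q * ω).trace := by
    rw [← Matrix.trace_add, ← Matrix.add_mul, hsum, Matrix.one_mul]
  refine ⟨q * ω * q + D * ω * D, (q * ω).trace • p + (t : ℂ) ^ 2 • (p * ω * p) +
    ((t : ℂ) ^ 2)⁻¹ • (q * ω * q), hposq.add hDpos, ((hp.smul ?_).add (hposp.smul hc)).add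
    (hposq.smul hc'), ?_, ?_, ?_⟩
  · rw [← tq]; exact hposq.trace_nonneg
  · conv_lhs => rw [hωsum]
    rw [hDD, hωtr, add_smul, ← hpw]
    abel
  · rw [hDD]
    simp only [Matrix.trace_add, Matrix.trace_smul, tq, tp, tpq, tqp, smul_eq_mul]
    ring
  · simp only [Matrix.trace_add, Matrix.trace_smul, tq, tp, htr, smul_eq_mul]
    ring

/-- The complement of `proj b s` is a projector too and has nonnegative weight in `outState`, whose
total weight is `1`. -/
theorem OSPProtocol.correctProb_le_one (P : OSPProtocol) (b : Bool) : P.correctProb b ≤ 1 := by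
  have h := P.sum_trace_outState b
  rw [← P.sum_trace_proj_mul_outState b]
  have h2 : ∀ s, (proj b s * P.outState b s).trace ≤ (P.outState b s).trace := by
    intro s
    have hq : (1 - proj b s).conjTranspose = 1 - proj b s := by
      rw [Matrix.conjTranspose_sub, proj_conjTranspose, Matrix.conjTranspose_one]
    have h3 := ((P.outState_posSemidef b s).mul_mul_conjTranspose_same (1 - proj b s)).trace_nonneg
    rw [hq, Matrix.trace_mul_comm, ← Matrix.mul_assoc] at h3
    have h4 : (1 - proj b s) * (1 - proj b s) = 1 - proj b s := by
      simp [sub_mul, mul_sub, proj_mul_self]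
    rw [h4, sub_mul, Matrix.one_mul, Matrix.trace_sub] at h3
    exact sub_nonneg.1 h3
  have h5 := (Complex.le_def.1 ((Finset.sum_le_sum fun s (_ : s ∈ Finset.univ) => h2 s).trans
    (le_of_eq h))).1
  simpa using h5

/-- For an OSP error of at most `t⁴`, the terms `t²` and `t⁻² · error` in the decomposition are both
at most `t²`, whence `t⁴ + 2 t²` per call. -/
theorem Template.diamondDist_outState_le {Q : QCircuit} (T : Template Q) (P : OSPProtocol) {t : ℝ}
    (ht : 0 < t) (hP : ∀ b, 1 - P.correctProb b ≤ t ^ 4) (x : Fin Q.n → Bool) :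
    diamondDist (T.channel P.outState x)
        (T.channel (fun b s => (P.outState b s).trace • OSPProtocol.proj b s) x) ≤
      ENNReal.ofReal (2 * (T.ospCalls * (t ^ 4 + 2 * t ^ 2))) := by
  choose E E' hE hE' hd tE tE' using fun b s =>
    exists_rank_one_decomposition (OSPProtocol.proj_posSemidef b s) (OSPProtocol.proj_mul_self b s)
      (OSPProtocol.trace_proj b s) (P.outState_posSemidef b s) (OSPProtocol.proj_mul_mul b s _) ht
  have hpos := fun b s => P.outState_posSemidef b s
  have key : ∀ b, ∑ s, (((1 - OSPProtocol.proj b s) * P.outState b s).trace +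
      (t : ℂ) ^ 2 * (OSPProtocol.proj b s * P.outState b s).trace +
      ((t : ℂ) ^ 2)⁻¹ * ((1 - OSPProtocol.proj b s) * P.outState b s).trace) ≤
        ((t ^ 4 + 2 * t ^ 2 : ℝ) : ℂ) := by
    intro b
    set c := ∑ s, (OSPProtocol.proj b s * P.outState b s).trace with hc
    have h1 : ∀ s, ((1 - OSPProtocol.proj b s) * P.outState b s).trace = (P.outState b s).trace -
        (OSPProtocol.proj b s * P.outState b s).trace := fun s => by
      rw [sub_mul, Matrix.one_mul, Matrix.trace_sub]
    have h0 : 0 ≤ c := Finset.sum_nonneg fun s _ => by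
      have h3 := ((hpos b s).mul_mul_conjTranspose_same (OSPProtocol.proj b s)).trace_nonneg
      rwa [OSPProtocol.proj_conjTranspose, Matrix.trace_mul_comm, ← Matrix.mul_assoc,
        OSPProtocol.proj_mul_self] at h3
    have h2 : c = (P.correctProb b : ℂ) := by
      rw [← P.sum_trace_proj_mul_outState b, ← hc]
      have := (Complex.le_def.1 h0).2
      exact Complex.ext (by simp) (by simpa using this.symm)
    simp only [h1, Finset.sum_add_distrib, ← Finset.mul_sum, Finset.sum_sub_distrib, ← hc,
      P.sum_trace_outState b]
    rw [h2]
    have h4 : (1 - P.correctProb b) + t ^ 2 * P.correctProb b + (t ^ 2)⁻¹ * (1 - P.correctProb b) ≤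
        t ^ 4 + 2 * t ^ 2 := by
      have e1 : (t ^ 2)⁻¹ * (1 - P.correctProb b) ≤ t ^ 2 := by
        rw [inv_mul_le_iff₀ (by positivity)]
        calc _ ≤ t ^ 4 := hP b
          _ = _ := by ring
      have e2 : t ^ 2 * P.correctProb b ≤ t ^ 2 * 1 :=
        mul_le_mul_of_nonneg_left (P.correctProb_le_one b) (by positivity)
      linarith [hP b]
    have h5 : ((1 : ℂ) - (P.correctProb b : ℂ)) + (t : ℂ) ^ 2 * (P.correctProb b : ℂ) +
        ((t : ℂ) ^ 2)⁻¹ * (1 - (P.correctProb b : ℂ)) =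
        (((1 - P.correctProb b) + t ^ 2 * P.correctProb b + (t ^ 2)⁻¹ * (1 - P.correctProb b) : ℝ) : ℂ) := by
      push_cast; rfl
    rw [h5]
    exact_mod_cast h4
  refine T.diamondDist_channel_le hpos (fun b s => (OSPProtocol.proj_posSemidef b s).smul
    (hpos b s).trace_nonneg) hE hE' P.sum_trace_outState (fun b => ?_) (fun b => ?_) (fun b => ?_) hd x
  · simp only [Matrix.trace_smul, OSPProtocol.trace_proj, smul_eq_mul, mul_one, P.sum_trace_outState]
  · simp only [tE]; exact key b
  · simp only [tE']; exact key b

/-! ### Polynomial bounds and negligible functions -/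

theorem mul_pow_le_mul_pow {a b c d x : ℕ} (h : a ≤ c) (h' : b ≤ d) : a * (x + 1) ^ b ≤ c * (x + 1) ^ d :=
  Nat.mul_le_mul h (Nat.pow_le_pow_right (Nat.succ_pos x) h')

/-- A bound valid for all `l`, with one number as factor and exponent, behaves well under sums and
products. The finitely many exceptional values are absorbed by their sum `M`. -/
theorem polyBounded_iff {f : ℕ → ℕ} : PolyBounded f ↔ ∃ c, ∀ l, f l ≤ c * (l + 1) ^ c := by
  constructor
  · rintro ⟨c, N, h⟩
    set M := ∑ i ∈ Finset.range (N + 1), f i with hM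
    refine ⟨M + 1 + c, fun l => ?_⟩
    have h1 : f l ≤ (M + 1) * (l + 1) ^ c := by
      have hp : 1 ≤ (l + 1) ^ c := Nat.one_le_pow _ _ (Nat.succ_pos l)
      by_cases hl : N < l
      · calc f l ≤ l ^ c := (h l hl).le
          _ ≤ 1 * (l + 1) ^ c := by rw [one_mul]; exact Nat.pow_le_pow_left (Nat.le_succ l) c
          _ ≤ _ := Nat.mul_le_mul_right _ (by omega)
      · have : f l ≤ M := Finset.single_le_sum (f := f) (fun _ _ => Nat.zero_le _)
          (Finset.mem_range.2 (by omega))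
        calc f l ≤ (M + 1) * 1 := by omega
          _ ≤ _ := Nat.mul_le_mul_left _ hp
    exact h1.trans (mul_pow_le_mul_pow (by omega) (by omega))
  · rintro ⟨c, h⟩
    refine ⟨c + 1, c * 2 ^ c, fun l hl => (h l).trans_lt ?_⟩
    rcases Nat.eq_zero_or_pos l with rfl | hl0
    · omega
    calc c * (l + 1) ^ c ≤ c * (2 * l) ^ c := Nat.mul_le_mul_left _ (Nat.pow_le_pow_left (by omega) c)
      _ = (c * 2 ^ c) * l ^ c := by rw [mul_pow, mul_assoc]
      _ < l * l ^ c := Nat.mul_lt_mul_of_pos_right hl (Nat.pow_pos hl0)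
      _ = l ^ (c + 1) := by rw [pow_succ, mul_comm]

theorem PolyBounded.mono {f g : ℕ → ℕ} (hg : PolyBounded g) (h : ∀ l, f l ≤ g l) : PolyBounded f := by
  obtain ⟨c, N, hc⟩ := hg
  exact ⟨c, N, fun l hl => (h l).trans_lt (hc l hl)⟩

theorem PolyBounded.const (a : ℕ) : PolyBounded fun _ => a :=
  polyBounded_iff.2 ⟨a, fun l => Nat.le_mul_of_pos_right _ (Nat.pow_pos (Nat.succ_pos l))⟩

theorem PolyBounded.add {f g : ℕ → ℕ} (hf : PolyBounded f) (hg : PolyBounded g) :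
    PolyBounded fun l => f l + g l := by
  obtain ⟨c, hc⟩ := polyBounded_iff.1 hf
  obtain ⟨d, hd⟩ := polyBounded_iff.1 hg
  refine polyBounded_iff.2 ⟨c + d, fun l => ?_⟩
  rw [add_mul]
  exact add_le_add ((hc l).trans (mul_pow_le_mul_pow le_rfl (by omega)))
    ((hd l).trans (mul_pow_le_mul_pow le_rfl (by omega)))

theorem PolyBounded.mul {f g : ℕ → ℕ} (hf : PolyBounded f) (hg : PolyBounded g) :
    PolyBounded fun l => f l * g l := by
  obtain ⟨c, hc⟩ := polyBounded_iff.1 hf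
  obtain ⟨d, hd⟩ := polyBounded_iff.1 hg
  refine polyBounded_iff.2 ⟨c * d + (c + d), fun l => ?_⟩
  calc f l * g l ≤ (c * (l + 1) ^ c) * (d * (l + 1) ^ d) := Nat.mul_le_mul (hc l) (hd l)
    _ = (c * d) * (l + 1) ^ (c + d) := by ring
    _ ≤ _ := mul_pow_le_mul_pow (by omega) (by omega)

theorem Negligible.mono {f g : ℕ → ℝ} (hg : Negligible g) (h : ∀ l, f l ≤ g l) : Negligible f := fun c =>
  let ⟨N, hN⟩ := hg c
  ⟨N, fun n hn => (h n).trans_lt (hN n hn)⟩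

theorem Negligible.polyMul {f : ℕ → ℝ} (hf : Negligible f) {g : ℕ → ℕ} (hg : PolyBounded g) :
    Negligible fun l => g l * f l := by
  intro c
  obtain ⟨d, M, hM⟩ := hg
  obtain ⟨N, hN⟩ := hf (c + d)
  refine ⟨max M N, fun n hn => ?_⟩
  have hn0 : (0 : ℝ) < n := Nat.cast_pos.2 (by omega)
  have h1 : (g n : ℝ) ≤ (n : ℝ) ^ d := by exact_mod_cast (hM n (by omega)).le
  have h2 := hN n (by omega)
  calc (g n : ℝ) * f n ≤ g n * ((n : ℝ) ^ (c + d))⁻¹ := by gcongr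
    _ < (n : ℝ) ^ d * ((n : ℝ) ^ (c + d))⁻¹ := by
        have : (g n : ℝ) < (n : ℝ) ^ d := by exact_mod_cast hM n (by omega)
        gcongr
    _ = ((n : ℝ) ^ c)⁻¹ := by rw [pow_add]; field_simp

theorem Negligible.add {f g : ℕ → ℝ} (hf : Negligible f) (hg : Negligible g) :
    Negligible fun l => f l + g l := by
  have h : Negligible fun l => max (f l) (g l) := fun c => by
    obtain ⟨N, hN⟩ := hf c
    obtain ⟨M, hM⟩ := hg c
    exact ⟨max N M, fun n hn => max_lt (hN n (by omega)) (hM n (by omega))⟩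
  refine (h.polyMul (PolyBounded.const 2)).mono fun l => ?_
  have h1 := le_max_left (f l) (g l)
  have h2 := le_max_right (f l) (g l)
  push_cast
  linarith

theorem Negligible.max {f g : ℕ → ℝ} (hf : Negligible f) (hg : Negligible g) :
    Negligible fun l => Max.max (f l) (g l) := fun c => by
  obtain ⟨N, hN⟩ := hf c
  obtain ⟨M, hM⟩ := hg c
  exact ⟨Max.max N M, fun n hn => max_lt (hN n (by omega)) (hM n (by omega))⟩

theorem Negligible.sqrt {f : ℕ → ℝ} (hf : Negligible f) : Negligible fun l => Real.sqrt (f l) := by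
  intro c
  obtain ⟨N, hN⟩ := hf (c * 2)
  refine ⟨N, fun n hn => ?_⟩
  have hn0 : (0 : ℝ) < n := Nat.cast_pos.2 (by omega)
  rw [Real.sqrt_lt' (by positivity), inv_pow, ← pow_mul]
  exact hN n hn

theorem negligible_two_pow : Negligible fun l => ((2 : ℝ) ^ l)⁻¹ := by
  intro c
  have h := tendsto_pow_const_div_const_pow_of_one_lt c (one_lt_two : (1 : ℝ) < 2)
  obtain ⟨N, hN⟩ := Filter.eventually_atTop.1 (h.eventually (gt_mem_nhds one_pos))
  refine ⟨N, fun n hn => ?_⟩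
  have hn0 : (0 : ℝ) < n := Nat.cast_pos.2 (by omega)
  have h1 := hN n hn.le
  rw [div_lt_one (by positivity)] at h1
  exact inv_strictAnti₀ (by positivity) h1

/-! ### Correctness -/

theorem diamondDist_real_ideal {P : ℕ → OSPProtocol} (hP : IsOSP P) (Q : ℕ → QCircuit)
    (hQ : PolyBounded fun l => (Q l).size) (x : (l : ℕ) → Fin (Q l).n → Bool) :
    ∃ ν : ℕ → ℝ, Negligible ν ∧ ∀ l,
      diamondDist (((Q l).template.expand (P l)).real (x l)) ((Q l).ideal (x l)) ≤
        ENNReal.ofReal (ν l) := by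
  -- The term `2^(-l)` keeps `e` positive, so that `t = e^(1/4)` can be inverted even for a perfect
  -- OSP.
  set e : ℕ → ℝ := fun l => Max.max (Max.max (1 - (P l).correctProb false) (1 - (P l).correctProb true))
    ((2 : ℝ) ^ l)⁻¹ with he
  have hneg : Negligible e := ((hP.correct false).max (hP.correct true)).max negligible_two_pow
  have hpos : ∀ l, 0 < e l := fun l => lt_of_lt_of_le (by positivity) (le_max_right _ _)
  refine ⟨fun l => (2 * (Q l).tCount : ℕ) * (e l + 2 * Real.sqrt (e l)), ?_, fun l => ?_⟩
  · have h2 := hneg.sqrt.polyMul (PolyBounded.const 2)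
    push_cast at h2
    refine (hneg.add h2).polyMul ((PolyBounded.const 2).mul (hQ.mono fun l => ?_))
    exact List.countP_le_length.trans (Nat.le_add_left _ _)
  · set t := Real.sqrt (Real.sqrt (e l)) with ht
    have ht0 : 0 < t := Real.sqrt_pos.2 (Real.sqrt_pos.2 (hpos l))
    have t2 : t ^ 2 = Real.sqrt (e l) := Real.sq_sqrt (Real.sqrt_nonneg _)
    have t4 : t ^ 4 = e l := by
      calc t ^ 4 = (t ^ 2) ^ 2 := by ring
        _ = e l := by rw [t2, Real.sq_sqrt (hpos l).le]
    have h := (Q l).template.diamondDist_outState_le (P l) ht0 (fun b => by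
      rw [t4]
      cases b
      · exact (le_max_left _ _).trans (le_max_left _ _)
      · exact (le_max_right _ _).trans (le_max_left _ _)) (x l)
    have h1 : ((Q l).template.expand (P l)).real (x l) = (Q l).template.channel (P l).outState (x l) :=
      funext fun ρ => Template.real_expand _ _ _ _
    have h2 : (Q l).template.channel (fun b s => ((P l).outState b s).trace • OSPProtocol.proj b s) (x l) =
        (Q l).ideal (x l) :=
      funext fun ρ => QCircuit.channel_template (fun b s => ((P l).outState b s).trace)
        (P l).sum_trace_outState (x l) ρ
    rw [h2, t4, t2, QCircuit.ospCalls_template] at h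
    rw [h1]
    refine h.trans (le_of_eq ?_)
    congr 1
    push_cast
    ring

/-! ### Size of the delegation protocol -/

namespace QCircuit

variable (Q : QCircuit)

theorem length_flatMap_le {α β : Type} (f : α → List β) {B : ℕ} (h : ∀ a, (f a).length ≤ B) (l : List α) :
    (l.flatMap f).length ≤ B * l.length := by
  induction l with
  | nil => simp
  | cons a l ih =>
    rw [List.flatMap_cons, List.length_append, List.length_cons, mul_add, mul_one, add_comm]
    exact add_le_add ih (h a)

theorem length_prog_template : Q.template.prog.length ≤ 21 * Q.size := by
  -- An input block has 11 instructions and the longest gate block, that of `T†`, has 18; the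
  -- constant is not tight.
  have h1 : ∀ i : Fin Q.n, (inputBlock i).length ≤ 21 := fun i => by
    simp [inputBlock, clients, xorInto]
  have h2 : ∀ g : Gate Q.Wire, (gateBlock g).length ≤ 21 := fun g => by
    cases g <;> simp [gateBlock, clients, keyUpdate, xorInto, correction]
  change ((List.finRange Q.n).flatMap inputBlock ++ Q.gates.flatMap gateBlock).length ≤ _
  rw [List.length_append]
  have h3 := length_flatMap_le _ h1 (List.finRange Q.n)
  have h4 := length_flatMap_le _ h2 Q.gates
  rw [List.length_finRange] at h3
  unfold size
  omega

theorem numCells_le : Q.numCells ≤ 3 * Q.size + 3 := by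
  simp only [numCells, size, Fintype.card_sum, Fintype.card_fin]
  omega

theorem numWires_le : Q.numWires ≤ Q.size + 1 := by
  simp only [numWires, size, Fintype.card_sum, Fintype.card_fin, Fintype.card_unit]
  omega

theorem size_expand (P : OSPProtocol) :
    (Q.template.expand P).toProtocol.size ≤ 200 * ((Q.size + 1) * (P.toProtocol.size + 1)) := by
  have hc : ∀ H : HInstr Q.numCells Q.numWires, (H.toC P).length ≤ P.toProtocol.size + 4 := fun H => by
    cases H <;> simp [HInstr.toC, copyBit, Protocol.size] <;> omega
  have hs : ∀ H : HInstr Q.numCells Q.numWires, (H.toS P).length ≤ P.toProtocol.size + 4 := fun H => by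
    cases H <;> simp [HInstr.toS, Protocol.size] <;> omega
  have h1 := length_flatMap_le _ hc Q.template.prog
  have h2 := length_flatMap_le _ hs Q.template.prog
  have h3 := Nat.mul_le_mul_left (P.toProtocol.size + 4) Q.length_prog_template
  have h4 := Q.numCells_le
  have h5 := Q.numWires_le
  have h6 : P.k + P.N ≤ P.toProtocol.size := by unfold Protocol.size; omega
  have e : (Q.template.expand P).toProtocol.size = (Q.numCells + P.k) + (Q.numWires + P.N) +
      (Q.template.prog.flatMap (HInstr.toC P)).length + (Q.template.prog.flatMap (HInstr.toS P)).length := rfl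
  rw [e]
  refine (add_le_add (add_le_add le_rfl (h1.trans h3)) (h2.trans h3)).trans ?_
  generalize P.toProtocol.size = p at *
  generalize Q.size = s at *
  nlinarith [Nat.zero_le (s * p)]

end QCircuit

theorem exists_size_expand_le {P : ℕ → OSPProtocol} (hP : PolyBounded fun l => (P l).toProtocol.size) :
    ∃ c : ℕ, ∀ (l : ℕ) (Q : QCircuit),
      (Q.template.expand (P l)).toProtocol.size ≤ c * (l + Q.size + 1) ^ c := by
  obtain ⟨c, hc⟩ := polyBounded_iff.1 (hP.add (PolyBounded.const 1))
  refine ⟨200 * (c + 1), fun l Q => (Q.size_expand (P l)).trans ?_⟩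
  calc 200 * ((Q.size + 1) * ((P l).toProtocol.size + 1))
      ≤ 200 * ((l + Q.size + 1) * (c * (l + Q.size + 1) ^ c)) := by
        gcongr
        · omega
        · exact (hc l).trans (Nat.mul_le_mul_left _ (Nat.pow_le_pow_left (by omega) c))
    _ = (200 * c) * (l + Q.size + 1) ^ (c + 1) := by ring
    _ ≤ _ := mul_pow_le_mul_pow (by omega) (by omega)

/-! ### Linear maps that commute with the operations of the server -/

section
variable {K A W : Type} [Fintype K] [DecidableEq K] [Fintype A] [DecidableEq A] [Fintype W]
  [DecidableEq W]

theorem pushMem_map {Φ : Op W → Op A} (hΦ : IsLinearMap ℂ Φ) (f : (K → Bool) → (K → Bool))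
    (σ : JState K W) : (fun m => Φ (pushMem f σ m)) = pushMem f fun m => Φ (σ m) := by
  funext m
  simp only [pushMem, hΦ.map_fsum]
  refine Finset.sum_congr rfl fun m' _ => ?_
  split_ifs
  · rfl
  · exact hΦ.map_zero

theorem clocal_map {Φ : Op W → Op A} (hΦ : IsLinearMap ℂ Φ) (c : CLocal K) (σ : JState K W) :
    (fun m => Φ (c.apply σ m)) = c.apply fun m => Φ (σ m) := by
  cases c with
  | const t b => exact pushMem_map hΦ _ σ
  | nand i j t => exact pushMem_map hΦ _ σ
  | coin t =>
    funext m
    simp only [CLocal.apply, hΦ.map_smul, hΦ.map_fsum]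

/-- An interaction uses only gates, overwriting and projections on the server's side, so a linear
map that intertwines these intertwines whole interactions. It is applied to partial traces and to
blocks. -/
theorem interact_map {Φ : Op W → Op A} (hΦ : IsLinearMap ℂ Φ) (f : A ↪ W)
    (hg : ∀ (g : Gate A) ρ, Φ ((g.map f).apply ρ) = g.apply (Φ ρ))
    (hs : ∀ q b ρ, Φ (setWire (f q) b ρ) = setWire q b (Φ ρ))
    (hp : ∀ q b ρ, Φ (projWire (f q) b ρ) = projWire q b (Φ ρ))
    (cs : List (CInstr K)) (ss : List (SInstr A)) (σ : JState K W) :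
    (fun m => Φ (interact cs (ss.map (SInstr.map f)) σ m)) = interact cs ss fun m => Φ (σ m) := by
  induction cs, ss using interact_induction generalizing σ with
  | nil => simp only [List.map_nil, interact_nil_nil]
  | gate cs g ss ih => simp only [List.map_cons, SInstr.map, interact_gate, ih, hg]
  | nil_comm q ss ih => simp only [List.map_cons, SInstr.map, interact_nil_comm, ih]
  | loc c cs ss ih => simp only [interact_loc, ih, clocal_map hΦ]
  | send_comm i q cs ss ih =>
    simp only [List.map_cons, SInstr.map, interact_send_comm, ih, toServer, hs]
    rfl
  | recv_comm i q cs ss ih =>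
    simp only [List.map_cons, SInstr.map, interact_recv_comm, ih, toClient, hΦ.map_fsum, hp]
    rfl
  | send_nil i cs ih => simpa only [List.map_nil, interact_send_nil] using ih σ
  | recv_nil i cs ih =>
    simp only [List.map_nil] at ih
    simp only [List.map_nil, interact_recv_nil, ih, clocal_map hΦ]

theorem interact_extract (f : A ↪ W) (cs : List (CInstr K)) (ss : List (SInstr A)) (σ : JState K W) :
    (fun m => extract f (interact cs (ss.map (SInstr.map f)) σ m)) =
      interact cs ss fun m => extract f (σ m) :=
  interact_map (isLinearMap_extract f) f (extract_apply_map f) (extract_setWire f) (extract_projWire f)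
    cs ss σ

theorem interact_blk_server (f : A ↪ W) (e e' : W → Bool) (cs : List (CInstr K)) (ss : List (SInstr A))
    (σ : JState K W) : (fun m => blk f e e' (interact cs (ss.map (SInstr.map f)) σ m)) =
      interact cs ss fun m => blk f e e' (σ m) :=
  interact_map (isLinearMap_blk f e e') f (blk_apply_map f e e') (blk_setWire f e e')
    (blk_projWire f e e') cs ss σ

theorem extract_zeroState (f : A ↪ W) : extract f zeroState = zeroState := by
  ext u u'
  rw [extract_apply]
  simp only [zeroState, Matrix.single_apply]
  have h : ∀ w : W → Bool, (if w ∘ f = u then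
      (if (fun _ => false) = w ∧ (fun _ => false) = extend f u' w then (1 : ℂ) else 0) else 0) =
      if w = fun _ => false then (if (fun _ => false) = u ∧ (fun _ => false) = u' then 1 else 0) else 0 := by
    intro w
    by_cases hw : w = fun _ => false
    · subst hw
      have e1 : ((fun _ => false) ∘ f : A → Bool) = fun _ => false := rfl
      have e2 : (fun _ => false) = extend f u' (fun _ : W => false) ↔ (fun _ => false) = u' := by
        constructor
        · intro h; rw [← extend_comp_emb f u' fun _ => false, ← h]; rfl
        · rintro rfl
          exact (extend_comp_self f (fun _ => false) (fun _ => false) fun _ _ => rfl).symm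
      simp only [e1, e2, if_true, true_and, ite_and]
    · rw [if_neg (fun h : (fun _ => false) = w ∧ _ => hw h.1.symm), if_neg hw, ite_self]
  simp only [h, Finset.sum_ite_eq', Finset.mem_univ, if_true]

theorem extract_setWire_of_notMem (f : A ↪ W) {a : W} (ha : ∀ j, f j ≠ a) (b : Bool) (ρ : Op W) :
    extract f (setWire a b ρ) = extract f ρ := by
  ext u u'
  rw [extract_apply, extract_apply]
  have h1 : ∀ w : W → Bool, (if w ∘ f = u then setWire a b ρ w (extend f u' w) else 0) =
      ∑ d : Bool, (fun m m' : W → Bool => if m' ∘ f = u then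
        (if m a = b then ρ m' (extend f u' m') else 0) else 0) w (update w a d) := by
    intro w
    have e1 : ∀ d, update w a d ∘ f = w ∘ f := fun d => by
      funext j; simp [ha j]
    have e2 : extend f u' w a = w a := Function.extend_apply' _ _ _ fun ⟨j, hj⟩ => ha j hj
    have e3 : ∀ d, update (extend f u' w) a d = extend f u' (update w a d) := fun d => by
      funext i
      by_cases hi : ∃ j, f j = i
      · obtain ⟨j, rfl⟩ := hi
        simp [ha j, extend_emb_apply]
      · rw [Function.extend_apply' _ _ _ hi]
        by_cases hia : i = a
        · subst hia; simp
        · rw [Function.update_of_ne hia, Function.update_of_ne hia, Function.extend_apply' _ _ _ hi]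
    simp only [setWire, Matrix.of_apply, e1, e2, e3, and_self, Finset.sum_ite_irrel,
      Finset.sum_const_zero]
  refine (Finset.sum_congr rfl fun w _ => h1 w).trans ((sum_sum_update a fun m m' : W → Bool =>
    if m' ∘ f = u then (if m a = b then ρ m' (extend f u' m') else 0) else 0).trans ?_)
  refine Finset.sum_congr rfl fun w _ => ?_
  simp

end

/-! ### One-wire states -/

section
variable {A W : Type} [Fintype A] [DecidableEq A] [Fintype W] [DecidableEq W]

/-- Addition of `b` to the content of wire `q`. -/
def flipWire (q : W) (b : Bool) (ρ : Op W) : Op W :=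
  Matrix.of fun w w' => ρ (update w q (xor (w q) b)) (update w' q (xor (w' q) b))

/-- Addition of `b` to a qubit. -/
def flipBit (b : Bool) (ω : Matrix Bool Bool ℂ) : Matrix Bool Bool ℂ :=
  Matrix.of fun u u' => ω (xor u b) (xor u' b)

theorem flipWire_replaceWire (q : W) (b : Bool) (ω : Matrix Bool Bool ℂ) (ρ : Op W) :
    flipWire q b (replaceWire q ω ρ) = replaceWire q (flipBit b ω) ρ := by
  ext w w'
  simp [flipWire, replaceWire, flipBit]

theorem setWire_eq_replaceWire (q : W) (b : Bool) (ρ : Op W) :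
    setWire q b ρ = replaceWire q (Matrix.single b b 1) ρ := by
  ext w w'
  by_cases h : w q = b ∧ w' q = b
  · simp [setWire, replaceWire, h.1, h.2]
  · simp only [setWire, replaceWire, Matrix.of_apply, if_neg h]
    rw [Matrix.single_apply, if_neg fun h' => h ⟨h'.1.symm, h'.2.symm⟩, zero_mul]

theorem extract_projWire_replaceWire (f : A ↪ W) {a : W} (ha : ∀ j, f j ≠ a) (c : Bool)
    (ω : Matrix Bool Bool ℂ) (ρ : Op W) :
    extract f (projWire a c (replaceWire a ω ρ)) = ω c c • extract f ρ := by
  have h : projWire a c (replaceWire a ω ρ) = ω c c • setWire a c ρ := by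
    ext w w'
    by_cases h : w a = c ∧ w' a = c
    · simp [setWire, replaceWire, projWire, h.1, h.2]
    · simp only [setWire, projWire, Matrix.of_apply, if_neg h, Matrix.smul_apply, smul_zero]
  rw [h, (isLinearMap_extract f).map_smul, extract_setWire_of_notMem f ha]

end

/-- The equatorial states of a qubit. -/
def equatorial (c : ℂ) : Matrix Bool Bool ℂ :=
  Matrix.of fun u u' => (1 / 2 : ℂ) * ((if u then c else 1) * star (if u' then c else 1))

theorem conj_hMat_single : conj hMat (Matrix.single false false 1) = equatorial 1 := by
  have h2 : (Real.sqrt 2 : ℂ) * Real.sqrt 2 = 2 := by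
    rw [← Complex.ofReal_mul, Real.mul_self_sqrt (by norm_num)]; norm_num
  have h0 : (Real.sqrt 2 : ℂ) ≠ 0 := fun h => by rw [h] at h2; norm_num at h2
  ext a b
  cases a <;> cases b <;>
    simp [conj, hMat, equatorial, Matrix.mul_apply, Matrix.single_apply, Complex.conj_ofReal] <;>
    field_simp <;> rw [pow_two, h2]

theorem conj_hMat_equatorial_one : conj hMat (equatorial 1) = Matrix.single false false 1 := by
  rw [← conj_hMat_single, ← conj_mul, hMat_mul_hMat]
  simp [conj]

theorem conj_hMat_equatorial_neg_one : conj hMat (equatorial (-1)) = Matrix.single true true 1 := by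
  have h2 : (Real.sqrt 2 : ℂ) * Real.sqrt 2 = 2 := by
    rw [← Complex.ofReal_mul, Real.mul_self_sqrt (by norm_num)]; norm_num
  have h0 : (Real.sqrt 2 : ℂ) ≠ 0 := fun h => by rw [h] at h2; norm_num at h2
  ext a b
  cases a <;> cases b <;>
    simp [conj, hMat, equatorial, Matrix.mul_apply, Complex.conj_ofReal] <;>
    field_simp <;> rw [pow_two, h2] <;> norm_num

theorem conj_pMat_equatorial (c : ℂ) : conj pMat (equatorial c) = equatorial (Complex.I * c) := by
  ext a b
  cases a <;> cases b <;> simp [conj, pMat, equatorial, Matrix.mul_apply, Matrix.diagonal_apply] <;> ring_nf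

theorem conj_tdgMat_equatorial (c : ℂ) : conj tdgMat (equatorial c) =
    equatorial (Complex.exp (-(Real.pi / 4 : ℝ) * Complex.I) * c) := by
  ext a b
  cases a <;> cases b <;> simp [conj, tdgMat, equatorial, Matrix.mul_apply, Matrix.diagonal_apply] <;>
    ring_nf

/-- Flipping a qubit on the equator inverts its relative phase, which for a phase of modulus `1` is
conjugation. -/
theorem flipBit_equatorial {c : ℂ} (hc : c * star c = 1) (b : Bool) :
    flipBit b (equatorial c) = equatorial (if b then star c else c) := by
  have hc' : c * (starRingEnd ℂ) c = 1 := hc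
  have hc'' : (starRingEnd ℂ) c * c = 1 := by rw [mul_comm]; exact hc
  ext u u'
  cases b <;> cases u <;> cases u' <;> simp [flipBit, equatorial, hc', hc'']

theorem flipBit_single (b c : Bool) :
    flipBit b (Matrix.single c c 1) = Matrix.single (xor c b) (xor c b) (1 : ℂ) := by
  ext u u'
  cases b <;> cases c <;> cases u <;> cases u' <;> simp [flipBit, Matrix.single_apply]

/-- A sequence of phase gates and controlled flips of a qubit that computes the conjunction of two
bits up to a phase. -/
theorem flipBit_conj_and (i j : Bool) :
    conj hMat (conj tdgMat (flipBit j (conj tdgMat (conj pMat (flipBit i (conj tdgMat (flipBit j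
      (conj tdgMat (conj pMat (conj hMat (Matrix.single false false 1))))))))))) =
      Matrix.single (i && j) (i && j) 1 := by
  set z : ℂ := Complex.exp (-(Real.pi / 4 : ℝ) * Complex.I) with hz
  have hzz : z * z = -Complex.I := by
    rw [hz, ← Complex.exp_add, show -((Real.pi / 4 : ℝ) : ℂ) * Complex.I + -((Real.pi / 4 : ℝ) : ℂ) * Complex.I
      = -(Real.pi / 2 * Complex.I) by push_cast; ring, Complex.exp_neg, Complex.exp_pi_div_two_mul_I,
      Complex.inv_I]
  have hI := Complex.I_mul_I
  have hzs : star z = Complex.I * z := by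
    have h1 : star z * z = 1 := by
      rw [hz, Complex.star_def, ← Complex.exp_conj, ← Complex.exp_add]
      simp only [map_mul, map_neg, Complex.conj_ofReal, Complex.conj_I]
      ring_nf
      exact Complex.exp_zero
    have h2 : (Complex.I * z) * z = 1 := by rw [mul_assoc, hzz]; linear_combination -hI
    have h0 : z ≠ 0 := Complex.exp_ne_zero _
    exact mul_right_cancel₀ h0 (h1.trans h2.symm)
  have hIs : star Complex.I = -Complex.I := Complex.conj_I
  have hu : z * star z = 1 := by rw [hzs]; linear_combination Complex.I * hzz - hI
  -- All states between the first and the last `H` are equatorial. The phase gates multiply `c` by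
  -- `z` or its conjugate, and the flips conjugate it. The total is `1`, except for `i = j = 1`,
  -- where it is `z⁴ = -1`.
  have T : ∀ c, conj tdgMat (conj pMat (equatorial c)) = equatorial (star z * c) := fun c => by
    rw [conj_pMat_equatorial, conj_tdgMat_equatorial, ← hz, hzs]
    congr 1
    ring
  have T' : ∀ c, conj tdgMat (equatorial c) = equatorial (z * c) := fun c => by
    rw [conj_tdgMat_equatorial]
  have u1 : ∀ {c : ℂ}, c * star c = 1 → (z * c) * star (z * c) = 1 := fun {c} h => by
    rw [star_mul', mul_mul_mul_comm, hu, h, one_mul]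
  have u2 : ∀ {c : ℂ}, c * star c = 1 → (star z * c) * star (star z * c) = 1 := fun {c} h => by
    rw [star_mul', star_star, mul_mul_mul_comm, mul_comm (star z), hu, h, one_mul]
  have u3 : ∀ {c : ℂ} (b : Bool), c * star c = 1 →
      (if b then star c else c) * star (if b then star c else c) = 1 := fun {c} b h => by
    cases b
    · exact h
    · simpa [mul_comm] using h
  have h1 : (1 : ℂ) * star 1 = 1 := by simp
  rw [conj_hMat_single, T, flipBit_equatorial (u2 h1), T', flipBit_equatorial (u1 (u3 _ (u2 h1))), T,
    flipBit_equatorial (u2 (u3 _ (u1 (u3 _ (u2 h1))))), T']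
  have e : ∀ {c : ℂ}, c = 1 → conj hMat (equatorial c) = Matrix.single false false 1 := fun h => by
    rw [h, conj_hMat_equatorial_one]
  have e' : ∀ {c : ℂ}, c = -1 → conj hMat (equatorial c) = Matrix.single true true 1 := fun h => by
    rw [h, conj_hMat_equatorial_neg_one]
  cases i <;> cases j
  · refine e ?_
    simp only [Bool.false_eq_true, if_false, mul_one]
    linear_combination (z * star z + 1) * hu
  · refine e ?_
    simp only [Bool.false_eq_true, if_false, if_true, star_mul', star_star, mul_one]
    linear_combination (z * star z + 1) * hu
  · refine e ?_
    simp only [Bool.false_eq_true, if_false, if_true, star_mul', star_star, mul_one]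
    linear_combination (z * star z + 1) * hu
  · refine e' ?_
    simp only [if_true, star_mul', star_star, mul_one]
    linear_combination (z * z - Complex.I) * hzz + hI

/-! ### Simulation of the client by a quantum circuit -/

section
variable {K V : Type} [Fintype K] [DecidableEq K] [Fintype V] [DecidableEq V]

/-- A joint state as a state of the register consisting of the client's memory and the server's
wires. -/
def emb (σ : JState K V) : Op (K ⊕ V) :=
  Matrix.of fun w w' => if w ∘ Sum.inl = w' ∘ Sum.inl then
    σ (w ∘ Sum.inl) (w ∘ Sum.inr) (w' ∘ Sum.inr) else 0

/-- The memory part of an embedded state is classical: blocks between different memory contents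
vanish. -/
theorem blk_emb (σ : JState K V) (e e' : K ⊕ V → Bool) :
    blk Function.Embedding.inr e e' (emb σ) =
      if e ∘ Sum.inl = e' ∘ Sum.inl then σ (e ∘ Sum.inl) else 0 := by
  have h : ∀ (a : V → Bool) (e : K ⊕ V → Bool),
      extend (Function.Embedding.inr : V ↪ K ⊕ V) a e ∘ Sum.inl = e ∘ Sum.inl := fun a e => by
    funext i
    exact Function.extend_apply' _ _ _ fun ⟨j, hj⟩ => Sum.inr_ne_inl hj
  have h' : ∀ (a : V → Bool) (e : K ⊕ V → Bool),
      extend (Function.Embedding.inr : V ↪ K ⊕ V) a e ∘ Sum.inr = a := fun a e =>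
    extend_comp_emb Function.Embedding.inr a e
  ext a a'
  simp only [blk, emb, Matrix.of_apply, h, h']
  split_ifs <;> rfl

theorem eq_of_blk {ρ ρ' : Op (K ⊕ V)}
    (h : ∀ e e', blk Function.Embedding.inr e e' ρ = blk Function.Embedding.inr e e' ρ') : ρ = ρ' := by
  ext w w'
  have := congrFun (congrFun (h w w') (w ∘ Sum.inr)) (w' ∘ Sum.inr)
  have hw : ∀ w : K ⊕ V → Bool, extend (Function.Embedding.inr : V ↪ K ⊕ V) (w ∘ Sum.inr) w = w :=
    fun w => extend_comp_self Function.Embedding.inr w w fun _ _ => rfl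
  simpa only [blk, Matrix.of_apply, hw] using this

theorem apply_emb (g : Gate V) (σ : JState K V) :
    (g.map Function.Embedding.inr).apply (emb σ) = emb fun m => g.apply (σ m) := by
  refine eq_of_blk fun e e' => ?_
  rw [blk_apply_map, blk_emb, blk_emb]
  split_ifs
  · rfl
  · exact (isLinearMap_apply g).map_zero

theorem gate_emb (g : Gate V) {g' : Gate (K ⊕ V)} (h : g.map Function.Embedding.inr = g')
    (σ : JState K V) : g'.apply (emb σ) = emb fun m => g.apply (σ m) := by
  rw [← h, apply_emb]

theorem update_inl_comp_inl (w : K ⊕ V → Bool) (t : K) (d : Bool) :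
    update w (Sum.inl t) d ∘ Sum.inl = update (w ∘ Sum.inl) t d :=
  Function.update_comp_eq_of_injective w Sum.inl_injective t d

theorem update_inl_comp_inr (w : K ⊕ V → Bool) (t : K) (d : Bool) :
    update w (Sum.inl t) d ∘ Sum.inr = w ∘ Sum.inr := by
  funext j; simp

theorem update_inr_comp_inr (w : K ⊕ V → Bool) (q : V) (d : Bool) :
    update w (Sum.inr q) d ∘ Sum.inr = update (w ∘ Sum.inr) q d :=
  Function.update_comp_eq_of_injective w Sum.inr_injective q d

theorem update_inr_comp_inl (w : K ⊕ V → Bool) (q : V) (d : Bool) :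
    update w (Sum.inr q) d ∘ Sum.inl = w ∘ Sum.inl := by
  funext j; simp

/-- The control is a classical cell, so the CNOT is a flip conditioned on it, and the result is
again in the range of `emb`. -/
theorem cnot_emb (i : K) (q : V) (σ : JState K V) :
    conj (cnotMat (Sum.inl i) (Sum.inr q)) (emb σ) = emb fun m => flipWire q (m i) (σ m) := by
  ext w w'
  rw [conj_cnot_apply Sum.inl_ne_inr]
  simp only [emb, Matrix.of_apply, cx, update_inr_comp_inl, update_inr_comp_inr, flipWire,
    Function.comp_apply]
  split_ifs with h
  · have : w' (Sum.inl i) = w (Sum.inl i) := (congrFun h i).symm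
    rw [this]
  · rfl

/-- The removal of the coherences of wire `t`. -/
def dephase (t : V) (ρ : Op V) : Op V := Matrix.of fun w w' => if w t = w' t then ρ w w' else 0

/-- The CNOT copies `t` onto a fresh wire, and discarding the copy removes the entries whose row and
column differ at `t`: a measurement without the use of its outcome. -/
theorem runGates_dephase {t a : V} (h : t ≠ a) (ρ : Op V) :
    runGates [.reset a, .cnot t a h, .reset a] ρ = setWire a false (dephase t ρ) := by
  change setWire a false (conj (cnotMat t a) (setWire a false ρ)) = _
  ext w w'
  simp only [setWire, dephase, Matrix.of_apply, conj_cnot_apply h, cx]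
  congr 1
  by_cases hw : w t = w' t
  · cases hb : w' t <;> simp [hw, hb, h]
  · cases hb : w' t <;> cases hb' : w t <;> simp_all

/-- The gates that measure wire `q` into the cell `t`. -/
def measureGates (q b : V) (hq : q ≠ b) (t : K) : List (Gate (K ⊕ V)) :=
  [.reset (.inl t), .cnot (.inr q) (.inl t) Sum.inr_ne_inl] ++
    [.reset (.inr b), .cnot (.inl t) (.inr b) Sum.inl_ne_inr, .reset (.inr b)]

/-- The cell `t` is cleared, receives a copy of `q`, and is dephased with the help of `b`. Dephasing
makes the memory classical again, so the result is back in the range of `emb`. -/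
theorem runGates_measureGates (q b : V) (hq : q ≠ b) (t : K) (σ : JState K V) :
    runGates (measureGates q b hq t) (emb σ) = emb fun m => setWire b false (toClient q t σ m) := by
  have h2 : (emb fun m => setWire b false (toClient q t σ m)) =
      setWire (.inr b) false (emb (toClient q t σ)) :=
    (gate_emb (.reset b) (g' := .reset (.inr b)) rfl (toClient q t σ)).symm
  rw [h2, measureGates, runGates_append, runGates_dephase]
  refine congrArg (setWire (Sum.inr b) false) ?_
  ext w w'
  simp only [runGates, List.foldl_cons, List.foldl_nil, Gate.apply, dephase, Matrix.of_apply,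
    conj_cnot_apply Sum.inr_ne_inl, cx, setWire,
    Function.update_self, Function.update_idem, emb, update_inl_comp_inl, update_inl_comp_inr, toClient,
    Matrix.sum_apply, projWire, Function.comp_apply]
  by_cases hE : w ∘ Sum.inl = w' ∘ Sum.inl
  · have ht : w (Sum.inl t) = w' (Sum.inl t) := congrFun hE t
    rw [if_pos hE, if_pos ht]
    simp only [hE, ht, if_true]
    cases w (Sum.inr q) <;> cases w' (Sum.inr q) <;> cases w' (Sum.inl t) <;> simp
  · rw [if_neg hE]
    split_ifs with h3 h4
    · refine Finset.sum_eq_zero fun d _ => if_neg fun h5 => hE ?_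
      funext i
      by_cases hi : i = t
      · subst hi; exact h3
      · have := congrFun h5 i
        simpa [hi] using this
    · rfl
    · rfl

/-- An assignment is written as a sum over the lost old value `d` of the cell with weights `0` or
`1`. A measurement of an auxiliary qubit into the cell produces this form. -/
theorem pushMem_update (f : (K → Bool) → Bool) (t : K) (σ : JState K V) :
    pushMem (fun m => update m t (f m)) σ = fun m =>
      ∑ d : Bool, (if f (update m t d) = m t then (1 : ℂ) else 0) • σ (update m t d) := by
  funext m
  simp only [pushMem, ite_smul, one_smul, zero_smul]
  have h : ∀ m' : K → Bool, (if update m' t (f m') = m then σ m' else 0) =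
      ∑ d : Bool, if update m t d = m' then (if f m' = m t then σ m' else 0) else 0 := by
    intro m'
    rw [Finset.sum_eq_single (m' t)]
    rotate_left
    · intro d _ hd
      rw [if_neg]
      intro e
      apply hd
      rw [← e]
      simp
    · simp
    by_cases h1 : update m t (m' t) = m'
    · rw [if_pos h1]
      congr 1
      apply propext
      rw [← h1]
      constructor
      · intro e; have := congrFun e t; simpa using this
      · intro e; rw [e]; simp
    · rw [if_neg h1, if_neg]
      intro e
      apply h1
      rw [← e]
      simp
  simp only [h]
  rw [Finset.sum_comm]
  simp

end

/-! ### Simulation of the client's steps with two auxiliary wires -/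

section
variable {K V : Type} [Fintype K] [DecidableEq K] [Fintype V] [DecidableEq V]

/-- The state of the wires without the two auxiliary ones. -/
def main (τ : JState K (V ⊕ Bool)) : JState K V := fun m => extract Function.Embedding.inl (τ m)

theorem inl_ne_aux (b : Bool) (j : V) : (Function.Embedding.inl : V ↪ V ⊕ Bool) j ≠ Sum.inr b :=
  Sum.inl_ne_inr

theorem main_toClient (q : V) (t : K) (τ : JState K (V ⊕ Bool)) :
    main (fun m => setWire (Sum.inr true) false (toClient (Sum.inl q) t τ m)) =
      toClient q t (main τ) := by
  funext m
  simp only [main, extract_setWire_of_notMem _ (inl_ne_aux true), toClient,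
    (isLinearMap_extract _).map_fsum]
  exact Finset.sum_congr rfl fun d _ => extract_projWire Function.Embedding.inl q (m t) _

theorem main_toClient_aux (t : K) (ω : (K → Bool) → Matrix Bool Bool ℂ) (τ : JState K (V ⊕ Bool)) :
    main (fun m => setWire (Sum.inr true) false
      (toClient (Sum.inr false) t (fun m => replaceWire (Sum.inr false) (ω m) (τ m)) m)) =
      fun m => ∑ d, (ω (update m t d) (m t) (m t)) • main τ (update m t d) := by
  funext m
  simp only [main, extract_setWire_of_notMem _ (inl_ne_aux true), toClient,
    (isLinearMap_extract _).map_fsum, extract_projWire_replaceWire _ (inl_ne_aux false)]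

/-- A local step is simulated by preparing on an auxiliary wire a qubit whose diagonal is the
distribution of the new bit, given the old memory, and measuring it into `t`. Since `t` is
overwritten only at the end, it may be among the inputs of the step. -/
theorem exists_gates_of_aux {l : List (Gate (K ⊕ (V ⊕ Bool)))} {ω : (K → Bool) → Matrix Bool Bool ℂ}
    (hl : ∀ τ : JState K (V ⊕ Bool),
      runGates l (emb τ) = emb fun m => replaceWire (Sum.inr false) (ω m) (τ m)) (hlen : l.length ≤ 20)
    (t : K) {c : CLocal K} (hc : ∀ σ : JState K V, c.apply σ = fun m =>
      ∑ d, (ω (update m t d) (m t) (m t)) • σ (update m t d)) :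
    ∃ l : List (Gate (K ⊕ (V ⊕ Bool))), l.length ≤ 25 ∧
      ∀ τ : JState K (V ⊕ Bool), ∃ τ', runGates l (emb τ) = emb τ' ∧ main τ' = c.apply (main τ) :=
  ⟨l ++ measureGates (Sum.inr false) (Sum.inr true) (by simp) t,
    by rw [List.length_append]; simpa [measureGates] using hlen,
    fun τ => ⟨_, by rw [runGates_append, hl, runGates_measureGates], (main_toClient_aux t ω τ).trans
      (hc _).symm⟩⟩

/-- Gates on the auxiliary wire. -/
theorem runGates_aux_append {l : List (Gate (K ⊕ (V ⊕ Bool)))} {ω : (K → Bool) → Matrix Bool Bool ℂ}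
    (hl : ∀ τ : JState K (V ⊕ Bool),
      runGates l (emb τ) = emb fun m => replaceWire (Sum.inr false) (ω m) (τ m))
    {g : Gate (K ⊕ (V ⊕ Bool))} {ω' : (K → Bool) → Matrix Bool Bool ℂ}
    (hg : ∀ τ : JState K (V ⊕ Bool), g.apply (emb fun m => replaceWire (Sum.inr false) (ω m) (τ m)) =
      emb fun m => replaceWire (Sum.inr false) (ω' m) (τ m)) :
    ∀ τ : JState K (V ⊕ Bool),
      runGates (l ++ [g]) (emb τ) = emb fun m => replaceWire (Sum.inr false) (ω' m) (τ m) := fun τ => by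
  rw [runGates_append, hl]
  exact hg τ

theorem aux_h (ω : (K → Bool) → Matrix Bool Bool ℂ) (τ : JState K (V ⊕ Bool)) :
    (Gate.h (.inr (.inr false) : K ⊕ (V ⊕ Bool))).apply (emb fun m => replaceWire (Sum.inr false) (ω m) (τ m)) =
      emb fun m => replaceWire (Sum.inr false) (conj hMat (ω m)) (τ m) := by
  rw [gate_emb (V := V ⊕ Bool) (.h (.inr false)) (g' := .h (.inr (.inr false))) rfl]
  simp only [Gate.apply, conj_onWire_replaceWire]

theorem aux_p (ω : (K → Bool) → Matrix Bool Bool ℂ) (τ : JState K (V ⊕ Bool)) :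
    (Gate.p (.inr (.inr false) : K ⊕ (V ⊕ Bool))).apply (emb fun m => replaceWire (Sum.inr false) (ω m) (τ m)) =
      emb fun m => replaceWire (Sum.inr false) (conj pMat (ω m)) (τ m) := by
  rw [gate_emb (V := V ⊕ Bool) (.p (.inr false)) (g' := .p (.inr (.inr false))) rfl]
  simp only [Gate.apply, conj_onWire_replaceWire]

theorem aux_tdg (ω : (K → Bool) → Matrix Bool Bool ℂ) (τ : JState K (V ⊕ Bool)) :
    (Gate.tdg (.inr (.inr false) : K ⊕ (V ⊕ Bool))).apply (emb fun m => replaceWire (Sum.inr false) (ω m) (τ m)) =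
      emb fun m => replaceWire (Sum.inr false) (conj tdgMat (ω m)) (τ m) := by
  rw [gate_emb (V := V ⊕ Bool) (.tdg (.inr false)) (g' := .tdg (.inr (.inr false))) rfl]
  simp only [Gate.apply, conj_onWire_replaceWire]

theorem aux_cnot (i : K) (ω : (K → Bool) → Matrix Bool Bool ℂ) (τ : JState K (V ⊕ Bool)) :
    (Gate.cnot (.inl i) (.inr (.inr false)) Sum.inl_ne_inr : Gate (K ⊕ (V ⊕ Bool))).apply
        (emb fun m => replaceWire (Sum.inr false) (ω m) (τ m)) =
      emb fun m => replaceWire (Sum.inr false) (flipBit (m i) (ω m)) (τ m) := by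
  simp only [Gate.apply, cnot_emb, flipWire_replaceWire]

theorem aux_reset (τ : JState K (V ⊕ Bool)) :
    runGates [.reset (.inr (.inr false))] (emb τ) =
      emb fun m => replaceWire (Sum.inr false) (Matrix.single false false 1) (τ m) := by
  change (Gate.reset (.inr (.inr false) : K ⊕ (V ⊕ Bool))).apply (emb τ) = _
  rw [gate_emb (V := V ⊕ Bool) (.reset (.inr false)) (g' := .reset (.inr (.inr false))) rfl]
  simp only [Gate.apply, setWire_eq_replaceWire]

theorem conj_not (b : Bool) : conj hMat (conj pMat (conj pMat (conj hMat (Matrix.single b b 1)))) =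
    Matrix.single (!b) (!b) 1 := by
  have hX : hMat * (pMat * (pMat * hMat)) = Matrix.of fun a b => if a = !b then 1 else 0 := by
    have h2 : (Real.sqrt 2 : ℂ) * Real.sqrt 2 = 2 := by
      rw [← Complex.ofReal_mul, Real.mul_self_sqrt (by norm_num)]; norm_num
    have h0 : (Real.sqrt 2 : ℂ) ≠ 0 := fun h => by rw [h] at h2; norm_num at h2
    ext a b
    cases a <;> cases b <;>
      simp [hMat, pMat, Matrix.mul_apply, Matrix.diagonal_apply] <;> field_simp <;>
      simp [pow_two, h2, Complex.I_mul_I] <;> norm_num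
  rw [← conj_mul, ← conj_mul, ← conj_mul, Matrix.mul_assoc, Matrix.mul_assoc, hX]
  ext u u'
  cases b <;> cases u <;> cases u' <;> simp [conj, Matrix.mul_apply, Matrix.single_apply]

/-- The gates that set the auxiliary wire to the NAND of two cells. -/
def nandGates (i j : K) : List (Gate (K ⊕ (V ⊕ Bool))) :=
  let A : K ⊕ (V ⊕ Bool) := .inr (.inr false)
  -- The first twelve gates produce the conjunction (`flipBit_conj_and`); the last four, `H P P H =
  -- X`, negate it.
  [.reset A, .h A, .p A, .tdg A, .cnot (.inl j) A Sum.inl_ne_inr, .tdg A, .cnot (.inl i) A Sum.inl_ne_inr,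
    .p A, .tdg A, .cnot (.inl j) A Sum.inl_ne_inr, .tdg A, .h A, .h A, .p A, .p A, .h A]

theorem runGates_nandGates (i j : K) (τ : JState K (V ⊕ Bool)) :
    runGates (nandGates i j) (emb τ) = emb fun m =>
      replaceWire (Sum.inr false) (Matrix.single (!(m i && m j)) (!(m i && m j)) 1) (τ m) := by
  have h := aux_reset (K := K) (V := V)
  replace h := runGates_aux_append h (aux_h _)
  replace h := runGates_aux_append h (aux_p _)
  replace h := runGates_aux_append h (aux_tdg _)
  replace h := runGates_aux_append h (aux_cnot j _)
  replace h := runGates_aux_append h (aux_tdg _)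
  replace h := runGates_aux_append h (aux_cnot i _)
  replace h := runGates_aux_append h (aux_p _)
  replace h := runGates_aux_append h (aux_tdg _)
  replace h := runGates_aux_append h (aux_cnot j _)
  replace h := runGates_aux_append h (aux_tdg _)
  replace h := runGates_aux_append h (aux_h _)
  replace h := runGates_aux_append h (aux_h _)
  replace h := runGates_aux_append h (aux_p _)
  replace h := runGates_aux_append h (aux_p _)
  replace h := runGates_aux_append h (aux_h _)
  replace h := h τ
  simp only [flipBit_conj_and, conj_not] at h
  exact h

theorem exists_clocal_gates (c : CLocal K) : ∃ l : List (Gate (K ⊕ (V ⊕ Bool))), l.length ≤ 25 ∧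
    ∀ τ : JState K (V ⊕ Bool), ∃ τ', runGates l (emb τ) = emb τ' ∧ main τ' = c.apply (main τ) := by
  have det : ∀ (f : (K → Bool) → Bool) (t : K) (σ : JState K V),
      pushMem (fun m => update m t (f m)) σ = fun m => ∑ d : Bool,
        (Matrix.single (f (update m t d)) (f (update m t d)) (1 : ℂ) (m t) (m t)) •
          σ (update m t d) := fun f t σ => by
    rw [pushMem_update]
    simp only [Matrix.single_apply, and_self]
  cases c with
  | const t b =>
    cases b
    · exact exists_gates_of_aux aux_reset (by simp) t (det (fun _ => false) t)
    -- The bit `1` is obtained from `0` by `X = H P P H`. In the `coin` case below, the measured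
    -- qubit is `|+⟩`.
    · refine exists_gates_of_aux (l := [.reset (.inr (.inr false)), .h (.inr (.inr false)),
        .p (.inr (.inr false)), .p (.inr (.inr false)), .h (.inr (.inr false))])
        (ω := fun _ => Matrix.single true true 1) (fun τ => ?_) (by simp) t
        (det (fun _ => true) t)
      have h := runGates_aux_append (runGates_aux_append (runGates_aux_append
        (runGates_aux_append aux_reset (aux_h _)) (aux_p _)) (aux_p _)) (aux_h _) τ
      simp only [conj_not, Bool.not_false] at h
      exact h
  | nand i j t =>
    exact exists_gates_of_aux (runGates_nandGates i j) (by simp [nandGates]) t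
      (det (fun m => !(m i && m j)) t)
  | coin t =>
    refine exists_gates_of_aux (runGates_aux_append aux_reset (aux_h _)) (by simp) t fun σ => ?_
    funext m
    refine Finset.smul_sum.trans ?_
    refine Finset.sum_congr rfl fun d _ => ?_
    rw [conj_hMat_single]
    cases m t <;> simp [equatorial]

/-- The joint computation of the client and the server as a quantum circuit. -/
theorem exists_simulation (cs : List (CInstr K)) (ss : List (SInstr V)) :
    ∃ l : List (Gate (K ⊕ (V ⊕ Bool))), l.length ≤ 25 * (cs.length + ss.length) ∧
      ∀ τ : JState K (V ⊕ Bool), ∃ τ', runGates l (emb τ) = emb τ' ∧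
        main τ' = interact cs ss (main τ) := by
  -- One step of the interaction costs at most 25 gates: at most 20 to prepare the auxiliary qubit
  -- and 5 to measure it.
  have step : ∀ {cs cs' : List (CInstr K)} {ss ss' : List (SInstr V)}
      {F : JState K V → JState K V} {l : List (Gate (K ⊕ (V ⊕ Bool)))}, l.length ≤ 25 →
      cs.length + ss.length < cs'.length + ss'.length →
      (∀ τ : JState K (V ⊕ Bool), ∃ τ', runGates l (emb τ) = emb τ' ∧ main τ' = F (main τ)) →
      (∀ σ, interact cs' ss' σ = interact cs ss (F σ)) →
      (∃ l : List (Gate (K ⊕ (V ⊕ Bool))), l.length ≤ 25 * (cs.length + ss.length) ∧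
        ∀ τ : JState K (V ⊕ Bool), ∃ τ', runGates l (emb τ) = emb τ' ∧
          main τ' = interact cs ss (main τ)) →
      ∃ l : List (Gate (K ⊕ (V ⊕ Bool))), l.length ≤ 25 * (cs'.length + ss'.length) ∧
        ∀ τ : JState K (V ⊕ Bool), ∃ τ', runGates l (emb τ) = emb τ' ∧
          main τ' = interact cs' ss' (main τ) := by
    rintro cs cs' ss ss' F l hl hlen hF hi ⟨l', hl', h'⟩
    refine ⟨l ++ l', by rw [List.length_append]; omega, fun τ => ?_⟩
    obtain ⟨τ', h1, h2⟩ := hF τ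
    obtain ⟨τ'', h3, h4⟩ := h' τ'
    exact ⟨τ'', by rw [runGates_append, h1, h3], by rw [h4, h2, hi]⟩
  induction cs, ss using interact_induction with
  | nil => exact ⟨[], by simp, fun τ => ⟨τ, rfl, by rw [interact_nil_nil]⟩⟩
  | gate cs g ss ih =>
    refine step (l := [(g.map Function.Embedding.inl).map Function.Embedding.inr]) (by simp) (by simp)
      (fun τ => ⟨_, apply_emb (g.map Function.Embedding.inl) τ, ?_⟩) (interact_gate cs g ss) ih
    funext m
    exact extract_apply_map Function.Embedding.inl g _
  | nil_comm q ss ih =>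
    exact step (l := []) (F := id) (by simp) (by simp) (fun τ => ⟨τ, rfl, rfl⟩) (interact_nil_comm q ss) ih
  | loc c cs ss ih =>
    obtain ⟨l, hl, h⟩ := exists_clocal_gates (V := V) c
    exact step hl (by simp) h (interact_loc c cs ss) ih
  | send_comm i q cs ss ih =>
    refine step (l := [.reset (.inr (.inl q)), .cnot (.inl i) (.inr (.inl q)) Sum.inl_ne_inr]) (by simp)
      (by simp; omega)
      (fun τ => ⟨fun m => flipWire (Sum.inl q) (m i) (setWire (Sum.inl q) false (τ m)), ?_, ?_⟩)
      (interact_send_comm i q cs ss) ih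
    · refine Eq.trans ?_ (cnot_emb i (Sum.inl q) _)
      exact congrArg (conj _) (gate_emb (.reset (.inl q)) (g' := .reset (.inr (.inl q))) rfl τ)
    · funext m
      have h1 : flipWire (Sum.inl q) (m i) (setWire (Sum.inl q) false (τ m)) =
          setWire (Function.Embedding.inl q) (m i) (τ m) := by
        rw [setWire_eq_replaceWire, flipWire_replaceWire, flipBit_single, setWire_eq_replaceWire]
        simp
      change extract _ (flipWire (Sum.inl q) (m i) (setWire (Sum.inl q) false (τ m))) = _
      rw [h1, extract_setWire]
      rfl
  | recv_comm i q cs ss ih =>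
    exact step (l := measureGates (.inl q) (.inr true) Sum.inl_ne_inr i) (by simp [measureGates])
      (by simp; omega) (fun τ => ⟨_, runGates_measureGates _ _ _ _ _, main_toClient q i τ⟩)
      (interact_recv_comm i q cs ss) ih
  | send_nil i cs ih =>
    exact step (l := []) (F := id) (by simp) (by simp) (fun τ => ⟨τ, rfl, rfl⟩) (interact_send_nil i cs) ih
  | recv_nil i cs ih =>
    obtain ⟨l, hl, h⟩ := exists_clocal_gates (V := V) (CLocal.const i false)
    exact step hl (by simp) h (interact_recv_nil i cs) ih

end

/-! ### The effect of an interaction on the server -/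

section
variable {K A W : Type} [Fintype K] [DecidableEq K] [Fintype A] [DecidableEq A] [Fintype W]
  [DecidableEq W]

/-- The state of the server, irrespective of the client's memory. -/
def marg (σ : JState K W) : Op W := ∑ m, σ m

theorem isLinearMap_marg : IsLinearMap ℂ (marg : JState K W → Op W) :=
  ⟨fun _ _ => Finset.sum_add_distrib, fun _ _ => by simp [marg, Finset.smul_sum]⟩

theorem isLinearMap_initState (m₀ : K → Bool) : IsLinearMap ℂ (initState m₀ : Op W → JState K W) :=
  Template.isLinearMap_initState m₀

/-- The operation on the server's state implemented by an interaction with a client that starts with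
memory `μ`. -/
def serverMap (cs : List (CInstr K)) (ss : List (SInstr W)) (μ : K → Bool) (ρ : Op W) : Op W :=
  marg (interact cs ss (initState μ ρ))

theorem isLinearMap_serverMap (cs : List (CInstr K)) (ss : List (SInstr W)) (μ : K → Bool) :
    IsLinearMap ℂ (serverMap cs ss μ) :=
  isLinearMap_marg.compose ((isLinearMap_interact cs ss).compose (isLinearMap_initState μ))

theorem map_initState {Φ : Op W → Op A} (hΦ : IsLinearMap ℂ Φ) (μ : K → Bool) (ρ : Op W) :
    (fun m => Φ (initState μ ρ m)) = initState μ (Φ ρ) := by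
  funext m
  by_cases h : m = μ <;> simp [initState, h, hΦ.map_zero]

theorem extract_serverMap (f : A ↪ W) (cs : List (CInstr K)) (ss : List (SInstr A)) (μ : K → Bool)
    (ρ : Op W) :
    extract f (serverMap cs (ss.map (SInstr.map f)) μ ρ) = serverMap cs ss μ (extract f ρ) := by
  rw [serverMap, serverMap, marg, (isLinearMap_extract f).map_fsum, marg,
    ← map_initState (isLinearMap_extract f), ← interact_extract]

theorem blk_serverMap (f : A ↪ W) (e e' : W → Bool) (cs : List (CInstr K)) (ss : List (SInstr A))
    (μ : K → Bool) (ρ : Op W) :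
    blk f e e' (serverMap cs (ss.map (SInstr.map f)) μ ρ) = serverMap cs ss μ (blk f e e' ρ) := by
  rw [serverMap, serverMap, marg, (isLinearMap_blk f e e').map_fsum, marg,
    ← map_initState (isLinearMap_blk f e e'), ← interact_blk_server]

theorem probZero_eq (q : W) (σ : JState K W) : probZero q σ = (projWire q false (marg σ)).trace.re := by
  rw [marg, (isLinearMap_projWire q false).map_fsum, isLinearMap_trace.map_fsum, Complex.re_sum]
  rfl

/-- Relabelling the wires or adding idle ones does not change an adversary's output distribution.
This allows the reduction to be built on a structured wire set and renumbered at the end. -/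
theorem probZero_map (f : A ↪ W) (q : A) (cs : List (CInstr K)) (ss : List (SInstr A)) (μ : K → Bool) :
    probZero (f q) (interact cs (ss.map (SInstr.map f)) (initState μ zeroState)) =
      probZero q (interact cs ss (initState μ zeroState)) := by
  have h := extract_serverMap f cs ss μ zeroState
  rw [extract_zeroState] at h
  rw [probZero_eq, probZero_eq]
  change (projWire (f q) false (serverMap cs (ss.map (SInstr.map f)) μ zeroState)).trace.re =
    (projWire q false (serverMap cs ss μ zeroState)).trace.re
  rw [← h, ← extract_projWire, trace_extract]

/-- Once the server's program is exhausted, the client's remaining steps change only its memory, so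
trailing gates may be applied after the whole interaction. -/
theorem interact_append_gates (cs : List (CInstr K)) (ss : List (SInstr W)) (l : List (Gate W))
    (σ : JState K W) :
    interact cs (ss ++ l.map .gate) σ = fun m => runGates l (interact cs ss σ m) := by
  have h0 : ∀ (cs : List (CInstr K)) (σ : JState K W),
      interact cs (l.map .gate) σ = fun m => runGates l (interact cs [] σ m) := by
    intro cs σ
    have h1 := interact_gates_append l cs [] σ
    rw [List.append_nil] at h1
    rw [h1]
    have hL := isLinearMap_runGates l
    induction cs generalizing σ with
    | nil => rw [interact_nil_nil, interact_nil_nil]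
    | cons c cs ih =>
      have ih' := fun σ => ih σ (by
        have := interact_gates_append l cs [] σ
        rwa [List.append_nil] at this)
      cases c with
      | loc c => rw [interact_loc, interact_loc, ← ih', clocal_map hL]
      | send i => rw [interact_send_nil, interact_send_nil, ← ih']
      | recv i => rw [interact_recv_nil, interact_recv_nil, ← ih', clocal_map hL]
  induction cs, ss using interact_induction generalizing σ with
  | nil => exact h0 [] σ
  | gate cs g ss ih => rw [List.cons_append, interact_gate, interact_gate, ih]
  | nil_comm q ss ih => rw [List.cons_append, interact_nil_comm, interact_nil_comm, ih]
  | loc c cs ss ih => rw [interact_loc, interact_loc, ih]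
  | send_comm i q cs ss ih => rw [List.cons_append, interact_send_comm, interact_send_comm, ih]
  | recv_comm i q cs ss ih => rw [List.cons_append, interact_recv_comm, interact_recv_comm, ih]
  | send_nil i cs ih => exact h0 (.send i :: cs) σ
  | recv_nil i cs ih => exact h0 (.recv i :: cs) σ

theorem marg_interact_append_gates (cs : List (CInstr K)) (ss : List (SInstr W)) (l : List (Gate W))
    (σ : JState K W) :
    marg (interact cs (ss ++ l.map .gate) σ) = runGates l (marg (interact cs ss σ)) := by
  rw [interact_append_gates, marg, marg, (isLinearMap_runGates l).map_fsum]

end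

/-! ### The reduction -/

theorem extract_load_self {A W : Type} [Fintype A] [DecidableEq A] [Fintype W] [DecidableEq W]
    (f : A ↪ W) (d : W → Bool) (ρ : Op A) : extract f (load f d ρ) = ρ := by
  have hd : ∀ (u : A → Bool) (w : W → Bool) i, (∀ j, f j ≠ i) → extend f u w i = w i := fun u w i hi =>
    Function.extend_apply' _ _ _ fun ⟨j, hj⟩ => hi j hj
  ext u u'
  rw [extract_apply, Finset.sum_eq_single (extend f u d)]
  · simp only [extend_comp_emb, if_true, load, Matrix.of_apply]
    exact if_pos fun i hi => ⟨hd _ _ i hi, (hd _ _ i hi).trans (hd _ _ i hi)⟩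
  · intro w _ hw
    by_cases h : w ∘ f = u
    · rw [if_pos h, load, Matrix.of_apply, if_neg]
      intro h'
      apply hw
      rw [← h]
      exact (extend_comp_self f w d fun i hi => (h' i hi).1).symm
    · rw [if_neg h]
  · simp

section
variable {K V : Type} [Fintype K] [DecidableEq K] [Fintype V] [DecidableEq V]

/-- The simulation starts in the range of `emb`, on which `exists_simulation` is stated. -/
theorem zeroState_eq_emb : (zeroState : Op (K ⊕ V)) = emb (initState (fun _ => false) zeroState) := by
  ext w w'
  simp only [emb, Matrix.of_apply, zeroState, initState, Matrix.single_apply]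
  have h : ∀ w : K ⊕ V → Bool, (fun _ => false) = w ↔
      w ∘ Sum.inl = (fun _ => false) ∧ (fun _ => false) = w ∘ Sum.inr := by
    intro w
    constructor
    · rintro rfl; exact ⟨rfl, rfl⟩
    · rintro ⟨h1, h2⟩
      funext i
      cases i with
      | inl i => exact (congrFun h1 i).symm
      | inr i => exact congrFun h2 i
  by_cases h1 : w ∘ Sum.inl = w' ∘ Sum.inl
  · rw [if_pos h1]
    by_cases h2 : w ∘ Sum.inl = fun _ => false
    · rw [if_pos h2, Matrix.single_apply]
      congr 1
      rw [h w, h w', ← h1]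
      simp only [h2, true_and]
    · rw [if_neg h2, if_neg]
      · rfl
      · rintro ⟨h3, _⟩; exact h2 ((h w).1 h3).1
  · rw [if_neg h1, if_neg]
    rintro ⟨h3, h4⟩
    rw [← h3, ← h4] at h1
    exact h1 rfl

theorem main_initState (μ : K → Bool) (ρ : Op (V ⊕ Bool)) :
    main (initState μ ρ) = initState μ (extract Function.Embedding.inl ρ) :=
  map_initState (isLinearMap_extract _) μ ρ

theorem trace_projWire_emb (o : K) (σ : JState K V) :
    (projWire (Sum.inl o) false (emb σ)).trace =
      ∑ m, if m o = false then (σ m).trace else 0 := by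
  simp only [Matrix.trace, Matrix.diag_apply, projWire, Matrix.of_apply, emb, if_true, and_self]
  rw [← (Equiv.sumArrowEquivProdArrow K V Bool).symm.sum_comp, Fintype.sum_prod_type]
  refine Finset.sum_congr rfl fun m _ => ?_
  have h : ∀ u : V → Bool, (Equiv.sumArrowEquivProdArrow K V Bool).symm (m, u) ∘ Sum.inl = m :=
    fun u => rfl
  have h' : ∀ u : V → Bool, (Equiv.sumArrowEquivProdArrow K V Bool).symm (m, u) ∘ Sum.inr = u :=
    fun u => rfl
  have h'' : ∀ u : V → Bool, (Equiv.sumArrowEquivProdArrow K V Bool).symm (m, u) (Sum.inl o) = m o :=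
    fun u => rfl
  simp only [h, h', h'', Finset.sum_ite_irrel, Finset.sum_const_zero]

/-- The memory is set to `μ`. -/
def loadMem (μ : K → Bool) : List (CLocal K) := Finset.univ.toList.map fun j => .const j (μ j)

theorem locals_loadMem (μ : K → Bool) (ρ : Op V) (m₀ : K → Bool) :
    locals (loadMem μ) (initState m₀ ρ) = initState μ ρ := by
  have h1 : ∀ (l : List K) (m₀ : K → Bool), locals (l.map fun j => .const j (μ j)) (initState m₀ ρ) =
      initState (fun i => if i ∈ l then μ i else m₀ i) ρ := by
    intro l
    induction l with
    | nil => intro m₀; simp [locals]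
    | cons j l ih =>
      intro m₀
      have h2 : (CLocal.const j (μ j)).apply (initState m₀ ρ) = initState (update m₀ j (μ j)) ρ := by
        funext m
        simp only [CLocal.apply, pushMem, initState]
        rw [Finset.sum_eq_single m₀]
        · simp [eq_comm]
        · intro b _ hb; simp [hb]
        · simp
      change locals (l.map fun j => .const j (μ j)) ((CLocal.const j (μ j)).apply (initState m₀ ρ)) = _
      rw [h2, ih]
      congr 1
      funext i
      by_cases hi : i ∈ l
      · simp [hi]
      · by_cases hij : i = j
        · subst hij; simp
        · simp [hi, hij]
  rw [loadMem, h1]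
  simp

end

section
variable {W : Type} [Fintype W] [DecidableEq W]

theorem eq_load_blk (ρ : Op (W ⊕ Unit)) : projWire (Sum.inr ()) true ρ =
    load Function.Embedding.inl (fun _ => true)
      (blk Function.Embedding.inl (fun _ => true) (fun _ => true) ρ) := by
  ext w w'
  have h0 : ∀ w : W ⊕ Unit → Bool, w (Sum.inr ()) = true →
      extend (Function.Embedding.inl : W ↪ W ⊕ Unit) (w ∘ Function.Embedding.inl) (fun _ => true) = w := by
    intro w hw
    refine extend_comp_self _ _ _ fun i hi => ?_
    cases i with
    | inl j => exact absurd rfl (hi j)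
    | inr u => exact hw
  simp only [projWire, load, Matrix.of_apply, blk]
  by_cases h : w (Sum.inr ()) = true ∧ w' (Sum.inr ()) = true
  · rw [if_pos h, if_pos, h0 w h.1, h0 w' h.2]
    intro i hi
    cases i with
    | inl j => exact absurd rfl (hi j)
    | inr u => exact h
  · rw [if_neg h, if_neg]
    exact fun h' => h (h' (Sum.inr ()) fun j => Sum.inl_ne_inr)

theorem trace_projWire_flag (ρ : Op (W ⊕ Unit)) : (projWire (Sum.inr ()) true ρ).trace =
    (blk Function.Embedding.inl (fun _ => true) (fun _ => true) ρ).trace := by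
  rw [eq_load_blk, trace_load]

/-- A flag wire set to `c` selects: its block at value `1` is the whole remaining state if `c = 1`
and nothing otherwise. -/
theorem blk_setWire_flag (c : Bool) (ρ : Op (W ⊕ Unit)) :
    blk Function.Embedding.inl (fun _ => true) (fun _ => true) (setWire (Sum.inr ()) c ρ) =
      if c then extract Function.Embedding.inl ρ else 0 := by
  have he : ∀ a : W → Bool, extend (Function.Embedding.inl : W ↪ W ⊕ Unit) a (fun _ => true) (Sum.inr ()) =
      true := fun a => Function.extend_apply' _ _ _ fun ⟨j, hj⟩ => Sum.inl_ne_inr hj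
  cases c
  · ext a a'
    simp [blk, setWire]
  · have h1 : projWire (Sum.inr ()) true (setWire (Sum.inr ()) true ρ) = setWire (Sum.inr ()) true ρ := by
      ext w w'
      simp only [projWire, setWire, Matrix.of_apply]
      split_ifs <;> rfl
    have h2 := congrArg (extract (Function.Embedding.inl : W ↪ W ⊕ Unit)) (eq_load_blk (setWire (Sum.inr ()) true ρ))
    rw [h1, extract_load_self, extract_setWire_of_notMem _ fun j => Sum.inl_ne_inr] at h2
    rw [if_pos rfl, h2]

end

section
variable {K W : Type} [Fintype K] [DecidableEq K] [Fintype W] [DecidableEq W]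

/-- The client receives two bits and computes whether the first one is `0` and the second one is `1`. -/
theorem sum_trace_final (o₁ o₂ : K) (ho : o₁ ≠ o₂) (p q : W) (σ : JState K W) :
    (∑ m, if m o₁ = false then
      (interact [.recv o₁, .recv o₂, .loc (.nand o₁ o₁ o₁), .loc (.nand o₁ o₂ o₁)] [.comm p, .comm q] σ
        m).trace else 0) = ∑ m, (projWire q true (projWire p false (σ m))).trace := by
  simp only [interact_recv_comm, interact_loc, interact_nil_nil, CLocal.apply]
  have hG : ∀ (p : Prop) [Decidable p], IsLinearMap ℂ fun ρ : Op W => if p then ρ.trace else 0 :=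
    fun p _ => isLinearMap_ite p isLinearMap_trace
  refine (sum_pushMem _ _ (G := fun m ρ => if m o₁ = false then ρ.trace else 0) fun _ => hG _).trans ?_
  refine (sum_pushMem _ _ (G := fun m ρ => if update m o₁ (!(m o₁ && m o₂)) o₁ = false then ρ.trace else 0)
    fun _ => hG _).trans ?_
  simp only [Function.update_self, Function.update_of_ne ho.symm]
  refine (sum_toClient _ _ _ (G := fun m ρ => if (!((!(m o₁ && m o₁)) && m o₂)) = false then ρ.trace else 0)
    fun _ => hG _).trans ?_
  refine (sum_toClient _ _ _ (G := fun m ρ => ∑ b, if (!((!((update m o₂ b) o₁ && (update m o₂ b) o₁)) &&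
    (update m o₂ b) o₂)) = false then (projWire q b ρ).trace else 0) fun m => ?_).trans ?_
  · constructor
    · intro x y
      simp only [← Finset.sum_add_distrib, (isLinearMap_projWire q _).map_add, Matrix.trace_add]
      exact Finset.sum_congr rfl fun b _ => by split_ifs <;> simp
    · intro c x
      simp only [(isLinearMap_projWire q _).map_smul, Matrix.trace_smul, Finset.smul_sum, smul_ite, smul_zero]
  · refine Finset.sum_congr rfl fun m _ => ?_
    simp [ho]

/-- A receiver that simulates the client and the server before and after an execution of an OSP
protocol, and outputs `0` if the bit in cell `b` was `1` and the server outputs `0`. -/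
theorem exists_reduction (cs₁ cs₃ : List (CInstr K)) (ss₁ ss₂ ss₃ : List (SInstr W)) (b o₁ o₂ : K)
    (ho : o₁ ≠ o₂) (out : W) (m₁ : K → Bool) :
    ∃ A : Adversary, A.size ≤ 210 + 26 * (Fintype.card K + Fintype.card W + cs₁.length + cs₃.length +
        ss₁.length + ss₂.length + ss₃.length) ∧
      ∀ {k : ℕ} (C : List (CInstr (Fin k))) (μ : Fin k → Bool),
        A.prob C μ = probZero out (interact cs₃ ss₃ fun m => serverMap C ss₂ μ
          (if m b then interact cs₁ ss₁ (initState m₁ zeroState) m else 0)) := by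
  -- Three extensions of the adversary's wires: by a flag that stores the bit `b`, by the two
  -- auxiliary wires of the simulation, and by the simulated client's memory.
  let ι : W ↪ W ⊕ Unit := Function.Embedding.inl
  let κ : W ⊕ Unit ↪ (W ⊕ Unit) ⊕ Bool := Function.Embedding.inl
  let Z := K ⊕ ((W ⊕ Unit) ⊕ Bool)
  let ζ : (W ⊕ Unit) ⊕ Bool ↪ Z := Function.Embedding.inr
  let e : Z ≃ Fin (Fintype.card Z) := Fintype.equivFin Z
  -- The initial memory `m₁`, which contains the client's input, is hard-wired; parties are
  -- non-uniform.
  obtain ⟨l₁, hl₁, h₁⟩ := exists_simulation ((loadMem m₁).map .loc ++ cs₁) (ss₁.map (SInstr.map ι))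
  obtain ⟨l₂, hl₂, h₂⟩ := exists_simulation [.send b] [SInstr.comm (Sum.inr () : W ⊕ Unit)]
  obtain ⟨l₃, hl₃, h₃⟩ := exists_simulation cs₃ (ss₃.map (SInstr.map ι))
  obtain ⟨l₄, hl₄, h₄⟩ := exists_simulation
    [.recv o₁, .recv o₂, .loc (.nand o₁ o₁ o₁), .loc (.nand o₁ o₂ o₁)]
    [SInstr.comm (ι out), SInstr.comm (Sum.inr () : W ⊕ Unit)]
  let prog : List (SInstr Z) := (l₁ ++ l₂).map .gate ++
    (((ss₂.map (SInstr.map ι)).map (SInstr.map κ)).map (SInstr.map ζ) ++ (l₃ ++ l₄).map .gate)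
  refine ⟨⟨Fintype.card Z, prog.map (SInstr.map e.toEmbedding), e (Sum.inl o₁)⟩, ?_, fun C μ => ?_⟩
  · have hm : (loadMem m₁).length = Fintype.card K := by simp [loadMem]
    simp only [List.length_append, List.length_map, hm, List.length_cons, List.length_nil] at hl₁ hl₂ hl₃ hl₄
    simp only [Adversary.size, prog, List.length_append, List.length_map, Z, Fintype.card_sum,
      Fintype.card_unit, Fintype.card_bool]
    omega
  · refine (probZero_map e.toEmbedding (Sum.inl o₁) C prog μ).trans ?_
    obtain ⟨τ₁, e₁, f₁⟩ := h₁ (initState (fun _ => false) zeroState)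
    obtain ⟨τ₂, e₂, f₂⟩ := h₂ τ₁
    -- During the OSP call the simulated memory is idle, so the call acts separately for each memory
    -- content.
    have hmid : serverMap C (((ss₂.map (SInstr.map ι)).map (SInstr.map κ)).map (SInstr.map ζ)) μ (emb τ₂) =
        emb fun m => serverMap C ((ss₂.map (SInstr.map ι)).map (SInstr.map κ)) μ (τ₂ m) := by
      refine eq_of_blk fun w w' => ?_
      rw [blk_emb, blk_serverMap Function.Embedding.inr, blk_emb]
      split_ifs
      · rfl
      · exact (isLinearMap_serverMap _ _ _).map_zero
    obtain ⟨τ₃, e₃, f₃⟩ := h₃ fun m => serverMap C ((ss₂.map (SInstr.map ι)).map (SInstr.map κ)) μ (τ₂ m)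
    obtain ⟨τ₄, e₄, f₄⟩ := h₄ τ₃
    have hall : marg (interact C prog (initState μ zeroState)) = emb τ₄ := by
      rw [show prog = _ from rfl, interact_gates_append, map_initState (isLinearMap_runGates _),
        zeroState_eq_emb, runGates_append, e₁, e₂, marg_interact_append_gates]
      change runGates (l₃ ++ l₄) (serverMap C _ μ (emb τ₂)) = _
      rw [hmid, runGates_append, e₃, e₄]
    rw [probZero_eq, hall, trace_projWire_emb]
    have htr : ∀ m, (τ₄ m).trace = (main τ₄ m).trace := fun m => (trace_extract _ _).symm
    simp only [htr, f₄]
    rw [sum_trace_final o₁ o₂ ho, f₃, probZero_eq, marg, (isLinearMap_projWire _ _).map_fsum,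
      isLinearMap_trace.map_fsum]
    -- Nothing after the flag was written touches it. So restricting to flag `1` can be moved to the
    -- front of the call, where it becomes the condition `m b`.
    have hσ : (fun m => blk ι (fun _ => true) (fun _ => true) (interact cs₃ (ss₃.map (SInstr.map ι))
        (main fun m => serverMap C ((ss₂.map (SInstr.map ι)).map (SInstr.map κ)) μ (τ₂ m)) m)) =
        interact cs₃ ss₃ fun m => serverMap C ss₂ μ
          (if m b then interact cs₁ ss₁ (initState m₁ zeroState) m else 0) := by
      rw [interact_blk_server]
      congr 1
      funext m
      have h1 : main (fun m => serverMap C ((ss₂.map (SInstr.map ι)).map (SInstr.map κ)) μ (τ₂ m)) m =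
          serverMap C (ss₂.map (SInstr.map ι)) μ (main τ₂ m) := extract_serverMap κ C _ μ (τ₂ m)
      rw [h1, blk_serverMap, f₂, interact_send_comm, interact_nil_nil, f₁, interact_locals_append,
        main_initState, locals_loadMem, extract_zeroState]
      congr 1
      refine (blk_setWire_flag (m b) _).trans ?_
      split_ifs
      · have h2 := congrFun (interact_extract ι cs₁ ss₁ (initState m₁ zeroState)) m
        rw [map_initState (isLinearMap_extract _), extract_zeroState] at h2
        exact h2
      · rfl
    refine congrArg Complex.re (Finset.sum_congr rfl fun m _ => ?_)
    rw [trace_projWire_flag, ← hσ]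
    exact congrArg Matrix.trace (blk_projWire ι _ _ out false _)

end

/-! ### Oblivious programs of the client -/

section
variable {K W : Type} [Fintype K] [DecidableEq K] [Fintype W] [DecidableEq W]

/-- The effect of the program on the server does not depend on the client's memory. -/
def Oblivious (cs : List (CInstr K)) : Prop :=
  ∀ {W : Type} [Fintype W] [DecidableEq W] (ss : List (SInstr W)) (σ σ' : JState K W),
    marg σ = marg σ' → marg (interact cs ss σ) = marg (interact cs ss σ')

theorem marg_pushMem (f : (K → Bool) → (K → Bool)) (σ : JState K W) : marg (pushMem f σ) = marg σ :=
  sum_pushMem f σ (G := fun _ ρ => ρ) fun _ => IsLinearMap.mk (fun _ _ => rfl) fun _ _ => rfl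

theorem marg_clocal (c : CLocal K) (σ : JState K W) : marg (c.apply σ) = marg σ := by
  cases c with
  | const t b => exact marg_pushMem _ _
  | nand i j t => exact marg_pushMem _ _
  | coin t =>
    refine (sum_coin t σ (G := fun _ ρ => ρ) fun _ => IsLinearMap.mk (fun _ _ => rfl) fun _ _ => rfl).trans
      (Finset.sum_congr rfl fun m _ => ?_)
    simp only [Fintype.sum_bool, ← add_smul]
    norm_num

theorem marg_locals (l : List (CLocal K)) (σ : JState K W) : marg (locals l σ) = marg σ := by
  induction l generalizing σ with
  | nil => rfl
  | cons c l ih => exact (ih _).trans (marg_clocal c σ)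

theorem marg_gate (g : Gate W) (σ : JState K W) : marg (fun m => g.apply (σ m)) = g.apply (marg σ) :=
  ((isLinearMap_apply g).map_fsum _ _).symm

theorem marg_toClient (q : W) (i : K) (σ : JState K W) :
    marg (toClient q i σ) = ∑ b, projWire q b (marg σ) := by
  refine (sum_toClient q i σ (G := fun _ ρ => ρ) fun _ => IsLinearMap.mk (fun _ _ => rfl) fun _ _ => rfl).trans ?_
  rw [Finset.sum_comm]
  exact Finset.sum_congr rfl fun b _ => ((isLinearMap_projWire q b).map_fsum _ _).symm

theorem marg_initState (μ : K → Bool) (ρ : Op W) : marg (initState μ ρ) = ρ := by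
  simp [marg, initState]

theorem oblivious_nil : Oblivious ([] : List (CInstr K)) := by
  intro W _ _ ss
  induction ss with
  | nil => intro σ σ' h; rwa [interact_nil_nil, interact_nil_nil]
  | cons s ss ih =>
    intro σ σ' h
    cases s with
    | gate g =>
      rw [interact_nil_gate, interact_nil_gate]
      exact ih _ _ (by rw [marg_gate, marg_gate, h])
    | comm q => rw [interact_nil_comm, interact_nil_comm]; exact ih _ _ h

theorem oblivious_recv (i : K) : Oblivious [CInstr.recv i] := by
  intro W _ _ ss
  induction ss with
  | nil =>
    intro σ σ' h
    rw [interact_recv_nil, interact_recv_nil, interact_nil_nil, interact_nil_nil, marg_clocal,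
      marg_clocal, h]
  | cons s ss ih =>
    intro σ σ' h
    cases s with
    | gate g =>
      rw [interact_gate, interact_gate]
      exact ih _ _ (by rw [marg_gate, marg_gate, h])
    | comm q =>
      rw [interact_recv_comm, interact_recv_comm]
      exact oblivious_nil ss _ _ (by rw [marg_toClient, marg_toClient, h])

theorem Oblivious.append {cs cs' : List (CInstr K)} (h : Oblivious cs) (h' : Oblivious cs') :
    Oblivious (cs ++ cs') := by
  intro W _ _ ss σ σ' e
  rw [interact_append, interact_append]
  exact h' _ _ _ (h _ _ _ e)

theorem oblivious_flatMap {ι : Type} (f : ι → List (CInstr K)) (l : List ι)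
    (h : ∀ a ∈ l, Oblivious (f a)) : Oblivious (l.flatMap f) := by
  induction l with
  | nil => exact oblivious_nil
  | cons a l ih =>
    rw [List.flatMap_cons]
    exact Oblivious.append (h a (by simp)) (ih fun b hb => h b (by simp [hb]))

theorem oblivious_locals (l : List (CLocal K)) : Oblivious (l.map CInstr.loc) := by
  intro W _ _ ss σ σ' h
  rw [← List.append_nil (l.map _), interact_locals_append, interact_locals_append]
  exact oblivious_nil ss _ _ (by rw [marg_locals, marg_locals, h])

/-- The memory may be exchanged for any other, here the all-zero one, so the program acts by a map
of the server's state alone. -/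
theorem Oblivious.marg_interact {cs : List (CInstr K)} (h : Oblivious cs) (ss : List (SInstr W))
    (σ : JState K W) : marg (interact cs ss σ) = serverMap cs ss (fun _ => false) (marg σ) :=
  h ss σ _ (marg_initState _ _).symm

/-- A transmission reveals only cell `a`, so the server's states split by the value of this cell
determine all that follows on its side. -/
theorem marg_interact_send (a : K) (ss : List (SInstr W)) (σ σ' : JState K W)
    (h : ∀ b, (∑ m, if m a = b then σ m else 0) = ∑ m, if m a = b then σ' m else 0) :
    marg (interact [.send a] ss σ) = marg (interact [.send a] ss σ') := by
  have hsum : ∀ σ : JState K W, marg σ = ∑ b, ∑ m, if m a = b then σ m else 0 := fun σ => by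
    rw [Finset.sum_comm]
    simp [marg]
  induction ss generalizing σ σ' with
  | nil =>
    rw [interact_send_nil, interact_send_nil, interact_nil_nil, interact_nil_nil, hsum, hsum σ']
    exact Finset.sum_congr rfl fun b _ => h b
  | cons s ss ih =>
    cases s with
    | gate g =>
      rw [interact_gate, interact_gate]
      refine ih _ _ fun b => ?_
      have hg : ∀ σ : JState K W, (∑ m, if m a = b then g.apply (σ m) else 0) =
          g.apply (∑ m, if m a = b then σ m else 0) := fun σ => by
        rw [(isLinearMap_apply g).map_fsum]
        refine Finset.sum_congr rfl fun m _ => ?_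
        split_ifs
        · rfl
        · exact (isLinearMap_apply g).map_zero.symm
      rw [hg, hg, h]
    | comm q =>
      rw [interact_send_comm, interact_send_comm]
      refine oblivious_nil ss _ _ ?_
      have hs : ∀ σ : JState K W, marg (toServer a q σ) =
          ∑ b, setWire q b (∑ m, if m a = b then σ m else 0) := fun σ => by
        simp only [(isLinearMap_setWire q _).map_fsum]
        rw [Finset.sum_comm]
        refine Finset.sum_congr rfl fun m _ => ?_
        rw [Finset.sum_eq_single (m a)]
        · rw [if_pos rfl]; rfl
        · intro b _ hb
          rw [if_neg hb.symm, (isLinearMap_setWire q b).map_zero]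
        · simp
      rw [hs, hs]
      exact Finset.sum_congr rfl fun b _ => by rw [h b]

/-- Sending a bit masked by a random bit. -/
theorem oblivious_pad (t a : K) (l : List (CLocal K)) (hl : ∀ c ∈ l, c.IsDet) (g : (K → Bool) → Bool)
    (hg : ∀ m b, evalList l (update m t b) a = xor (g m) b) :
    Oblivious (.loc (.coin t) :: (l.map CInstr.loc ++ [.send a])) := by
  intro W _ _ ss σ σ' h
  rw [interact_loc, interact_loc, interact_locals_append, interact_locals_append]
  -- For each memory exactly one value of the coin makes the sent bit equal to `b`. So the bit is
  -- uniform and independent of the server's state.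
  have key : ∀ (σ : JState K W) (b : Bool),
      (∑ m, if m a = b then locals l ((CLocal.coin t).apply σ) m else 0) = (1 / 2 : ℂ) • marg σ := by
    intro σ b
    have hL : ∀ (p : Prop) [Decidable p], IsLinearMap ℂ fun ρ : Op W => if p then ρ else 0 :=
      fun p _ => isLinearMap_ite p (IsLinearMap.mk (fun _ _ => rfl) fun _ _ => rfl)
    rw [locals_eq_pushMem l hl]
    refine (sum_pushMem (evalList l) _ (G := fun m ρ => if m a = b then ρ else 0) fun _ => hL _).trans ?_
    refine (sum_coin t σ (G := fun m ρ => if evalList l m a = b then ρ else 0) fun _ => hL _).trans ?_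
    rw [marg, Finset.smul_sum]
    refine Finset.sum_congr rfl fun m _ => ?_
    simp only [hg, Fintype.sum_bool]
    cases g m <;> cases b <;> simp
  exact marg_interact_send a ss _ _ fun b => by rw [key, key, h]

end

/-! ### Calls of an OSP protocol -/

section
variable {k N k' : ℕ} {W : Type} [Fintype W] [DecidableEq W]

/-- For a fixed content `u` of the first `k` cells, the block of the state is that of an isolated
run of `cs` with initial memory `μ u`. The sum over `u` is the marginal. -/
theorem marg_interact_natAdd (cs : List (CInstr (Fin k'))) (ss : List (SInstr W))
    (μ : (Fin k → Bool) → (Fin k' → Bool)) (σ : JState (Fin (k + k')) W) :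
    marg (interact (cs.map (CInstr.map (Fin.natAdd k))) ss
        (pushMem (fun M => Fin.append (M ∘ Fin.castAdd k') (μ (M ∘ Fin.castAdd k'))) σ)) =
      ∑ M, serverMap cs ss (μ (M ∘ Fin.castAdd k')) (σ M) := by
  set τ : JState (Fin (k + k')) W :=
    pushMem (fun M => Fin.append (M ∘ Fin.castAdd k') (μ (M ∘ Fin.castAdd k'))) σ with hτ
  have hrefl : ∀ (e e' : W → Bool) (ρ : Op W), blk (Function.Embedding.refl W) e e' ρ = ρ := by
    intro e e' ρ
    ext a a'
    simp [blk, extend_refl]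
  have h1 : ∀ u : Fin k → Bool, (fun v => τ (Fin.append u v)) =
      ∑ M, if M ∘ Fin.castAdd k' = u then initState (μ u) (σ M) else 0 := by
    intro u
    funext v
    rw [hτ, Finset.sum_apply]
    refine Finset.sum_congr rfl fun M _ => ?_
    simp only [append_inj]
    by_cases h : M ∘ Fin.castAdd k' = u
    · subst h
      simp [initState, eq_comm]
    · simp [h]
  have h2 : ∀ u : Fin k → Bool, ∑ v, interact (cs.map (CInstr.map (Fin.natAdd k))) ss τ (Fin.append u v) =
      ∑ M, if M ∘ Fin.castAdd k' = u then serverMap cs ss (μ u) (σ M) else 0 := by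
    intro u
    have hb := interact_blk (Fin.natAddEmb k) (Function.Embedding.refl W)
      (Fin.append u fun _ : Fin k' => false) (fun _ => false) (fun _ => false) cs ss τ
    rw [map_refl_server] at hb
    have hc : ∀ σ : JState (Fin (k + k')) W, blkJ (Fin.natAddEmb k) (Function.Embedding.refl W)
        (Fin.append u fun _ : Fin k' => false) (fun _ => false) (fun _ => false) σ =
        fun v => σ (Fin.append u v) := fun σ => by
      funext v
      rw [blkJ, hrefl, extend_natAddEmb, append_comp_castAdd]
    rw [hc, hc, h1] at hb
    have hL := isLinearMap_marg.compose (isLinearMap_interact (K := Fin k') cs ss)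
    have := congrArg marg hb
    refine this.trans ((hL.map_fsum _ _).trans (Finset.sum_congr rfl fun M _ => ?_))
    split_ifs
    · rfl
    · exact hL.map_zero
  rw [marg, sum_append, Finset.sum_congr rfl fun u _ => h2 u, Finset.sum_comm]
  simp

/-- The program of the client with the input of OSP calls replaced by `0`. -/
def HInstr.zeroC (P : OSPProtocol) : HInstr k N → List (CInstr (Fin (k + P.k)))
  | .osp _ s _ => ((List.finRange P.k).map (fun j => CLocal.const (Fin.natAdd k j) false)).map .loc ++
      (P.client.map (CInstr.map (Fin.natAdd k)) ++ (postLocals P s).map .loc)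
  | H => H.toC P

/-- Cleared cells already encode the input `0`, so the zeroed program can simply omit the copying of
the input bit. -/
theorem initMem_false (P : OSPProtocol) : P.initMem false = fun _ => false := by
  simp [OSPProtocol.initMem]

theorem marg_interact_toC_osp (P : OSPProtocol) (b s : Fin k) (q : Fin N) (ss : List (SInstr W))
    (σ : JState (Fin (k + P.k)) W) :
    marg (interact ((HInstr.osp b s q).toC P) ss σ) =
      ∑ M, serverMap P.client ss (P.initMem (M (Fin.castAdd P.k b))) (σ M) := by
  rw [toC_osp, interact_locals_append, interact_append_locals, marg_locals, pushMem_pre]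
  exact marg_interact_natAdd P.client ss (fun u => P.initMem (u b)) σ

theorem marg_interact_zeroC_osp (P : OSPProtocol) (b s : Fin k) (q : Fin N) (ss : List (SInstr W))
    (σ : JState (Fin (k + P.k)) W) :
    marg (interact ((HInstr.osp b s q).zeroC P) ss σ) =
      serverMap P.client ss (P.initMem false) (marg σ) := by
  have hl : locals ((List.finRange P.k).map fun j => CLocal.const (Fin.natAdd k j) false) σ =
      pushMem (fun M => Fin.append (M ∘ Fin.castAdd P.k) (P.initMem false)) σ := by
    rw [locals_eq_pushMem]
    · congr 1
      funext M
      rw [evalList_const_false, initMem_false]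
      funext i
      refine Fin.addCases (fun i => ?_) (fun i => ?_) i
      · have h1 : ∀ x : Fin P.k, Fin.natAdd k x ≠ Fin.castAdd P.k i :=
          fun x e => castAdd_ne_natAdd i x e.symm
        simp [h1]
      · simp
    · intro c hc
      simp only [List.mem_map] at hc
      obtain ⟨j, _, rfl⟩ := hc
      trivial
  rw [HInstr.zeroC, interact_locals_append, interact_append_locals, marg_locals, hl]
  refine (marg_interact_natAdd P.client ss (fun _ => P.initMem false) σ).trans ?_
  rw [marg, (isLinearMap_serverMap _ _ _).map_fsum]

/-- Local steps and received bits only change the memory, and a zeroed OSP call does not read it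
before sending. A bit sent in the clear would depend on the memory, hence the exclusion of
`toServer`. -/
theorem oblivious_zeroC (P : OSPProtocol) (H : HInstr k N) (hH : ∀ i q, H ≠ .toServer i q) :
    Oblivious (H.zeroC P) := by
  cases H with
  | client c => exact oblivious_locals [c.map (Fin.castAdd P.k)]
  | server g => exact oblivious_nil
  | toServer i q => exact absurd rfl (hH i q)
  | toClient q i => exact oblivious_recv _
  | osp b s q =>
    intro W _ _ ss σ σ' h
    rw [marg_interact_zeroC_osp, marg_interact_zeroC_osp, h]

theorem length_toC_le (P : OSPProtocol) (H : HInstr k N) : (H.toC P).length ≤ P.toProtocol.size + 4 := by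
  cases H <;> simp [HInstr.toC, copyBit, Protocol.size]
  omega

theorem length_zeroC_le (P : OSPProtocol) (H : HInstr k N) :
    (H.zeroC P).length ≤ P.toProtocol.size + 4 := by
  cases H <;> simp [HInstr.zeroC, HInstr.toC, postLocals, Protocol.size]
  omega

theorem length_takeComm_add (n : ℕ) (ss : List (SInstr W)) :
    (takeComm n ss).length + (dropComm n ss).length = ss.length := by
  rw [← List.length_append, takeComm_append_dropComm]

/-- Replacing the input of one OSP call by `0` is an attack on OSP. -/
theorem exists_hybrid_step (P : OSPProtocol) (A : Adversary) (p p' : List (HInstr k N)) (b s : Fin k)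
    (q : Fin N) (hp' : ∀ H ∈ p', ∀ i q, H ≠ .toServer i q) (o₁ o₂ : Fin (k + P.k)) (ho : o₁ ≠ o₂)
    (m₀ : Fin (k + P.k) → Bool) :
    ∃ R : Adversary, R.size ≤ 210 + 26 * (k + P.k + A.size +
        (P.toProtocol.size + 4) * (p.length + p'.length)) ∧
      A.prob (p.flatMap (HInstr.toC P) ++ ((HInstr.osp b s q).toC P ++ p'.flatMap (HInstr.zeroC P))) m₀ -
        A.prob (p.flatMap (HInstr.toC P) ++ ((HInstr.osp b s q).zeroC P ++ p'.flatMap (HInstr.zeroC P))) m₀ =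
      R.prob P.client (P.initMem true) - R.prob P.client (P.initMem false) := by
  set cs₁ := p.flatMap (HInstr.toC P) with hcs₁
  set cs₃ := p'.flatMap (HInstr.zeroC P) with hcs₃
  have hobl : Oblivious cs₃ := oblivious_flatMap _ _ fun H hH => oblivious_zeroC P H (hp' H hH)
  set n₁ := cs₁.countP CInstr.isComm
  set n₂ := P.client.countP CInstr.isComm
  set ss₁ := takeComm n₁ A.prog
  set ss₂ := takeComm n₂ (dropComm n₁ A.prog)
  set ss₃ := dropComm n₂ (dropComm n₁ A.prog)
  obtain ⟨R, hR, hprob⟩ := exists_reduction cs₁ cs₃ ss₁ ss₂ ss₃ (Fin.castAdd P.k b) o₁ o₂ ho A.out m₀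
  have hn : ((HInstr.osp b s q).toC P).countP CInstr.isComm = n₂ := by
    rw [toC_osp, List.countP_append, List.countP_append, countP_map_client]
    simp [preLocals, postLocals, CInstr.isComm, List.countP_eq_zero, n₂]
  have hn' : ((HInstr.osp b s q).zeroC P).countP CInstr.isComm = n₂ := by
    rw [HInstr.zeroC, List.countP_append, List.countP_append, countP_map_client]
    simp [postLocals, CInstr.isComm, List.countP_eq_zero, n₂]
  refine ⟨R, ?_, ?_⟩
  · have h1 := QCircuit.length_flatMap_le _ (length_toC_le (N := N) P) p
    have h2 := QCircuit.length_flatMap_le _ (length_zeroC_le (N := N) P) p'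
    have h3 := length_takeComm_add n₁ A.prog
    have h4 := length_takeComm_add n₂ (dropComm n₁ A.prog)
    have h5 : A.size = A.N + A.prog.length := rfl
    simp only [Fintype.card_fin] at hR
    rw [mul_add (P.toProtocol.size + 4)]
    change cs₁.length ≤ _ at h1
    change cs₃.length ≤ _ at h2
    change ss₁.length + _ = _ at h3
    change ss₂.length + ss₃.length = _ at h4
    omega
  · set σ₁ := interact cs₁ ss₁ (initState m₀ zeroState) with hσ₁
    have hA : A.prob (cs₁ ++ ((HInstr.osp b s q).toC P ++ cs₃)) m₀ =
        (projWire A.out false (serverMap cs₃ ss₃ (fun _ => false)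
          (∑ M, serverMap P.client ss₂ (P.initMem (M (Fin.castAdd P.k b))) (σ₁ M)))).trace.re := by
      rw [Adversary.prob, probZero_eq, interact_append, interact_append, Oblivious.marg_interact hobl, hn,
        marg_interact_toC_osp]
    have hA' : A.prob (cs₁ ++ ((HInstr.osp b s q).zeroC P ++ cs₃)) m₀ =
        (projWire A.out false (serverMap cs₃ ss₃ (fun _ => false)
          (∑ M, serverMap P.client ss₂ (P.initMem false) (σ₁ M)))).trace.re := by
      rw [Adversary.prob, probZero_eq, interact_append, interact_append, Oblivious.marg_interact hobl, hn',
        marg_interact_zeroC_osp, marg, (isLinearMap_serverMap _ _ _).map_fsum]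
    have hB : ∀ β, R.prob P.client (P.initMem β) =
        (projWire A.out false (serverMap cs₃ ss₃ (fun _ => false)
          (∑ M, serverMap P.client ss₂ (P.initMem β)
            (if M (Fin.castAdd P.k b) then σ₁ M else 0)))).trace.re := fun β => by
      rw [hprob, probZero_eq, Oblivious.marg_interact hobl, marg]
    have hL := (isLinearMap_trace (I := Fin A.N → Bool)).compose ((isLinearMap_projWire A.out false).compose
      (isLinearMap_serverMap cs₃ ss₃ fun _ => false))
    have hsub : ∀ X Y, (projWire A.out false (serverMap cs₃ ss₃ (fun _ => false) X)).trace.re -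
        (projWire A.out false (serverMap cs₃ ss₃ (fun _ => false) Y)).trace.re =
        (projWire A.out false (serverMap cs₃ ss₃ (fun _ => false) (X - Y))).trace.re := fun X Y => by
      rw [← Complex.sub_re]
      exact congrArg Complex.re (hL.map_sub X Y).symm
    rw [hA, hA', hB, hB, hsub, hsub, ← Finset.sum_sub_distrib, ← Finset.sum_sub_distrib]
    congr 5
    funext M
    -- Memories with input bit `0` are treated alike in both hybrids and are suppressed by the
    -- reduction; for input bit `1` the two differences agree term by term.
    cases hM : M (Fin.castAdd P.k b)
    · simp [(isLinearMap_serverMap _ _ _).map_zero]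
    · simp

/-- Replacing the inputs of all OSP calls by `0`. -/
theorem exists_hybrid (P : OSPProtocol) (A : Adversary) (p p' : List (HInstr k N))
    (hp' : ∀ H ∈ p', ∀ i q, H ≠ .toServer i q) (o₁ o₂ : Fin (k + P.k)) (ho : o₁ ≠ o₂)
    (m₀ : Fin (k + P.k) → Bool) :
    ∃ R : Adversary, R.size ≤ 210 + 26 * (k + P.k + A.size +
        (P.toProtocol.size + 4) * (p.length + p'.length)) ∧
      |A.prob (p.flatMap (HInstr.toC P) ++ p'.flatMap (HInstr.toC P)) m₀ -
        A.prob (p.flatMap (HInstr.toC P) ++ p'.flatMap (HInstr.zeroC P)) m₀| ≤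
      p'.length * |R.prob P.client (P.initMem false) - R.prob P.client (P.initMem true)| := by
  induction p' generalizing p with
  -- Nothing is replaced, so any adversary will do.
  | nil => exact ⟨⟨1, [], 0⟩, by simp only [Adversary.size, List.length_nil]; omega, by simp⟩
  | cons H p' ih =>
    -- The later calls are replaced first, with `H` still in the real prefix; what follows `H` is
    -- then oblivious.
    obtain ⟨R, hR, h⟩ := ih (p ++ [H]) fun H' hH' => hp' H' (by simp [hH'])
    have hlen : (p ++ [H]).length + p'.length = p.length + (H :: p').length := by
      simp only [List.length_append, List.length_cons, List.length_nil]; omega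
    rw [hlen] at hR
    simp only [List.flatMap_append, List.flatMap_cons, List.flatMap_nil, List.append_nil,
      List.append_assoc] at h ⊢
    by_cases hH : ∃ b s q, H = .osp b s q
    · obtain ⟨b, s, q, rfl⟩ := hH
      obtain ⟨R', hR', h'⟩ := exists_hybrid_step P A p p' b s q
        (fun H' hH' => hp' H' (by simp [hH'])) o₁ o₂ ho m₀
      have hR'' : R'.size ≤ 210 + 26 * (k + P.k + A.size +
          (P.toProtocol.size + 4) * (p.length + (HInstr.osp b s q :: p').length)) :=
        hR'.trans (by
          have : (P.toProtocol.size + 4) * (p.length + p'.length) ≤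
              (P.toProtocol.size + 4) * (p.length + (HInstr.osp b s q :: p').length) :=
            Nat.mul_le_mul_left _ (by simp only [List.length_cons]; omega)
          omega)
      have habs := abs_sub_le (A.prob (p.flatMap (HInstr.toC P) ++
        ((HInstr.osp b s q).toC P ++ p'.flatMap (HInstr.toC P))) m₀)
        (A.prob (p.flatMap (HInstr.toC P) ++ ((HInstr.osp b s q).toC P ++ p'.flatMap (HInstr.zeroC P))) m₀)
        (A.prob (p.flatMap (HInstr.toC P) ++ ((HInstr.osp b s q).zeroC P ++ p'.flatMap (HInstr.zeroC P))) m₀)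
      rw [h', abs_sub_comm (R'.prob _ _)] at habs
      have hcast : (((HInstr.osp b s q :: p').length : ℕ) : ℝ) = p'.length + 1 := by simp
      rw [hcast]
      -- Keeping the better of the two attacks lets a single receiver account for all calls.
      rcases le_total |R.prob P.client (P.initMem false) - R.prob P.client (P.initMem true)|
        |R'.prob P.client (P.initMem false) - R'.prob P.client (P.initMem true)| with hle | hle
      · refine ⟨R', hR'', habs.trans ((add_le_add_left h _).trans ?_)⟩
        have := mul_le_mul_of_nonneg_left hle (Nat.cast_nonneg (α := ℝ) p'.length)
        linarith
      · refine ⟨R, hR, habs.trans ((add_le_add_left h _).trans ?_)⟩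
        linarith
    · have hz : H.zeroC P = H.toC P := by
        cases H with
        | osp b s q => exact absurd ⟨b, s, q, rfl⟩ hH
        | _ => rfl
      rw [hz]
      refine ⟨R, hR, h.trans ?_⟩
      have h0 := abs_nonneg (R.prob P.client (P.initMem false) - R.prob P.client (P.initMem true))
      have hcast : (((H :: p').length : ℕ) : ℝ) = p'.length + 1 := by simp
      rw [hcast]
      linarith

end

/-! ### Blindness -/

namespace QCircuit

variable {Q : QCircuit}

/-- A cell of the client in the expansion of the template. -/
def cell (P : OSPProtocol) (c : Q.Cell) : Fin (Q.numCells + P.k) := Fin.castAdd P.k (Q.cellEquiv c)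

theorem cell_injective (P : OSPProtocol) : Function.Injective (cell P : Q.Cell → _) :=
  (Fin.castAdd_injective _ _).comp Q.cellEquiv.injective

theorem flatMap_toC_clients (P : OSPProtocol) (l : List (CLocal Q.Cell)) :
    (clients l).flatMap (HInstr.toC P) = (l.map (CLocal.map (cell P))).map .loc := by
  induction l with
  | nil => rfl
  | cons c l ih =>
    change HInstr.toC P (.client (c.map Q.cellEquiv)) ++ (clients l).flatMap (HInstr.toC P) = _
    rw [ih]
    cases c <;> rfl

/-- The bit sent is the input bit masked by a key drawn just before, so `oblivious_pad` applies. -/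
theorem oblivious_inputBlock (P : OSPProtocol) (i : Fin Q.n) :
    Oblivious ((inputBlock i).flatMap (HInstr.toC P)) := by
  rw [inputBlock, List.flatMap_append, List.flatMap_append, flatMap_toC_clients, flatMap_toC_clients]
  refine oblivious_pad (cell P (keyX (.inl i))) (cell P (auxCell 0)) _ ?_ (fun m => m (cell P (inCell i))) ?_
  · intro c hc
    obtain ⟨d, hd, rfl⟩ := List.mem_map.1 hc
    simp only [List.mem_cons, List.mem_append] at hd
    have : d.IsDet := by
      rcases hd with rfl | hd | hd
      · trivial
      · exact isDet_xorInto d hd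
      · exact isDet_xorInto d hd
    cases d with
    | coin t => exact this.elim
    | _ => trivial
  · intro m b
    have h := congrFun (evalList_map (cell_injective P) (.const (auxCell 0) false ::
      (xorInto (auxCell 0) (inCell i) (auxCell 2) ++ xorInto (auxCell 0) (keyX (.inl i)) (auxCell 2)))
      (update m (cell P (keyX (.inl i))) b)) (auxCell 0)
    rw [Function.update_comp_eq_of_injective m (cell_injective P)] at h
    refine h.trans ?_
    simp [evalList, xorInto, CLocal.eval]
    cases m (cell P (inCell i)) <;> cases b <;> rfl

theorem ne_toServer_of_mem_gateBlock (g : Gate Q.Wire) : ∀ H ∈ gateBlock g, ∀ i q, H ≠ .toServer i q := by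
  have hc : ∀ l : List (CLocal Q.Cell), ∀ H ∈ clients l, ∀ i q, H ≠ .toServer i q := by
    intro l H hH i q e
    obtain ⟨c, _, rfl⟩ := List.mem_map.1 hH
    cases e
  intro H hH i q
  rcases List.mem_cons.1 hH with rfl | hH
  · exact fun e => by cases e
  · rcases List.mem_append.1 hH with hH | hH
    · cases g with
      | tdg w =>
        rintro rfl
        simp [correction] at hH
      | _ => cases hH
    · exact hc _ H hH i q

/-- The views of an adversary for two initial memories of the client differ by its advantages in attacks on OSP. -/
theorem exists_attacks (P : OSPProtocol) (A : Adversary) (m₀ m₁ : Fin (Q.numCells + P.k) → Bool) :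
    ∃ R : Bool → Adversary, (∀ b, (R b).size ≤ 210 + 26 * (Q.numCells + P.k + A.size +
        (P.toProtocol.size + 4) * Q.template.prog.length)) ∧
      |A.prob (Q.template.prog.flatMap (HInstr.toC P)) m₀ -
        A.prob (Q.template.prog.flatMap (HInstr.toC P)) m₁| ≤
      Q.template.prog.length *
        (|(R false).prob P.client (P.initMem false) - (R false).prob P.client (P.initMem true)| +
          |(R true).prob P.client (P.initMem false) - (R true).prob P.client (P.initMem true)|) := by
  set p := (List.finRange Q.n).flatMap inputBlock
  set p' := Q.gates.flatMap gateBlock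
  have hp' : ∀ H ∈ p', ∀ i q, H ≠ .toServer i q := fun H hH => by
    obtain ⟨g, _, hg⟩ := List.mem_flatMap.1 hH
    exact ne_toServer_of_mem_gateBlock g H hg
  have hlen : Q.template.prog.length = p.length + p'.length := List.length_append
  have hclient : Q.template.prog.flatMap (HInstr.toC P) =
      p.flatMap (HInstr.toC P) ++ p'.flatMap (HInstr.toC P) := List.flatMap_append
  have ho : cell P (auxCell 0) ≠ cell P (auxCell 1 : Q.Cell) := fun h => by
    simpa using cell_injective P h
  have hobl : Oblivious (p.flatMap (HInstr.toC P) ++ p'.flatMap (HInstr.zeroC P)) := by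
    refine Oblivious.append ?_ (oblivious_flatMap _ _ fun H hH => oblivious_zeroC P H (hp' H hH))
    rw [List.flatMap_assoc]
    exact oblivious_flatMap _ _ fun i _ => oblivious_inputBlock P i
  obtain ⟨R₀, hR₀, h₀⟩ := exists_hybrid P A p p' hp' _ _ ho m₀
  obtain ⟨R₁, hR₁, h₁⟩ := exists_hybrid P A p p' hp' _ _ ho m₁
  -- With all calls zeroed the whole program is oblivious, so the two inputs give identical views.
  -- Each input then contributes one chain of hybrids, hence the two attacks.
  have hmid : A.prob (p.flatMap (HInstr.toC P) ++ p'.flatMap (HInstr.zeroC P))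
        m₀ =
      A.prob (p.flatMap (HInstr.toC P) ++ p'.flatMap (HInstr.zeroC P))
        m₁ := by
    rw [Adversary.prob, Adversary.prob, probZero_eq, probZero_eq,
      hobl A.prog _ _ ((marg_initState _ _).trans (marg_initState _ _).symm)]
  refine ⟨fun b => if b then R₁ else R₀, fun b => ?_, ?_⟩
  · rw [hlen]
    cases b
    · exact hR₀
    · exact hR₁
  · rw [hclient, hlen]
    change _ ≤ _ * (|R₀.prob _ _ - R₀.prob _ _| + |R₁.prob _ _ - R₁.prob _ _|)
    have h := abs_sub_le (A.prob (p.flatMap (HInstr.toC P) ++ p'.flatMap (HInstr.toC P))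
      m₀) (A.prob (p.flatMap (HInstr.toC P) ++ p'.flatMap (HInstr.zeroC P))
        m₀) (A.prob (p.flatMap (HInstr.toC P) ++ p'.flatMap (HInstr.toC P))
      m₁)
    rw [hmid, abs_sub_comm (A.prob (p.flatMap (HInstr.toC P) ++ p'.flatMap (HInstr.zeroC P)) _)] at h
    have hmul := mul_le_mul_of_nonneg_right
      (show (p'.length : ℝ) ≤ ((p.length + p'.length : ℕ) : ℝ) by exact_mod_cast Nat.le_add_left _ _)
      (add_nonneg (abs_nonneg (R₀.prob P.client (P.initMem false) - R₀.prob P.client (P.initMem true)))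
        (abs_nonneg (R₁.prob P.client (P.initMem false) - R₁.prob P.client (P.initMem true))))
    rw [mul_add] at hmul
    rw [hmid] at h₀
    exact (h.trans (add_le_add h₀ h₁)).trans hmul

end QCircuit

theorem negligible_advantage {P : ℕ → OSPProtocol} (hP : IsOSP P) (Q : ℕ → QCircuit)
    (hQ : PolyBounded fun l => (Q l).size) (A : ℕ → Adversary) (hA : PolyBounded fun l => (A l).size)
    (x₀ x₁ : (l : ℕ) → Fin (Q l).n → Bool) :
    Negligible fun l =>
      |(A l).prob ((Q l).template.expand (P l)).client (((Q l).template.expand (P l)).initMem (x₀ l)) -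
        (A l).prob ((Q l).template.expand (P l)).client
          (((Q l).template.expand (P l)).initMem (x₁ l))| := by
  -- Adversaries are non-uniform, so receivers chosen separately for each security parameter form an
  -- admissible family.
  choose R hR h using fun l => QCircuit.exists_attacks (Q := Q l) (P l) (A l)
    (((Q l).template.expand (P l)).initMem (x₀ l)) (((Q l).template.expand (P l)).initMem (x₁ l))
  have hprog : PolyBounded fun l => (Q l).template.prog.length :=
    ((PolyBounded.const 21).mul hQ).mono fun l => (Q l).length_prog_template
  have hsize : ∀ b, PolyBounded fun l => (R l b).size := fun b =>
    ((PolyBounded.const 210).add ((PolyBounded.const 26).mul (((((PolyBounded.const 3).mul hQ).add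
      (PolyBounded.const 3)).add hP.poly).add hA |>.add
        ((hP.poly.add (PolyBounded.const 4)).mul hprog)))).mono fun l => (hR l b).trans (by
      have h1 := (Q l).numCells_le
      have h2 : (P l).k ≤ (P l).toProtocol.size := by unfold Protocol.size; omega
      gcongr)
  exact (((hP.secure _ (hsize false)).add (hP.secure _ (hsize true))).polyMul hprog).mono h

end OSP

end

theorem mainTheorem4 :
    ∃ T : (Q : OSP.QCircuit) → OSP.Template Q,
      (∀ Q : OSP.QCircuit, (T Q).ospCalls = Q.tCount) ∧
      ∀ P : ℕ → OSP.OSPProtocol, OSP.IsOSP P →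
        OSP.IsBlindDelegation (fun l Q => (T Q).expand (P l)) :=
  ⟨fun Q => Q.template, OSP.QCircuit.ospCalls_template, fun _ hP =>
    ⟨OSP.exists_size_expand_le hP.poly, OSP.diamondDist_real_ideal hP, OSP.negligible_advantage hP⟩⟩
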